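/- **Setting.** Algorithms are (uniform) quantum polynomial-time (QPT) algorithms, and every algorithm also receives the security parameter $1^n$. An untelegraphable secret-key encryption scheme consists of QPT algorithms: $\mathsf{Gen}(1^n)$ outputs an encryption key $\mathsf{ek}$ and a decryption key $\mathsf{dk}$ (classical strings; a scheme with a single secret key has $\mathsf{ek}=\mathsf{dk}=\mathsf{sk}$); $\mathsf{Enc}(\mathsf{ek},m)$ outputs a quantum ciphertext, possibly with a classical part; $\mathsf{Dec}(\mathsf{dk},\mathsf{ct})$ outputs a message. For a bit $b$ and a pair $(\mathcal A,\mathcal B)$ of QPT algorithms consider the following game. Keys are sampled. The first-stage adversary $\mathcal A(1^n)$ adaptively makes queries $(m_0,m_1)$ with $m_0,m_1$ in the message space $\mathcal M_n$ and receives for each a fresh $\mathsf{Enc}(\mathsf{ek},m_b)$. Then $\mathcal A$ outputs a classical string $\mathsf{st}$, and the second-stage adversary $\mathcal B$, given only $1^n$, $\mathsf{st}$ and $\mathsf{dk}$, outputs a bit $b_{\mathcal B}$. The scheme is *collusion-resistant* if for all QPT $(\mathcal A,\mathcal B)$ the quantity $\bigl|\Pr[b_{\mathcal B}=1\mid b=0]-\Pr[b_{\mathcal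 B}=1\mid b=1]\bigr|$ is negligible in $n$; it is *(one-time) indistinguishability secure* if this holds for all QPT $(\mathcal A,\mathcal B)$ where $\mathcal A$ makes at most one query. A secret-key non-committing encryption scheme for receiver (SK-NCER) with message space $\mathcal K=\{\mathcal K_n\}$ consists of efficient (QPT) algorithms with classical inputs and outputs: $\mathsf{KG}(1^n)\to(\mathsf{ek},\mathsf{dk})$, $\mathsf{Enc}(\mathsf{ek},m)\to\mathsf{ct}$, $\mathsf{Dec}(\mathsf{dk},\mathsf{ct})\to m$, $\mathsf{Fake}(\mathsf{ek})\to(\mathsf{ct},\mathsf{st})$, $\mathsf{Reveal}(\mathsf{st},m)\to\mathsf{dk}^*$. It has *non-committing security* if every QPT adversary has negligible advantage in distinguishing $b=0$ from $b=1$ in the following game. Keys $(\mathsf{ek},\mathsf{dk})\gets\mathsf{KG}(1^n)$ are sampled; the adversary makes, in any order, arbitrarily many encryption queries $m\in\mathcal K_n$, answered by $\mathsf{Enc}(\mathsf{ek},m)$, and at most one challenge query $m^*\in\mathcal K_n$, answered by $(\mathsf{Enc}(\mathsf{ek},m^*),\mathsf{dk})$ if $b=0$, and by $(\mathsf{ct}^*,\mathsf{Reveal}(\mathsf{st},m^*))$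 with $(\mathsf{ct}^*,\mathsf{st})\gets\mathsf{Fake}(\mathsf{ek})$ if $b=1$; finally it outputs a bit. **Construction.** Let $\Pi_{\mathsf{1UTE}}$ be a single-key untelegraphable secret-key encryption scheme with message space $\mathcal M$ and key space $\mathcal K$, and let $\Pi_{\mathsf{NCE}}$ be an SK-NCER scheme with message space $\mathcal K$. Define the scheme $\Pi_{\mathsf{UTE}}$ as follows. - $\mathsf{Gen}(1^n)$ outputs $(\mathsf{ek},\mathsf{dk})\gets\mathsf{NCE.KG}(1^n)$. - $\mathsf{Enc}(\mathsf{ek},m)$ samples $\mathsf{sk}\gets\mathsf{1UTE.Gen}(1^n)$ and outputs $\bigl(\mathsf{1UTE.Enc}(\mathsf{sk},m),\ \mathsf{NCE.Enc}(\mathsf{ek},\mathsf{sk})\bigr)$. - $\mathsf{Dec}(\mathsf{dk},(\mathsf{ct}_1,\mathsf{ct}_2))$ outputs $\mathsf{1UTE.Dec}\bigl(\mathsf{NCE.Dec}(\mathsf{dk},\mathsf{ct}_2),\mathsf{ct}_1\bigr)$. **Theorem (Collusion-Resistant Security).** Suppose that $\Pi_{\mathsf{1UTE}}$ satisfies (one-time,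 computational) indistinguishability security and that $\Pi_{\mathsf{NCE}}$ satisfies non-committing security against QPT adversaries. Then the algorithms of $\Pi_{\mathsf{UTE}}$ are QPT, and $\Pi_{\mathsf{UTE}}$ satisfies collusion-resistant security with message space $\mathcal M$. -/

import Mathlib

/-!
# Quantum programs with classical control

The machine model is a structured programming language with classical control and quantum data.
A register holds a classical bit string together with a string (a stack) of qubits. All qubits
start in the state `|0⟩`; the gates are Hadamard, `T` and controlled-not (a universal set), applied
to the tops of the stacks; measurement is in the computational basis. Control flow is classical:
sequencing, branching on a bit, and iterating a block as many times as a given string is long.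
Every polynomial-time classically controlled quantum computation can be written in this way.
A program may call oracles, named by a type `O`; a program without oracles has `O = Empty`.
-/

/-- Contents of all registers: one bit string for every register. -/
abbrev Store (R : Type) : Type := R → List Bool

/-- Self-delimiting code of a pair of bit strings. -/
def pairCode : List Bool → List Bool → List Bool
  | [], y => false :: y
  | b :: x, y => true :: b :: pairCode x y

/-- Decoding of `pairCode`; strings that are no codes are sent to an arbitrary value. -/
def unpairCode : List Bool → List Bool × List Bool
  | false :: y => ([], y)
  | true :: b :: z => (b :: (unpairCode z).1, (unpairCode z).2)
  | _ => ([], [])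

theorem unpairCode_pairCode (x y : List Bool) : unpairCode (pairCode x y) = (x, y) := by
  induction x with
  | nil => simp [pairCode, unpairCode]
  | cons b x ih => simp [pairCode, unpairCode, ih]

/-- Elementary instructions. -/
inductive Instr (R : Type) : Type
  /-- put the bit `b` in front of the string in `r` -/
  | push (b : Bool) (r : R)
  /-- delete the first bit of the string in `r` -/
  | pop (r : R)
  /-- overwrite the string in `r` by the string in `s` -/
  | copy (r s : R)
  /-- keep only the first `|s|` bits of the string in `r` -/
  | cut (r s : R)
  /-- overwrite the string in `r` by the code of the pair of the strings in `s` and `t` -/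
  | pair (r s t : R)
  /-- decode the string in `t` as a pair and write its components into `r` and `s` -/
  | unpair (r s t : R)
  /-- put a new qubit in state `|0⟩` on top of `r` -/
  | qnew (r : R)
  /-- Hadamard gate on the top qubit of `r` -/
  | had (r : R)
  /-- the gate `diag(1, exp(iπ/4))` on the top qubit of `r` -/
  | tgate (r : R)
  /-- controlled-not; control: top qubit of `r`, target: top qubit of `s` -/
  | cnot (r s : R)
  /-- move the top qubit of `r` to the top of `s` -/
  | qmove (r s : R)
  /-- exchange the qubit strings of `r` and `s` -/
  | qswap (r s : R)
  /-- remove and measure the top qubit of `r`, put the outcome in front of the string in `s` -/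
  | meas (r s : R)
  /-- put the bit "the qubit string of `r` is non-empty" in front of the string in `s` -/
  | qtest (r s : R)
  /-- erase the classical and discard (trace out) the quantum contents of all registers in `S`;
  a program uses finitely many registers, so only finitely many elements of `S` matter -/
  | reset (S : Set R)

/-- Programs over the registers `R` with oracles `O`. -/
inductive Prog (R O : Type) : Type
  | skip
  | instr (i : Instr R)
  | seq (p q : Prog R O)
  /-- run `p` if the string in `r` starts with the bit `1`, and `q` otherwise -/
  | ite (r : R) (p q : Prog R O)
  /-- run `p` as many times as the string in `r` is long when the loop is entered -/
  | loop (r : R) (p : Prog R O)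
  | query (o : O)

infixr:60 " ;; " => Prog.seq

/-! ## Semantics: density operators -/

/-- The index `(cl, ket, bra)` of a matrix entry `|ket⟩⟨bra|` of the (unnormalised) density operator
of the qubits, on the part of the mixture where the classical memory is `cl`. -/
structure Cfg (R : Type) : Type where
  cl : Store R
  ket : Store R
  bra : Store R

/-- A classical-quantum state: the family of its matrix entries. -/
abbrev CQState (R : Type) : Type := Cfg R →₀ ℂ

noncomputable section

/-- Linear extension of a map that is given on the matrix units. -/
def CQState.bind {R : Type} (d : CQState R) (f : Cfg R → CQState R) : CQState R :=
  d.sum fun c z => z • f c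

def hadamardEntry (a b : Bool) : ℂ := (if a && b then -1 else 1) / (Real.sqrt 2 : ℂ)

def tEntry (b : Bool) : ℂ := if b then Complex.exp (Complex.I * (Real.pi / 4)) else 1

/-- Image of the matrix unit `c` under `ρ ↦ V ρ V†`, for `V` given on basis vectors. -/
def Cfg.conjugate {R : Type} (V : Store R → (Store R →₀ ℂ)) (c : Cfg R) : CQState R :=
  (V c.ket).sum fun x z => (V c.bra).sum fun y w =>
    Finsupp.single (⟨c.cl, x, y⟩ : Cfg R) (z * starRingEnd ℂ w)

open Classical in
/-- Action of an instruction on a matrix unit. -/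
def Instr.eval {R : Type} : Instr R → Cfg R → CQState R
  | .push b r, c => Finsupp.single { c with cl := Function.update c.cl r (b :: c.cl r) } 1
  | .pop r, c => Finsupp.single { c with cl := Function.update c.cl r (c.cl r).tail } 1
  | .copy r s, c => Finsupp.single { c with cl := Function.update c.cl r (c.cl s) } 1
  | .cut r s, c =>
      Finsupp.single { c with cl := Function.update c.cl r ((c.cl r).take (c.cl s).length) } 1
  | .pair r s t, c =>
      Finsupp.single { c with cl := Function.update c.cl r (pairCode (c.cl s) (c.cl t)) } 1
  | .unpair r s t, c =>
      Finsupp.single { c with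
        cl := Function.update (Function.update c.cl r (unpairCode (c.cl t)).1)
          s (unpairCode (c.cl t)).2 } 1
  | .qnew r, c => c.conjugate fun x => Finsupp.single (Function.update x r (false :: x r)) 1
  | .had r, c => c.conjugate fun x =>
      match x r with
      | [] => Finsupp.single x 1
      | b :: w => Finsupp.single (Function.update x r (false :: w)) (hadamardEntry false b)
          + Finsupp.single (Function.update x r (true :: w)) (hadamardEntry true b)
  | .tgate r, c => c.conjugate fun x =>
      match x r with
      | [] => Finsupp.single x 1
      | b :: _ => Finsupp.single x (tEntry b)
  | .cnot r s, c => c.conjugate fun x =>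
      match x r, x s with
      | true :: _, b :: w =>
          Finsupp.single (if r = s then x else Function.update x s ((!b) :: w)) 1
      | _, _ => Finsupp.single x 1
  | .qmove r s, c => c.conjugate fun x =>
      match x r with
      | [] => Finsupp.single x 1
      | b :: w => Finsupp.single
          (Function.update (Function.update x r w) s (b :: Function.update x r w s)) 1
  | .qswap r s, c => c.conjugate fun x => Finsupp.single (x ∘ Equiv.swap r s) 1
  | .meas r s, c =>
      match c.ket r, c.bra r with
      | a :: u, b :: v =>
          if a = b then
            Finsupp.single ⟨Function.update c.cl s (a :: c.cl s),
              Function.update c.ket r u, Function.update c.bra r v⟩ 1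
          else 0
      | [], [] => Finsupp.single c 1
      | _, _ => 0
  | .qtest r s, c =>
      if (c.ket r).isEmpty = (c.bra r).isEmpty then
        Finsupp.single { c with cl := Function.update c.cl s ((!(c.ket r).isEmpty) :: c.cl s) } 1
      else 0
  | .reset S, c =>
      if ∀ r ∈ S, c.ket r = c.bra r then
        Finsupp.single ⟨fun r => if r ∈ S then [] else c.cl r,
          fun r => if r ∈ S then [] else c.ket r, fun r => if r ∈ S then [] else c.bra r⟩ 1
      else 0

/-- `n`-fold iteration of a linear map that is given on the matrix units. -/
def CQState.iter {R : Type} (f : Cfg R → CQState R) : ℕ → Cfg R → CQState R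
  | 0, c => Finsupp.single c 1
  | n + 1, c => (f c).bind (CQState.iter f n)

/-- The final state of a program, for the initial matrix unit `c`. -/
def Prog.run {R : Type} : Prog R Empty → Cfg R → CQState R
  | .skip, c => Finsupp.single c 1
  | .instr i, c => i.eval c
  | .seq p q, c => (p.run c).bind q.run
  | .ite r p q, c => if (c.cl r).head? = some true then p.run c else q.run c
  | .loop r p, c => CQState.iter p.run (c.cl r).length c
  | .query o, _ => o.elim

open Classical in
/-- The probability that, started on the classical memory `m` and no qubits, the program ends with
the bit `1` in front in the register `r`. -/
def Prog.acceptProb {R : Type} (p : Prog R Empty) (m : Store R) (r : R) : ℝ :=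
  (p.run ⟨m, fun _ => [], fun _ => []⟩).sum fun c z =>
    if c.ket = c.bra ∧ (c.cl r).head? = some true then z.re else 0

end

/-! ## Computation paths, running time and oracle calls -/

/-- A basis configuration. -/
structure Point (R : Type) : Type where
  cl : Store R
  q : Store R

/-- Result of one computation path: the final configuration, the number of steps, and the oracle
calls, each with the classical memory at the moment of the call. -/
structure Outcome (R O : Type) : Type where
  final : Point R
  time : ℕ
  calls : List (O × Store R)

/-- Number of steps of an instruction. -/
def Instr.cost {R : Type} : Instr R → Point R → ℕ
  | .copy _ s, m => 1 + (m.cl s).length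
  | .cut _ s, m => 1 + (m.cl s).length
  | .pair _ s t, m => 1 + (m.cl s).length + (m.cl t).length
  | .unpair _ _ t, m => 1 + (m.cl t).length
  | _, _ => 1

/-- Append to each computation path in `X` the paths that `f` offers at its end. -/
def Outcome.andThen {R O : Type} (X : Set (Outcome R O)) (f : Point R → Set (Outcome R O)) :
    Set (Outcome R O) :=
  {o | ∃ o₁ ∈ X, ∃ o₂ ∈ f o₁.final,
    o = ⟨o₂.final, o₁.time + o₂.time, o₁.calls ++ o₂.calls⟩}

def Outcome.iter {R O : Type} (f : Point R → Set (Outcome R O)) :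
    ℕ → Point R → Set (Outcome R O)
  | 0, m => {⟨m, 1, []⟩}
  | n + 1, m => Outcome.andThen (f m) (Outcome.iter f n)

/-- All computation paths from a basis configuration: every measurement outcome and every basis
state in a superposition is followed. An oracle call takes one step and leaves arbitrary contents,
classical and quantum, in the registers `ans`. -/
def Prog.paths {R O : Type} (ans : Set R) : Prog R O → Point R → Set (Outcome R O)
  | .skip, m => {⟨m, 1, []⟩}
  | .instr i, m =>
      {o | i.eval ⟨m.cl, m.q, m.q⟩ ⟨o.final.cl, o.final.q, o.final.q⟩ ≠ 0 ∧
        o.time = i.cost m ∧ o.calls = []}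
  | .seq p q, m => Outcome.andThen (p.paths ans m) (q.paths ans)
  | .ite r p q, m =>
      Outcome.andThen {⟨m, 1, []⟩}
        (if (m.cl r).head? = some true then p.paths ans else q.paths ans)
  | .loop r p, m => Outcome.iter (p.paths ans) (m.cl r).length m
  | .query o, m =>
      {w | (∀ r, r ∉ ans → w.final.cl r = m.cl r ∧ w.final.q r = m.q r) ∧
        w.time = 1 ∧ w.calls = [(o, m.cl)]}

/-! ## Composition of programs -/

/-- Rename the registers of an instruction. -/
def Instr.map {R S : Type} (f : R → S) : Instr R → Instr S
  | .push b r => .push b (f r)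
  | .pop r => .pop (f r)
  | .copy r s => .copy (f r) (f s)
  | .cut r s => .cut (f r) (f s)
  | .pair r s t => .pair (f r) (f s) (f t)
  | .unpair r s t => .unpair (f r) (f s) (f t)
  | .qnew r => .qnew (f r)
  | .had r => .had (f r)
  | .tgate r => .tgate (f r)
  | .cnot r s => .cnot (f r) (f s)
  | .qmove r s => .qmove (f r) (f s)
  | .qswap r s => .qswap (f r) (f s)
  | .meas r s => .meas (f r) (f s)
  | .qtest r s => .qtest (f r) (f s)
  | .reset T => .reset (f '' T)

/-- Rename the registers and replace every oracle call by a program. -/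
def Prog.subst {R S O P : Type} (f : R → S) (h : O → Prog S P) : Prog R O → Prog S P
  | .skip => .skip
  | .instr i => .instr (i.map f)
  | .seq p q => .seq (p.subst f h) (q.subst f h)
  | .ite r p q => .ite (f r) (p.subst f h) (q.subst f h)
  | .loop r p => .loop (f r) (p.subst f h)
  | .query o => h o

/-- Rename the registers of a program without oracles. -/
def Prog.place {R S P : Type} (f : R → S) (p : Prog R Empty) : Prog S P :=
  p.subst f fun o => o.elim

def Prog.copy {R O : Type} (r s : R) : Prog R O := .instr (.copy r s)

/-- Empty all registers `f 0, f 1, …`, then copy, for every `(i, r)` in `args`, the classical string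
in `r` into `f i`. -/
def Prog.load {R O : Type} (f : ℕ → R) (args : List (ℕ × R)) : Prog R O :=
  args.foldl (fun p a => p ;; Prog.copy (f a.1) a.2) (.instr (.reset (Set.range f)))

/-- Run the algorithm `p` in the fresh memory `f 0, f 1, …` on the given classical inputs. -/
def Prog.call {R O : Type} (f : ℕ → R) (p : Prog ℕ Empty) (args : List (ℕ × R)) : Prog R O :=
  Prog.load f args ;; p.place f

/-! ## Quantum polynomial time

Algorithms and adversaries have the registers `0, 1, 2, …`. Register `0` receives the security
parameter in unary, registers `1` and `2` receive the inputs (or the answers of oracles), registers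
`3` and `4` hold the outputs (or the arguments of oracle calls). All other registers are
initially empty. -/

/-- Initial configuration with security parameter `n`, the bit strings `x`, `y` and the qubit
strings `u`, `v` in the registers `1` and `2`. -/
def inputPoint (n : ℕ) (x y u v : List Bool) : Point ℕ where
  cl := fun r =>
    if r = 0 then List.replicate n true else if r = 1 then x else if r = 2 then y else []
  q := fun r => if r = 1 then u else if r = 2 then v else []

/-- The algorithm runs in quantum polynomial time in the size of its input. -/
def Prog.IsQPT (p : Prog ℕ Empty) : Prop :=
  ∃ f : Polynomial ℕ, ∀ (n : ℕ) (x y u v : List Bool), ∀ o ∈ p.paths ∅ (inputPoint n x y u v),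
    o.time ≤ f.eval (n + x.length + y.length + u.length + v.length)

/-- The oracle algorithm, on input the security parameter, runs in quantum polynomial time,
however its oracle calls are answered. -/
def Prog.IsOracleQPT {O : Type} (A : Prog ℕ O) : Prop :=
  ∃ f : Polynomial ℕ, ∀ n : ℕ, ∀ o ∈ A.paths {1, 2} (inputPoint n [] [] [] []), o.time ≤ f.eval n

/-- Along every computation path, and however the oracle calls are answered, the list of oracle
calls has the property `V n`, where `n` is the security parameter. -/
def Prog.CallsSatisfy {O : Type} (A : Prog ℕ O) (V : ℕ → List (O × Store ℕ) → Prop) : Prop :=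
  ∀ n : ℕ, ∀ o ∈ A.paths {1, 2} (inputPoint n [] [] [] []), V n o.calls

def Negligible (f : ℕ → ℝ) : Prop :=
  Asymptotics.SuperpolynomialDecay Filter.atTop (fun n : ℕ => (n : ℝ)) f

/-! ## Untelegraphable encryption -/

/-- The parties of the games. Each has its own memory; `main` is the storage of the challenger and
the others, except `adv` and `dist`, are the memories in which it runs the algorithms of the
scheme. -/
inductive Party : Type
  | main | adv | dist | gen | enc | fake | reveal

/-- Initial memory of a game: the security parameter, in the challenger's storage. -/
noncomputable def gameInput (n : ℕ) : Store (Party × ℕ) :=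
  open Classical in fun r => if r = (Party.main, 0) then List.replicate n true else []

/-- Syntax of untelegraphable secret-key encryption with separate encryption and decryption keys.
`gen`: `1ⁿ ↦ (ek, dk)`; `enc`: `(1ⁿ, ek, m) ↦ ct`; `dec`: `(1ⁿ, dk, ct) ↦ m`. Here `ct` consists of the
bit string and of the qubits of the output register. -/
structure SplitUTSKE : Type where
  gen : Prog ℕ Empty
  enc : Prog ℕ Empty
  dec : Prog ℕ Empty

/-- Syntax of untelegraphable secret-key encryption with a single secret key.
`gen`: `1ⁿ ↦ sk`; `enc`: `(1ⁿ, sk, m) ↦ ct`; `dec`: `(1ⁿ, sk, ct) ↦ m`. -/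
structure UTSKE : Type where
  gen : Prog ℕ Empty
  enc : Prog ℕ Empty
  dec : Prog ℕ Empty

/-- A scheme with a single key, seen as a scheme with `ek = dk = sk`. -/
def UTSKE.toSplit (U : UTSKE) : SplitUTSKE where
  gen := U.gen ;; Prog.copy 4 3
  enc := U.enc
  dec := U.dec

def SplitUTSKE.IsQPT (U : SplitUTSKE) : Prop := U.gen.IsQPT ∧ U.enc.IsQPT ∧ U.dec.IsQPT

def UTSKE.IsQPT (U : UTSKE) : Prop := U.gen.IsQPT ∧ U.enc.IsQPT ∧ U.dec.IsQPT

/-- The challenger's answer to the first-stage adversary's query `(m₀, m₁)`, which the adversary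
has in its registers `3` and `4`: a fresh encryption of `m_b`, delivered in its register `1`. -/
def SplitUTSKE.challenge (U : SplitUTSKE) (b : Bool) : Prog (Party × ℕ) Empty :=
  Prog.call (Party.enc, ·) U.enc
    [(0, (.main, 0)), (1, (.main, 1)), (2, (.adv, if b then 4 else 3))] ;;
  .instr (.reset {(.adv, 1)}) ;;
  Prog.copy (.adv, 1) (.enc, 3) ;;
  .instr (.qswap (.adv, 1) (.enc, 3))

/-- The untelegraphability game: keys are sampled; the first-stage adversary `A` makes queries and
ends with a bit string `st` in its register `3`; the second-stage adversary `B` receives only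
`(1ⁿ, st, dk)`, in a fresh memory, and outputs a bit. -/
def SplitUTSKE.game (U : SplitUTSKE) (A : Prog ℕ Unit) (B : Prog ℕ Empty) (b : Bool) :
    Prog (Party × ℕ) Empty :=
  Prog.call (Party.gen, ·) U.gen [(0, (.main, 0))] ;;
  Prog.copy (.main, 1) (.gen, 3) ;;
  Prog.copy (.main, 2) (.gen, 4) ;;
  Prog.copy (.adv, 0) (.main, 0) ;;
  A.subst (Party.adv, ·) (fun _ => U.challenge b) ;;
  Prog.call (Party.dist, ·) B [(0, (.main, 0)), (1, (.adv, 3)), (2, (.main, 2))]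

/-- `Pr[b_B = 1]` in the game with challenge bit `b`. -/
noncomputable def SplitUTSKE.winProb (U : SplitUTSKE) (A : Prog ℕ Unit) (B : Prog ℕ Empty)
    (b : Bool) (n : ℕ) : ℝ :=
  (U.game A B b).acceptProb (gameInput n) (.dist, 3)

/-- All queried messages belong to the message space. -/
def queriesIn (M : ℕ → Set (List Bool)) (n : ℕ) (l : List (Unit × Store ℕ)) : Prop :=
  ∀ c ∈ l, c.2 3 ∈ M n ∧ c.2 4 ∈ M n

/-- Collusion-resistant security with message space `M`: the first-stage adversary may make any
number of adaptive queries. -/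
def SplitUTSKE.CollusionResistant (U : SplitUTSKE) (M : ℕ → Set (List Bool)) : Prop :=
  ∀ (A : Prog ℕ Unit) (B : Prog ℕ Empty), A.IsOracleQPT → B.IsQPT →
    A.CallsSatisfy (queriesIn M) →
    Negligible fun n => |U.winProb A B false n - U.winProb A B true n|

/-- (One-time) indistinguishability security with message space `M`: one query. -/
def UTSKE.IndSecure (U : UTSKE) (M : ℕ → Set (List Bool)) : Prop :=
  ∀ (A : Prog ℕ Unit) (B : Prog ℕ Empty), A.IsOracleQPT → B.IsQPT →
    A.CallsSatisfy (fun n l => queriesIn M n l ∧ l.length ≤ 1) →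
    Negligible fun n => |U.toSplit.winProb A B false n - U.toSplit.winProb A B true n|

/-- `K` is a key space: every key that key generation can output belongs to it. -/
def UTSKE.KeysIn (U : UTSKE) (K : ℕ → Set (List Bool)) : Prop :=
  ∀ n : ℕ, ∀ o ∈ U.gen.paths ∅ (inputPoint n [] [] [] []), o.final.cl 3 ∈ K n

/-! ## Secret-key non-committing encryption for receiver -/

/-- Syntax of secret-key non-committing encryption for receiver. `kg`: `1ⁿ ↦ (ek, dk)`;
`enc`: `(1ⁿ, ek, m) ↦ ct`; `dec`: `(1ⁿ, dk, ct) ↦ m`; `fake`: `(1ⁿ, ek) ↦ (ct, st)`;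
`reveal`: `(1ⁿ, st, m) ↦ dk`. All inputs and outputs are bit strings. -/
structure SKNCER : Type where
  kg : Prog ℕ Empty
  enc : Prog ℕ Empty
  dec : Prog ℕ Empty
  fake : Prog ℕ Empty
  reveal : Prog ℕ Empty

def SKNCER.IsQPT (N : SKNCER) : Prop :=
  N.kg.IsQPT ∧ N.enc.IsQPT ∧ N.dec.IsQPT ∧ N.fake.IsQPT ∧ N.reveal.IsQPT

/-- The two kinds of queries in the non-committing security game. -/
inductive NCEQuery : Type
  | encrypt | challenge

/-- The challenger's answers. The adversary has the message in its register `3`; it receives the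
ciphertext in register `1` and, for a challenge query, the decryption key in register `2`. -/
def SKNCER.answer (N : SKNCER) (b : Bool) : NCEQuery → Prog (Party × ℕ) Empty
  | .encrypt =>
      Prog.call (Party.enc, ·) N.enc [(0, (.main, 0)), (1, (.main, 1)), (2, (.adv, 3))] ;;
      Prog.copy (.adv, 1) (.enc, 3)
  | .challenge =>
      if b then
        Prog.call (Party.fake, ·) N.fake [(0, (.main, 0)), (1, (.main, 1))] ;;
        Prog.call (Party.reveal, ·) N.reveal [(0, (.main, 0)), (1, (.fake, 4)), (2, (.adv, 3))] ;;
        Prog.copy (.adv, 1) (.fake, 3) ;;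
        Prog.copy (.adv, 2) (.reveal, 3)
      else
        Prog.call (Party.enc, ·) N.enc [(0, (.main, 0)), (1, (.main, 1)), (2, (.adv, 3))] ;;
        Prog.copy (.adv, 1) (.enc, 3) ;;
        Prog.copy (.adv, 2) (.main, 2)

/-- The non-committing security game. -/
def SKNCER.game (N : SKNCER) (A : Prog ℕ NCEQuery) (b : Bool) : Prog (Party × ℕ) Empty :=
  Prog.call (Party.gen, ·) N.kg [(0, (.main, 0))] ;;
  Prog.copy (.main, 1) (.gen, 3) ;;
  Prog.copy (.main, 2) (.gen, 4) ;;
  Prog.copy (.adv, 0) (.main, 0) ;;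
  A.subst (Party.adv, ·) (N.answer b)

/-- `Pr[b' = 1]` in the game with challenge bit `b`. -/
noncomputable def SKNCER.winProb (N : SKNCER) (A : Prog ℕ NCEQuery) (b : Bool) (n : ℕ) : ℝ :=
  (N.game A b).acceptProb (gameInput n) (.adv, 3)

/-- All queried messages belong to the message space, and there is at most one challenge query. -/
def nceQueriesIn (K : ℕ → Set (List Bool)) (n : ℕ) (l : List (NCEQuery × Store ℕ)) : Prop :=
  (∀ c ∈ l, c.2 3 ∈ K n) ∧ l.Pairwise fun c d => ¬ (c.1 = .challenge ∧ d.1 = .challenge)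

/-- Non-committing security, with message space `K`, against quantum polynomial-time adversaries. -/
def SKNCER.NonCommitting (N : SKNCER) (K : ℕ → Set (List Bool)) : Prop :=
  ∀ A : Prog ℕ NCEQuery, A.IsOracleQPT → A.CallsSatisfy (nceQueriesIn K) →
    Negligible fun n => |N.winProb A false n - N.winProb A true n|

/-! ## The construction -/

/-- The `k`-th block of work registers. -/
def block (k : ℕ) (r : ℕ) : ℕ := 5 + Nat.pair k r

/-- `Enc(ek, m)`: sample a one-time key `sk`; output `(1UTE.Enc(sk, m), NCE.Enc(ek, sk))`. -/
def crEnc (U : UTSKE) (N : SKNCER) : Prog ℕ Empty :=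
  Prog.call (block 0) U.gen [(0, 0)] ;;
  Prog.call (block 1) U.enc [(0, 0), (1, block 0 3), (2, 2)] ;;
  Prog.call (block 2) N.enc [(0, 0), (1, 1), (2, block 0 3)] ;;
  .instr (.pair 3 (block 1 3) (block 2 3)) ;;
  .instr (.qswap 3 (block 1 3))

/-- `Dec(dk, (ct₁, ct₂)) = 1UTE.Dec(NCE.Dec(dk, ct₂), ct₁)`. -/
def crDec (U : UTSKE) (N : SKNCER) : Prog ℕ Empty :=
  .instr (.unpair (block 2 1) (block 2 2) 2) ;;
  Prog.call (block 0) N.dec [(0, 0), (1, 1), (2, block 2 2)] ;;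
  Prog.load (block 1) [(0, 0), (1, block 0 3), (2, block 2 1)] ;;
  .instr (.qswap (block 1 2) 2) ;;
  U.dec.place (block 1) ;;
  Prog.copy 3 (block 1 3)

/-- The collusion-resistant scheme; its key generation is that of the non-committing scheme. -/
def crUTE (U : UTSKE) (N : SKNCER) : SplitUTSKE where
  gen := N.kg
  enc := crEnc U N
  dec := crDec U N

/-!
The proof is a hybrid argument over the queries of the first-stage adversary `A`. In the `i`-th hybrid
the first `i` queries are answered by encryptions of `m₁` and all others by encryptions of `m₀`, so
that the hybrid `0` is the game with the challenge bit `0`, and a hybrid beyond the number of queries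
is the game with the challenge bit `1`. Two consecutive hybrids differ in one query, the distinguished
one. There, the non-committing ciphertext of the one-time key `sk` is replaced by a fake one, and the
decryption key by a key that is revealed for `sk`; the message `m₀` is replaced by `m₁`; and the first
step is undone. The first and the last step are justified by non-committing security
(`nceAdversary`). In the middle step neither the ciphertexts nor the state `st` that `A` hands over
depend on `sk`, except through the single-key encryption of the distinguished message; only the second
stage needs `sk`, to reveal the decryption key, and it is given `sk` by the single-key game
(`uteAdversary`, `uteDistinguisher`). The distinguished query is chosen at random, so that the advantage
against the collusion-resistant scheme is the sum of those of three reductions, up to the number of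
hybrids (`crUTE_advantage`).

The reductions obtain their challenge at a fixed moment, whereas the distinguished query comes when
`A` makes it. Since the one-time key is fresh and used once, it and its encryption may be sampled in
advance (`eager_eq_hybrid`).

Programs are analysed in the Heisenberg picture: a program transforms functionals of its final state
into functionals of its initial state (`Prog.wp`), and an oracle program does so for any
interpretation of its oracles as transformers of functionals (`Prog.transform`,
`Prog.transform_rel`). Memory that is later overwritten or ignored is traced out (`traceOut`); with
trace preservation (`Prog.wp_trace`) a call of an algorithm then becomes a draw from its output
distribution (`wp_call_traceOut`), and the games become expressions in such draws (`crUTE_winProb`,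
`nceAdversary_winProb_false`, `nceAdversary_winProb_true`, `uteAdversary_winProb`), which can be compared.

Coins are only available as measured qubits, so an index is chosen uniformly below a power of two,
`samplerRange Q`, with `Q < samplerRange Q ≤ 2 * Q + 1` for a bound `Q` on the number of queries.
Running times are bounded along all computation paths (`Prog.Ensures`). The oracles of the reductions
may there answer by arbitrarily long strings; hence the reductions truncate what they receive, which
has no effect in the games themselves (`SizeBounds`).
-/

noncomputable section

/-! ### Functionals on finitely supported families -/

/-- The value `∑ a, d a * φ a` of the functional `φ` on the family `d`. For a family of
probabilities this is an expectation; for a classical-quantum state it is the Heisenberg picture,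
in which a program acts on functionals of its final state. -/
def ev {α : Type*} (d : α →₀ ℂ) (φ : α → ℂ) : ℂ := d.sum fun a z => z * φ a

section ev

variable {α β : Type*}

theorem ev_eq_linearCombination (d : α →₀ ℂ) (φ : α → ℂ) :
    ev d φ = Finsupp.linearCombination ℂ φ d := by
  simp [ev, Finsupp.linearCombination_apply]

@[simp] theorem ev_single (a : α) (z : ℂ) (φ : α → ℂ) : ev (Finsupp.single a z) φ = z * φ a := by
  simp [ev]

@[simp] theorem ev_zero_left (φ : α → ℂ) : ev 0 φ = 0 := by simp [ev]

theorem ev_add_left (d e : α →₀ ℂ) (φ : α → ℂ) : ev (d + e) φ = ev d φ + ev e φ := by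
  simp [ev_eq_linearCombination]

theorem ev_sum_left (d : β →₀ ℂ) (f : β → α →₀ ℂ) (φ : α → ℂ) :
    ev (d.sum fun b z => z • f b) φ = ev d fun b => ev (f b) φ := by
  simp only [ev_eq_linearCombination, map_finsuppSum, map_smul]
  rw [Finsupp.linearCombination_apply]

theorem ev_mapDomain (g : β → α) (d : β →₀ ℂ) (φ : α → ℂ) :
    ev (d.mapDomain g) φ = ev d fun b => φ (g b) := by
  simp only [ev_eq_linearCombination, Finsupp.linearCombination_mapDomain]; rfl

theorem ev_congr {d : α →₀ ℂ} {φ ψ : α → ℂ} (h : ∀ a, d a ≠ 0 → φ a = ψ a) : ev d φ = ev d ψ :=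
  Finset.sum_congr rfl fun a ha => by simp [h a (Finsupp.mem_support_iff.1 ha)]

theorem ev_comm (d : α →₀ ℂ) (e : β →₀ ℂ) (φ : α → β → ℂ) :
    (ev d fun a => ev e fun b => φ a b) = ev e fun b => ev d fun a => φ a b := by
  simp only [ev, Finsupp.sum, Finset.mul_sum]
  rw [Finset.sum_comm]
  exact Finset.sum_congr rfl fun b _ => Finset.sum_congr rfl fun a _ => by ring

theorem ev_mul_const (d : α →₀ ℂ) (φ : α → ℂ) (k : ℂ) : (ev d fun a => φ a * k) = ev d φ * k := by
  simp only [ev, Finsupp.sum, Finset.sum_mul, mul_assoc]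

theorem ev_const (d : α →₀ ℂ) (k : ℂ) : (ev d fun _ => k) = (ev d fun _ => 1) * k := by
  rw [← ev_mul_const]; simp

@[simp] theorem ev_zero_right (d : α →₀ ℂ) : (ev d fun _ => 0) = 0 := by simp [ev]

theorem ev_sum_right {ι : Type*} (d : α →₀ ℂ) (s : Finset ι) (φ : ι → α → ℂ) :
    (ev d fun a => ∑ i ∈ s, φ i a) = ∑ i ∈ s, ev d (φ i) := by
  simp only [ev, Finsupp.sum, Finset.mul_sum]
  rw [Finset.sum_comm]

end ev

/-! ### Programs as transformers of functionals -/

section wp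

variable {R : Type}

theorem ev_bind (d : CQState R) (f : Cfg R → CQState R) (φ : Cfg R → ℂ) :
    ev (d.bind f) φ = ev d fun c => ev (f c) φ := ev_sum_left d f φ

/-- The Heisenberg picture of a program: the functional `φ` of the final state as a functional of
the initial state. -/
def Prog.wp (p : Prog R Empty) (φ : Cfg R → ℂ) (c : Cfg R) : ℂ := ev (p.run c) φ

theorem Prog.wp_skip (φ : Cfg R → ℂ) : Prog.skip.wp φ = φ := by
  funext c; simp [Prog.wp, Prog.run]

theorem Prog.wp_instr (i : Instr R) (φ : Cfg R → ℂ) (c : Cfg R) :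
    (Prog.instr i).wp φ c = ev (i.eval c) φ := rfl

theorem Prog.wp_seq (p q : Prog R Empty) (φ : Cfg R → ℂ) : (p ;; q).wp φ = p.wp (q.wp φ) := by
  funext c; simp only [Prog.wp, Prog.run, ev_bind]; rfl

theorem Prog.wp_ite (r : R) (p q : Prog R Empty) (φ : Cfg R → ℂ) (c : Cfg R) :
    (Prog.ite r p q).wp φ c = if (c.cl r).head? = some true then p.wp φ c else q.wp φ c := by
  simp only [Prog.wp, Prog.run]; split_ifs <;> rfl

theorem Prog.wp_loop (r : R) (p : Prog R Empty) (φ : Cfg R → ℂ) (c : Cfg R) :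
    (Prog.loop r p).wp φ c = p.wp^[(c.cl r).length] φ c := by
  simp only [Prog.wp, Prog.run]
  generalize (c.cl r).length = n
  induction n generalizing c with
  | zero => simp [CQState.iter]
  | succ n ih =>
    rw [Function.iterate_succ_apply', CQState.iter, ev_bind]
    simp only [ih]; rfl

end wp

/-! ### Renaming registers -/

section rename

variable {R S T : Type}

/-- The part of a configuration in the registers `f r`. -/
def Cfg.restrict (f : R → S) (c : Cfg S) : Cfg R := ⟨c.cl ∘ f, c.ket ∘ f, c.bra ∘ f⟩

/-- The configuration `c`, with the contents of the registers `f r` replaced by `w`. -/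
def Cfg.overlay (f : R → S) (c : Cfg S) (w : Cfg R) : Cfg S :=
  ⟨Function.extend f w.cl c.cl, Function.extend f w.ket c.ket, Function.extend f w.bra c.bra⟩

theorem extend_comp_self' {α : Type*} {f : R → S} (x : S → α) :
    Function.extend f (x ∘ f) x = x := by
  funext s
  by_cases h : ∃ r, f r = s
  · unfold Function.extend
    rw [dif_pos h, Function.comp, h.choose_spec]
  · rw [Function.extend_apply' _ _ _ h]

open Classical in
theorem extend_update {α : Type*} {f : R → S} (hf : f.Injective) (w : R → α) (x : S → α) (r : R)
    (v : α) :
    Function.extend f (Function.update w r v) x =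
      Function.update (Function.extend f w x) (f r) v := by
  funext s
  by_cases h : ∃ r', f r' = s
  · obtain ⟨r', rfl⟩ := h
    simp [hf.extend_apply, Function.update_apply, hf.eq_iff]
  · rw [Function.extend_apply' _ _ _ h, Function.update_apply, if_neg,
      Function.extend_apply' _ _ _ h]
    rintro rfl; exact h ⟨r, rfl⟩

theorem extend_extend {α : Type*} {f : R → S} (w w' : R → α) (x : S → α) :
    Function.extend f w' (Function.extend f w x) = Function.extend f w' x := by
  funext s
  by_cases h : ∃ r', f r' = s
  · unfold Function.extend
    rw [dif_pos h, dif_pos h]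
  · simp only [Function.extend_apply' _ _ _ h]

theorem extend_comp_left {α : Type*} {f : R → S} (hf : f.Injective) (w : R → α) (x : S → α) :
    Function.extend f w x ∘ f = w := by
  funext r; simp [hf.extend_apply]

@[simp] theorem Cfg.overlay_restrict (f : R → S) (c : Cfg S) :
    c.overlay f (c.restrict f) = c := by
  cases c; simp [Cfg.overlay, Cfg.restrict, extend_comp_self']

theorem Cfg.restrict_overlay {f : R → S} (hf : f.Injective) (c : Cfg S) (w : Cfg R) :
    (c.overlay f w).restrict f = w := by
  cases c; cases w; simp [Cfg.overlay, Cfg.restrict, extend_comp_left hf]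

theorem Cfg.overlay_overlay (f : R → S) (c : Cfg S) (w w' : Cfg R) :
    (c.overlay f w).overlay f w' = c.overlay f w' := by
  simp [Cfg.overlay, extend_extend]

theorem Cfg.conjugate_overlay {f : R → S} {V : Store R → (Store R →₀ ℂ)}
    {V' : Store S → (Store S →₀ ℂ)} (c : Cfg S)
    (h : ∀ x : Store S, V' x = (V (x ∘ f)).mapDomain (Function.extend f · x)) :
    c.conjugate V' = ((c.restrict f).conjugate V).mapDomain (c.overlay f) := by
  have hm : ∀ (x : Store S) (d : Store R →₀ ℂ) (k : Store S → ℂ → CQState S),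
      (∀ y, k y 0 = 0) → (∀ y a b, k y (a + b) = k y a + k y b) →
        (d.mapDomain (Function.extend f · x)).sum k =
          d.sum fun y z => k (Function.extend f y x) z :=
    fun x d k h0 h1 => Finsupp.sum_mapDomain_index h0 h1
  simp only [Cfg.conjugate, h]
  rw [hm _ _ _ (by simp) (by intro x a b; simp [add_mul, Finsupp.sum_add])]
  simp only [Finsupp.sum, Finsupp.mapDomain_finsetSum, Finsupp.mapDomain_single]
  refine Finset.sum_congr rfl fun x _ => ?_
  refine (hm c.bra _ (fun y w => Finsupp.single ⟨c.cl, Function.extend f x c.ket, y⟩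
    ((V (c.ket ∘ f)) x * starRingEnd ℂ w)) (by simp) (by simp [mul_add])).trans ?_
  simp [Finsupp.sum, Cfg.overlay, Cfg.restrict, extend_comp_self']

end rename

section frame

variable {R S T O P : Type}

open Classical in
theorem Instr.eval_reset_of_forall {T : Set S} {c : Cfg S} (h : ∀ r ∈ T, c.ket r = c.bra r) :
    (Instr.reset T).eval c = Finsupp.single ⟨fun r => if r ∈ T then [] else c.cl r,
      fun r => if r ∈ T then [] else c.ket r, fun r => if r ∈ T then [] else c.bra r⟩ 1 :=
  if_pos h

theorem Instr.eval_reset_of_not_forall {T : Set S} {c : Cfg S}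
    (h : ¬ ∀ r ∈ T, c.ket r = c.bra r) : (Instr.reset T).eval c = 0 :=
  if_neg h

open Classical in
/-- A renamed instruction acts on the renamed registers as the instruction does on its own, and
leaves all other registers alone. -/
theorem Instr.eval_map {f : R → S} (hf : f.Injective) (i : Instr R) (c : Cfg S) :
    (i.map f).eval c = (i.eval (c.restrict f)).mapDomain (c.overlay f) := by
  have he : ∀ (x : Store S) r, (x ∘ f) r = x (f r) := fun _ _ => rfl
  have hu : ∀ (x : Store S) (r : R) (v : List Bool),
      Function.extend f (Function.update (x ∘ f) r v) x = Function.update x (f r) v := by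
    intro x r v; rw [extend_update hf, extend_comp_self']
  have hu2 : ∀ (x : Store S) (r s : R) (v w : List Bool),
      Function.extend f (Function.update (Function.update (x ∘ f) r v) s w) x =
        Function.update (Function.update x (f r) v) (f s) w := by
    intro x r s v w; rw [extend_update hf, hu]
  have hcomp : ∀ (x : Store S), Function.extend f (x ∘ f) x = x := extend_comp_self'
  cases i with
  | push b r => simp [Instr.map, Instr.eval, Cfg.restrict, Cfg.overlay, hu, hcomp]
  | pop r => simp [Instr.map, Instr.eval, Cfg.restrict, Cfg.overlay, hu, hcomp]
  | copy r s => simp [Instr.map, Instr.eval, Cfg.restrict, Cfg.overlay, hu, hcomp]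
  | cut r s => simp [Instr.map, Instr.eval, Cfg.restrict, Cfg.overlay, hu, hcomp]
  | pair r s t => simp [Instr.map, Instr.eval, Cfg.restrict, Cfg.overlay, hu, hcomp]
  | unpair r s t => simp [Instr.map, Instr.eval, Cfg.restrict, Cfg.overlay, hu2, hcomp]
  | qnew r =>
    simp only [Instr.map, Instr.eval]
    refine Cfg.conjugate_overlay c fun x => ?_
    simp [hu]
  | had r =>
    simp only [Instr.map, Instr.eval]
    refine Cfg.conjugate_overlay c fun x => ?_
    rw [he]
    rcases x (f r) with _ | ⟨b, w⟩ <;> simp [Finsupp.mapDomain_add, hu, hcomp]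
  | tgate r =>
    simp only [Instr.map, Instr.eval]
    refine Cfg.conjugate_overlay c fun x => ?_
    rw [he]
    rcases x (f r) with _ | ⟨b, w⟩ <;> simp [hcomp]
  | cnot r s =>
    simp only [Instr.map, Instr.eval]
    refine Cfg.conjugate_overlay c fun x => ?_
    simp only [he]
    rcases x (f r) with _ | ⟨_ | _, w⟩ <;> rcases x (f s) with _ | ⟨b, u⟩ <;>
      simp [hcomp, hf.eq_iff]
    split_ifs <;> simp [hu, hcomp]
  | qmove r s =>
    simp only [Instr.map, Instr.eval]
    refine Cfg.conjugate_overlay c fun x => ?_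
    simp only [he]
    rcases x (f r) with _ | ⟨b, w⟩ <;> simp [hcomp, hu2, Function.update_apply, hf.eq_iff]
  | qswap r s =>
    simp only [Instr.map, Instr.eval]
    refine Cfg.conjugate_overlay c fun x => ?_
    simp only [Finsupp.mapDomain_single]
    congr 1
    funext t
    by_cases h : ∃ t', f t' = t
    · obtain ⟨t', rfl⟩ := h
      simp only [hf.extend_apply, Function.comp, Equiv.swap_apply_def, hf.eq_iff]
      split_ifs <;> rfl
    · rw [Function.extend_apply' _ _ _ h, Function.comp, Equiv.swap_apply_of_ne_of_ne]
      · rintro rfl; exact h ⟨_, rfl⟩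
      · rintro rfl; exact h ⟨_, rfl⟩
  | meas r s =>
    simp only [Instr.map, Instr.eval, Cfg.restrict, he]
    rcases c.ket (f r) with _ | ⟨a, u⟩ <;> rcases c.bra (f r) with _ | ⟨b, v⟩ <;>
      simp only [Finsupp.mapDomain_zero, Finsupp.mapDomain_single, Cfg.overlay, hcomp]
    split_ifs <;> simp [Cfg.overlay, hu]
  | qtest r s =>
    simp only [Instr.map, Instr.eval, Cfg.restrict, he]
    split_ifs <;> simp [Cfg.overlay, hu, hcomp]
  | reset T =>
    have hr : ∀ x : Store S, (fun r => if r ∈ f '' T then [] else x r) =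
        Function.extend f (fun r => if r ∈ T then [] else (x ∘ f) r) x := by
      intro x
      funext s
      by_cases h : ∃ r, f r = s
      · obtain ⟨r, rfl⟩ := h
        simp [hf.extend_apply, hf.eq_iff]
      · rw [Function.extend_apply' _ _ _ h, if_neg]
        rintro ⟨r, _, rfl⟩; exact h ⟨r, rfl⟩
    have hd : (∀ r ∈ f '' T, c.ket r = c.bra r) ↔
        ∀ r ∈ T, (c.restrict f).ket r = (c.restrict f).bra r := by simp [Cfg.restrict]
    by_cases h : ∀ r ∈ T, (c.restrict f).ket r = (c.restrict f).bra r
    · rw [Instr.eval_reset_of_forall h, Instr.map, Instr.eval_reset_of_forall (hd.2 h),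
        Finsupp.mapDomain_single]
      simp only [hr]; rfl
    · rw [Instr.eval_reset_of_not_forall h, Instr.map,
        Instr.eval_reset_of_not_forall fun h' => h (hd.1 h'), Finsupp.mapDomain_zero]

theorem Instr.ev_eval_map {f : R → S} (hf : f.Injective) (i : Instr R) (φ : Cfg S → ℂ)
    (c : Cfg S) :
    ev ((i.map f).eval c) φ = ev (i.eval (c.restrict f)) fun w => φ (c.overlay f w) := by
  rw [Instr.eval_map hf, ev_mapDomain]

theorem Instr.map_map (f : R → S) (g : S → T) (i : Instr R) : (i.map f).map g = i.map (g ∘ f) := by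
  cases i <;> simp [Instr.map, Set.image_image]

theorem Prog.subst_subst {Q : Type} (f : R → S) (g : S → T) (h : O → Prog S P) (k : P → Prog T Q)
    (p : Prog R O) :
    (p.subst f h).subst g k = p.subst (g ∘ f) fun o => (h o).subst g k := by
  induction p with
  | skip => rfl
  | instr i => simp [Prog.subst, Instr.map_map]
  | seq p q ihp ihq => simp [Prog.subst, ihp, ihq]
  | ite r p q ihp ihq => simp [Prog.subst, ihp, ihq]
  | loop r p ih => simp [Prog.subst, ih]
  | query o => rfl

theorem Prog.subst_place {Q : Type} (f : R → S) (g : S → T) (k : P → Prog T Q)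
    (p : Prog R Empty) : (p.place f : Prog S P).subst g k = p.place (g ∘ f) := by
  rw [Prog.place, Prog.subst_subst, Prog.place]
  congr 1
  funext o; exact o.elim

theorem Prog.subst_load (f : ℕ → R) (g : R → S) (k : O → Prog S P) (args : List (ℕ × R)) :
    (Prog.load f args : Prog R O).subst g k =
      Prog.load (g ∘ f) (args.map fun a => (a.1, g a.2)) := by
  unfold Prog.load
  have h : ((Prog.instr (.reset (Set.range f)) : Prog R O)).subst g k =
      .instr (.reset (Set.range (g ∘ f))) := by
    simp [Prog.subst, Instr.map, Set.range_comp]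
  rw [← h]
  generalize (Prog.instr (.reset (Set.range f)) : Prog R O) = p
  induction args generalizing p with
  | nil => rfl
  | cons a l ih => rw [List.foldl_cons, ih]; rfl

theorem Prog.subst_call (f : ℕ → R) (g : R → S) (k : O → Prog S P) (p : Prog ℕ Empty)
    (args : List (ℕ × R)) :
    (Prog.call f p args : Prog R O).subst g k =
      Prog.call (g ∘ f) p (args.map fun a => (a.1, g a.2)) := by
  simp only [Prog.call, Prog.subst, Prog.subst_load, Prog.subst_place]

end frame

/-! ### Oracle programs as transformers of functionals -/

section interpreter

variable {R S O X Y : Type}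

/-- The action of an oracle program on functionals of states of type `X`. The registers of the
program are a part of the state, read by `get` and overwritten by `set`; the oracles are arbitrary
transformers `G` of functionals. -/
def Prog.transform (get : X → Cfg R) (set : X → Cfg R → X) (G : O → (X → ℂ) → X → ℂ) :
    Prog R O → (X → ℂ) → X → ℂ
  | .skip, φ => φ
  | .instr i, φ => fun x => ev (i.eval (get x)) fun w => φ (set x w)
  | .seq p q, φ => p.transform get set G (q.transform get set G φ)
  | .ite r p q, φ => fun x =>
      if ((get x).cl r).head? = some true then p.transform get set G φ x
      else q.transform get set G φ x
  | .loop r p, φ => fun x => (p.transform get set G)^[((get x).cl r).length] φ x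
  | .query o, φ => G o φ

/-- A program with its oracle calls replaced by programs is an interpretation of the oracle program:
its own registers are those at `f r`. -/
theorem Prog.wp_subst {f : R → S} (hf : f.Injective) (h : O → Prog S Empty) (A : Prog R O) :
    (A.subst f h).wp = A.transform (Cfg.restrict f) (Cfg.overlay f) fun o => (h o).wp := by
  induction A with
  | skip => funext φ; exact Prog.wp_skip φ
  | instr i => funext φ c; exact Instr.ev_eval_map hf i φ c
  | seq p q ihp ihq => funext φ; simp only [Prog.subst, Prog.wp_seq, Prog.transform, ihp, ihq]
  | ite r p q ihp ihq =>
    funext φ c; simp only [Prog.subst, Prog.wp_ite, Prog.transform, ihp, ihq]; rfl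
  | loop r p ih => funext φ c; simp only [Prog.subst, Prog.wp_loop, Prog.transform, ih]; rfl
  | query o => rfl

/-- A relation between functionals that is compatible with the instructions, with the oracles and
with case distinctions on the registers of the program is compatible with the program. -/
theorem Prog.transform_rel {get₁ : Y → Cfg R} {set₁ : Y → Cfg R → Y} {G₁ : O → (Y → ℂ) → Y → ℂ}
    {get₂ : X → Cfg R} {set₂ : X → Cfg R → X} {G₂ : O → (X → ℂ) → X → ℂ}
    (Rel : (Y → ℂ) → (X → ℂ) → Prop)
    (hI : ∀ (i : Instr R) φ ψ, Rel φ ψ →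
      Rel (fun y => ev (i.eval (get₁ y)) fun w => φ (set₁ y w))
        (fun x => ev (i.eval (get₂ x)) fun w => ψ (set₂ x w)))
    (hQ : ∀ o φ ψ, Rel φ ψ → Rel (G₁ o φ) (G₂ o ψ))
    (hC : ∀ r (Φ : List Bool → Y → ℂ) (Ψ : List Bool → X → ℂ), (∀ l, Rel (Φ l) (Ψ l)) →
      Rel (fun y => Φ ((get₁ y).cl r) y) (fun x => Ψ ((get₂ x).cl r) x))
    (A : Prog R O) {φ : Y → ℂ} {ψ : X → ℂ} (h : Rel φ ψ) :
    Rel (A.transform get₁ set₁ G₁ φ) (A.transform get₂ set₂ G₂ ψ) := by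
  induction A generalizing φ ψ with
  | skip => exact h
  | instr i => exact hI i _ _ h
  | seq p q ihp ihq => exact ihp (ihq h)
  | ite r p q ihp ihq =>
    refine hC r
      (fun l y => if l.head? = some true then p.transform get₁ set₁ G₁ φ y
        else q.transform get₁ set₁ G₁ φ y)
      (fun l x => if l.head? = some true then p.transform get₂ set₂ G₂ ψ x
        else q.transform get₂ set₂ G₂ ψ x) fun l => ?_
    by_cases hl : l.head? = some true
    · simpa only [hl, if_true] using ihp h
    · simpa only [hl, if_false] using ihq h
  | loop r p ih =>
    refine hC r (fun l y => (p.transform get₁ set₁ G₁)^[l.length] φ y)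
      (fun l x => (p.transform get₂ set₂ G₂)^[l.length] ψ x) fun l => ?_
    generalize l.length = n
    induction n with
    | zero => exact h
    | succ n ihn => simp only [Function.iterate_succ_apply']; exact ih ihn
  | query o => exact hQ o _ _ h

theorem Prog.wp_place {f : R → S} (hf : f.Injective) (p : Prog R Empty) (φ : Cfg S → ℂ)
    (c : Cfg S) :
    (p.place f).wp φ c = p.wp (fun w => φ (c.overlay f w)) (c.restrict f) := by
  have hp : p.wp = p.transform (X := Cfg R) id (fun _ w => w) fun o => o.elim := by
    induction p with
    | skip => funext φ; exact Prog.wp_skip φ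
    | instr i => rfl
    | seq p q ihp ihq => funext φ; simp only [Prog.wp_seq, Prog.transform, ihp, ihq]
    | ite r p q ihp ihq => funext φ c; simp only [Prog.wp_ite, Prog.transform, ihp, ihq]; rfl
    | loop r p ih => funext φ c; simp only [Prog.wp_loop, Prog.transform, ih]; rfl
    | query o => exact o.elim
  rw [Prog.place, Prog.wp_subst hf, hp]
  have := Prog.transform_rel (Y := Cfg S) (X := Cfg R) (get₁ := Cfg.restrict f)
    (set₁ := Cfg.overlay f) (G₁ := fun o : Empty => ((fun o => o.elim : Empty → Prog S Empty) o).wp)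
    (get₂ := id) (set₂ := fun _ w => w) (G₂ := fun o : Empty => o.elim)
    (fun φ ψ => ∀ w, φ (c.overlay f w) = ψ w) ?_ (fun o => o.elim) ?_ p
    (φ := φ) (ψ := fun w => φ (c.overlay f w)) (fun _ => rfl)
  · simpa using this (c.restrict f)
  · intro i φ ψ h w
    simp only [Cfg.restrict_overlay hf, Cfg.overlay_overlay, h, id]
  · intro r Φ Ψ h w
    simp only [Cfg.restrict_overlay hf, h, id]

end interpreter

/-! ### Trace preservation -/

section trace

variable {R : Type}

open Classical in
/-- The trace, as a functional on matrix entries. -/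
def Cfg.trace (c : Cfg R) : ℂ := if c.ket = c.bra then 1 else 0

/-- The stacks of qubits have the same heights in the ket and in the bra. Since the heights are
never in superposition, all matrix entries that occur in the run of a program have this property;
without it, `qmove` is not trace preserving. -/
def Cfg.Balanced (c : Cfg R) : Prop := ∀ r, (c.ket r).length = (c.bra r).length

open Classical in
theorem Cfg.conjugate_apply (V : Store R → (Store R →₀ ℂ)) (c c' : Cfg R) :
    c.conjugate V c' =
      if c.cl = c'.cl then V c.ket c'.ket * starRingEnd ℂ (V c.bra c'.bra) else 0 := by
  obtain ⟨l, x, y⟩ := c'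
  simp only [Cfg.conjugate, Finsupp.sum, Finsupp.finsetSum_apply, Finsupp.single_apply,
    Cfg.mk.injEq]
  split_ifs with h
  · simp only [h, true_and, ite_and, Finset.sum_ite_irrel, Finset.sum_ite_eq',
      Finset.sum_const_zero]
    split_ifs <;> simp_all
  · simp [h]

open Classical in
/-- An operator that is given on basis vectors, is isometric between basis vectors with the same
stack heights, and changes the stack heights in a way that depends on the heights only. -/
structure IsLocalIsometry (V : Store R → (Store R →₀ ℂ)) : Prop where
  height : ∃ g : (R → ℕ) → R → ℕ, ∀ x x', V x x' ≠ 0 →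
    ∀ r, (x' r).length = g (fun s => (x s).length) r
  inner : ∀ x y, (∀ r, (x r).length = (y r).length) →
    ((V x).sum fun x' z => (V y).sum fun y' w => if x' = y' then z * starRingEnd ℂ w else 0) =
      if x = y then 1 else 0

open Classical in
/-- Conjugation with a local isometry preserves the trace, on matrix entries between basis vectors of
the same heights. -/
theorem ev_conjugate_trace {V : Store R → (Store R →₀ ℂ)} (hV : IsLocalIsometry V) {c : Cfg R}
    (hc : c.Balanced) : ev (c.conjugate V) Cfg.trace = c.trace := by
  rw [Cfg.trace, ← hV.inner _ _ hc]
  have h : ∀ (s : Finset (Store R)) (f : Store R → CQState R),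
      ev (∑ x ∈ s, f x) Cfg.trace = ∑ x ∈ s, ev (f x) Cfg.trace := by
    intro s f; simp only [ev_eq_linearCombination, map_sum]
  simp only [Cfg.conjugate, Finsupp.sum, h, ev_single, Cfg.trace, mul_ite, mul_one, mul_zero]

theorem isLocalIsometry_single (g : Store R → Store R) (u : Store R → ℂ)
    (hu : ∀ x, u x * starRingEnd ℂ (u x) = 1)
    (hg : ∀ x y, (∀ r, (x r).length = (y r).length) → g x = g y → x = y)
    (hl : ∃ k : (R → ℕ) → R → ℕ, ∀ x r, (g x r).length = k (fun s => (x s).length) r) :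
    IsLocalIsometry fun x => Finsupp.single (g x) (u x) := by
  classical
  constructor
  · obtain ⟨k, hk⟩ := hl
    refine ⟨k, fun x x' h => ?_⟩
    have : x' = g x := by
      by_contra hne
      exact h (by rw [Finsupp.single_apply, if_neg (Ne.symm hne)])
    subst this
    exact hk x
  · intro x y hxy
    rw [Finsupp.sum_single_index (by simp), Finsupp.sum_single_index (by simp)]
    by_cases h : x = y
    · subst h; simp [hu]
    · rw [if_neg h, if_neg fun h' => h (hg x y hxy h')]

theorem tEntry_mul_conj (b : Bool) : tEntry b * starRingEnd ℂ (tEntry b) = 1 := by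
  cases b
  · simp [tEntry]
  · simp only [tEntry, if_true]
    rw [← Complex.exp_conj, ← Complex.exp_add]
    simp [map_ofNat (starRingEnd ℂ) 4]

theorem hadamardEntry_inner (a b : Bool) :
    hadamardEntry false a * starRingEnd ℂ (hadamardEntry false b) +
      hadamardEntry true a * starRingEnd ℂ (hadamardEntry true b) = if a = b then 1 else 0 := by
  have h : ((Real.sqrt 2 : ℝ) : ℂ) * ((Real.sqrt 2 : ℝ) : ℂ) = 2 := by
    rw [← Complex.ofReal_mul, Real.mul_self_sqrt (by norm_num)]; norm_num
  have h0 : ((Real.sqrt 2 : ℝ) : ℂ) ≠ 0 := by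
    intro h'; rw [h'] at h; norm_num at h
  cases a <;> cases b <;> simp [hadamardEntry] <;> field_simp <;> rw [sq, h] <;> norm_num

/-- The heights after replacing the string in one register by one of known length. -/
theorem exists_height_update (r : R) (k : (R → ℕ) → ℕ) (v : Store R → List Bool)
    (hv : ∀ x, (v x).length = k fun s => (x s).length) :
    ∃ g : (R → ℕ) → R → ℕ, ∀ x s, (open Classical in Function.update x r (v x) s).length =
      g (fun s => (x s).length) s := by
  classical
  refine ⟨fun l => Function.update l r (k l), fun x s => ?_⟩
  by_cases h : s = r
  · subst h; simp [hv]
  · simp [h]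

open Classical in
theorem isLocalIsometry_had (r : R) : IsLocalIsometry fun x : Store R =>
    match x r with
    | [] => Finsupp.single x 1
    | b :: w => Finsupp.single (Function.update x r (false :: w)) (hadamardEntry false b)
        + Finsupp.single (Function.update x r (true :: w)) (hadamardEntry true b) := by
  constructor
  · refine ⟨id, fun x x' h s => ?_⟩
    rcases hx : x r with _ | ⟨b, w⟩
    · simp only [hx, Finsupp.single_apply] at h
      split_ifs at h with h'
      · subst h'; rfl
      · exact absurd rfl h
    · simp only [hx, Finsupp.add_apply, Finsupp.single_apply] at h
      by_cases hs : s = r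
      · subst hs
        split_ifs at h with h1 h2 h2
        · simp [← h1, hx]
        · simp [← h1, hx]
        · simp [← h2, hx]
        · simp at h
      · split_ifs at h with h1 h2 h2
        · simp [← h1, hs]
        · simp [← h1, hs]
        · simp [← h2, hs]
        · simp at h
  · intro x y hxy
    -- Both images are sums of two basis vectors; those with different top qubits are orthogonal.
    rcases hx : x r with _ | ⟨a, u⟩
    · have hy : y r = [] := by simpa [hx] using (hxy r).symm
      simp [hy, Finsupp.single_apply, eq_comm]
    · obtain ⟨b, v, hy⟩ : ∃ b v, y r = b :: v := by
        rcases hy : y r with _ | ⟨b, v⟩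
        · simpa [hx, hy] using hxy r
        · exact ⟨b, v, rfl⟩
      have hsum : ∀ (f g : Store R) (p q : ℂ) (k : Store R → ℂ → ℂ), (∀ x, k x 0 = 0) →
          (∀ x s t, k x (s + t) = k x s + k x t) →
          (Finsupp.single f p + Finsupp.single g q).sum k = k f p + k g q := by
        intro f g p q k h0 h1
        rw [Finsupp.sum_add_index' h0 h1, Finsupp.sum_single_index (h0 _),
          Finsupp.sum_single_index (h0 _)]
      simp only [hy]
      rw [hsum _ _ _ _ _ (by simp) (by
        intro x s t
        simp only [add_mul, ← Finsupp.sum_add]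
        refine Finsupp.sum_congr fun y _ => ?_
        split_ifs <;> simp)]
      rw [hsum _ _ _ _ _ (by simp) (by intro x s t; split_ifs <;> simp [mul_add]),
        hsum _ _ _ _ _ (by simp) (by intro x s t; split_ifs <;> simp [mul_add])]
      have hne : ∀ c d : Bool, c ≠ d →
          Function.update x r (c :: u) ≠ Function.update y r (d :: v) := by
        intro c d hcd h
        have := congrFun h r
        simp [hcd] at this
      rw [if_neg (hne false true (by simp)), if_neg (hne true false (by simp)), add_zero, zero_add]
      have heq : ∀ c, Function.update x r (c :: u) = Function.update y r (c :: v) ↔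
          u = v ∧ ∀ s, s ≠ r → x s = y s := by
        intro c
        constructor
        · intro h
          refine ⟨by simpa using congrFun h r, fun s hs => by simpa [hs] using congrFun h s⟩
        · rintro ⟨rfl, h⟩
          funext s
          by_cases hs : s = r
          · subst hs; simp
          · simp [hs, h s hs]
      simp only [heq]
      by_cases h : u = v ∧ ∀ s, s ≠ r → x s = y s
      · rw [if_pos h, if_pos h, hadamardEntry_inner]
        congr 1
        refine propext ⟨fun hab => ?_, fun hxy' => ?_⟩
        · funext s
          by_cases hs : s = r
          · subst hs; rw [hx, hy, hab, h.1]
          · exact h.2 s hs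
        · have := congrFun hxy' r
          rw [hx, hy] at this
          exact (List.cons.inj this).1
      · rw [if_neg h, if_neg h, if_neg, add_zero]
        rintro rfl
        rw [hx] at hy
        exact h ⟨(List.cons.inj hy).2, fun _ _ => rfl⟩

/-- The kinds of instructions: local isometries, classical instructions, and the three that measure
or discard qubits. -/
theorem Instr.eval_cases (i : Instr R) :
    (∃ V, IsLocalIsometry V ∧ ∀ c, i.eval c = c.conjugate V) ∨
    (∃ g : Store R → Store R, ∀ c, i.eval c = Finsupp.single { c with cl := g c.cl } 1) ∨
    (∃ r s, i = .meas r s) ∨ (∃ r s, i = .qtest r s) ∨ ∃ T, i = .reset T := by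
  classical
  have hupd : ∀ (x : Store R) r, Function.update x r (x r) = x := fun x r =>
    Function.update_eq_self r x
  cases i with
  | push b r => exact .inr (.inl ⟨fun x => Function.update x r (b :: x r), fun c => rfl⟩)
  | pop r => exact .inr (.inl ⟨fun x => Function.update x r (x r).tail, fun c => rfl⟩)
  | copy r s => exact .inr (.inl ⟨fun x => Function.update x r (x s), fun c => rfl⟩)
  | cut r s => exact .inr (.inl ⟨fun x => Function.update x r ((x r).take (x s).length), fun c => rfl⟩)
  | pair r s t => exact .inr (.inl ⟨fun x => Function.update x r (pairCode (x s) (x t)), fun c => rfl⟩)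
  | unpair r s t => exact .inr (.inl ⟨fun x =>
      Function.update (Function.update x r (unpairCode (x t)).1) s (unpairCode (x t)).2, fun c => rfl⟩)
  | meas r s => exact .inr (.inr (.inl ⟨r, s, rfl⟩))
  | qtest r s => exact .inr (.inr (.inr (.inl ⟨r, s, rfl⟩)))
  | reset T => exact .inr (.inr (.inr (.inr ⟨T, rfl⟩)))
  | qnew r =>
    refine .inl ⟨_, isLocalIsometry_single (fun x => Function.update x r (false :: x r))
      (fun _ => 1) (by simp) ?_ (by
        convert exists_height_update r (fun l => l r + 1) (fun x => false :: x r) (by simp)),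
      fun c => rfl⟩
    intro x y _ h
    funext s
    by_cases hs : s = r
    · subst hs; simpa using congrFun h s
    · simpa [hs] using congrFun h s
  | had r => exact .inl ⟨_, isLocalIsometry_had r, fun c => rfl⟩
  | tgate r =>
    refine .inl ⟨_, isLocalIsometry_single id
      (fun x => match x r with | [] => 1 | b :: _ => tEntry b) ?_ (fun x y _ h => h)
      ⟨id, fun x r => rfl⟩, fun c => ?_⟩
    · intro x
      rcases x r with _ | ⟨b, w⟩
      · simp
      · exact tEntry_mul_conj b
    · simp only [Instr.eval]
      congr 1
      funext x
      rcases x r with _ | ⟨b, w⟩ <;> rfl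
  | cnot r s =>
    refine .inl ⟨_, isLocalIsometry_single
      (fun x => match x r, x s with
        | true :: _, b :: w => if r = s then x else Function.update x s ((!b) :: w)
        | _, _ => x)
      (fun _ => 1) (by simp) ?_ ⟨id, ?_⟩, fun c => ?_⟩
    · intro x y hxy h
      by_cases hrs : r = s
      · subst hrs
        rcases hx : x r with _ | ⟨_ | _, u⟩ <;> rcases hy : y r with _ | ⟨_ | _, v⟩ <;>
          simpa [hx, hy] using h
      · have hr : x r = y r := by
          have := congrFun h r
          rcases hx : x r with _ | ⟨_ | _, u⟩ <;> rcases hy : y r with _ | ⟨_ | _, v⟩ <;>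
            rcases hx' : x s with _ | ⟨_, u'⟩ <;> rcases hy' : y s with _ | ⟨_, v'⟩ <;>
              simp_all
        have hs : x s = y s := by
          have := congrFun h s
          have hl := hxy s
          rw [hr] at this
          rcases hy : y r with _ | ⟨_ | _, v⟩ <;>
            rcases hx' : x s with _ | ⟨_, u'⟩ <;> rcases hy' : y s with _ | ⟨_, v'⟩ <;>
              simp_all
        funext t
        by_cases ht : t = s
        · subst ht; exact hs
        · have := congrFun h t
          rw [hr, hs] at this
          rcases hy : y r with _ | ⟨_ | _, v⟩ <;> rcases hy' : y s with _ | ⟨_, v'⟩ <;>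
            simpa [hy, hy', hrs, ht] using this
    · intro x t
      rcases hx : x r with _ | ⟨_ | _, u⟩ <;> rcases hx' : x s with _ | ⟨_, u'⟩ <;> try rfl
      split_ifs
      · rfl
      · by_cases ht : t = s
        · subst ht; simp [hx']
        · simp [ht]
    · simp only [Instr.eval]
      congr 1
      funext x
      rcases x r with _ | ⟨_ | _, u⟩ <;> rcases x s with _ | ⟨_, u'⟩ <;> rfl
  | qmove r s =>
    refine .inl ⟨_, isLocalIsometry_single
      (fun x => match x r with
        | [] => x
        | b :: w => Function.update (Function.update x r w) s (b :: Function.update x r w s))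
      (fun _ => 1) (by simp) ?_
      ⟨fun l => if l r = 0 then l else
        Function.update (Function.update l r (l r - 1)) s
          (Function.update l r (l r - 1) s + 1), ?_⟩, fun c => ?_⟩
    · intro x y hxy h
      have hl := hxy r
      rcases hx : x r with _ | ⟨a, u⟩ <;> rcases hy : y r with _ | ⟨b, v⟩ <;>
        simp only [hx, hy] at h hl
      · exact h
      · simp at hl
      · simp at hl
      · have h1 := congrFun h s
        simp only [Function.update_self] at h1
        obtain ⟨rfl, h1'⟩ := List.cons.inj h1
        have h2 : Function.update x r u = Function.update y r v := by
          funext t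
          by_cases ht : t = s
          · subst ht; exact h1'
          · simpa [ht] using congrFun h t
        funext t
        by_cases ht : t = r
        · subst ht
          rw [hx, hy]
          simpa using congrFun h2 t
        · simpa [ht] using congrFun h2 t
    · intro x t
      suffices h : ∀ l, x r = l → ((match l with
          | [] => x
          | b :: w => Function.update (Function.update x r w) s (b :: Function.update x r w s))
            t).length = (if (x r).length = 0 then fun s => (x s).length else
              Function.update (Function.update (fun s => (x s).length) r ((x r).length - 1)) s
              (Function.update (fun s => (x s).length) r ((x r).length - 1) s + 1)) t from
        h _ rfl
      intro l hl
      rcases l with _ | ⟨b, w⟩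
      · simp [hl]
      · simp only [hl, List.length_cons, Nat.add_sub_cancel, Nat.add_eq_zero_iff, one_ne_zero,
          and_false, if_false, Function.update_apply]
        split_ifs <;> simp
    · simp only [Instr.eval]
      congr 1
      funext x
      rcases x r with _ | ⟨b, w⟩ <;> rfl
  | qswap r s =>
    refine .inl ⟨_, isLocalIsometry_single (fun x => x ∘ Equiv.swap r s) (fun _ => 1) (by simp) ?_
      ⟨fun l => l ∘ Equiv.swap r s, fun x t => rfl⟩, fun c => rfl⟩
    intro x y _ h
    exact (Equiv.swap r s).surjective.injective_comp_right h

theorem Instr.ev_eval_trace (i : Instr R) {c : Cfg R} (hc : c.Balanced) :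
    ev (i.eval c) Cfg.trace = c.trace := by
  classical
  rcases i.eval_cases with ⟨V, hV, h⟩ | ⟨g, h⟩ | ⟨r, s, rfl⟩ | ⟨r, s, rfl⟩ | ⟨T, rfl⟩
  · rw [h, ev_conjugate_trace hV hc]
  · simp [h, Cfg.trace]
  · have hl := hc r
    simp only [Instr.eval]
    rcases hx : c.ket r with _ | ⟨a, u⟩ <;> rcases hy : c.bra r with _ | ⟨b, v⟩ <;>
      simp only [hx, hy] at hl ⊢
    · simp
    · simp at hl
    · simp at hl
    · by_cases hab : a = b
      · subst hab
        simp only [if_true, ev_single, one_mul, Cfg.trace]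
        congr 1
        refine propext ⟨fun h => ?_, fun h => ?_⟩
        · funext t
          by_cases ht : t = r
          · subst ht
            rw [hx, hy]
            simpa using congrFun h t
          · simpa [ht] using congrFun h t
        · have := congrFun h r
          rw [hx, hy] at this
          rw [h, (List.cons.inj this).2]
      · rw [if_neg hab, ev_zero_left, Cfg.trace, if_neg]
        intro h
        have := congrFun h r
        rw [hx, hy] at this
        exact hab (List.cons.inj this).1
  · have : (c.ket r).isEmpty = (c.bra r).isEmpty := by
      have hl := hc r
      rcases hx : c.ket r with _ | ⟨a, u⟩ <;> rcases hy : c.bra r with _ | ⟨b, v⟩ <;>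
        simp_all
    simp only [Instr.eval]
    rw [if_pos this]
    simp [Cfg.trace]
  · by_cases h : ∀ r ∈ T, c.ket r = c.bra r
    · rw [Instr.eval_reset_of_forall h]
      simp only [ev_single, one_mul, Cfg.trace]
      congr 1
      refine propext ⟨fun h' => ?_, fun h' => by rw [h']⟩
      funext t
      by_cases ht : t ∈ T
      · exact h t ht
      · simpa [ht] using congrFun h' t
    · rw [Instr.eval_reset_of_not_forall h, ev_zero_left, Cfg.trace, if_neg]
      intro h'
      exact h fun r _ => by rw [h']

theorem Instr.balanced_of_eval (i : Instr R) {c c' : Cfg R} (hc : c.Balanced)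
    (h : i.eval c c' ≠ 0) : c'.Balanced := by
  classical
  have hs : ∀ d : Cfg R, Finsupp.single d (1 : ℂ) c' ≠ 0 → c' = d := by
    intro d h; by_contra hne
    exact h (by rw [Finsupp.single_apply, if_neg (Ne.symm hne)])
  rcases i.eval_cases with ⟨V, hV, hV'⟩ | ⟨g, hg⟩ | ⟨r, s, rfl⟩ | ⟨r, s, rfl⟩ | ⟨T, rfl⟩
  · obtain ⟨g, hg⟩ := hV.height
    rw [hV', Cfg.conjugate_apply] at h
    split_ifs at h
    · have h1 := left_ne_zero_of_mul h
      have h2 : V c.bra c'.bra ≠ 0 := by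
        intro h0; exact h (by rw [h0]; simp)
      intro r
      rw [hg _ _ h1, hg _ _ h2, show (fun s => (c.ket s).length) = fun s => (c.bra s).length from
        funext hc]
    · exact absurd rfl h
  · rw [hg] at h
    rw [hs _ h]; exact hc
  · have hl := hc r
    simp only [Instr.eval] at h
    rcases hx : c.ket r with _ | ⟨a, u⟩ <;> rcases hy : c.bra r with _ | ⟨b, v⟩ <;>
      simp only [hx, hy] at hl h
    · rw [hs _ h]; exact hc
    · simp at hl
    · simp at hl
    · split_ifs at h
      · rw [hs _ h]
        intro t
        by_cases ht : t = r
        · subst ht; simpa using hl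
        · simpa [ht] using hc t
      · exact absurd rfl h
  · simp only [Instr.eval] at h
    split_ifs at h
    · rw [hs _ h]; exact hc
    · exact absurd rfl h
  · by_cases h0 : ∀ r ∈ T, c.ket r = c.bra r
    · rw [Instr.eval_reset_of_forall h0] at h
      rw [hs _ h]
      intro t
      by_cases ht : t ∈ T
      · simp [ht]
      · simpa [ht] using hc t
    · rw [Instr.eval_reset_of_not_forall h0] at h
      exact absurd rfl h

/-- If `|k⟩⟨b|` has a component `|k'⟩⟨b'|` after an instruction, then `|k⟩⟨k|` has a component
`|k'⟩⟨k'|`. -/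
theorem Instr.eval_diag_ne_zero (i : Instr R) {c c' : Cfg R} (h : i.eval c c' ≠ 0) :
    i.eval ⟨c.cl, c.ket, c.ket⟩ ⟨c'.cl, c'.ket, c'.ket⟩ ≠ 0 := by
  classical
  have hs : ∀ d : Cfg R, Finsupp.single d (1 : ℂ) c' ≠ 0 → c' = d := by
    intro d h; by_contra hne
    exact h (by rw [Finsupp.single_apply, if_neg (Ne.symm hne)])
  rcases i.eval_cases with ⟨V, hV, hV'⟩ | ⟨g, hg⟩ | ⟨r, s, rfl⟩ | ⟨r, s, rfl⟩ | ⟨T, rfl⟩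
  · rw [hV', Cfg.conjugate_apply] at h ⊢
    split_ifs at h with hcl
    · rw [if_pos hcl]
      have h1 := left_ne_zero_of_mul h
      exact mul_ne_zero h1 ((map_ne_zero _).2 h1)
    · exact absurd rfl h
  · rw [hg] at h ⊢
    rw [hs _ h]; simp
  · simp only [Instr.eval] at h ⊢
    rcases hx : c.ket r with _ | ⟨a, u⟩ <;> rcases hy : c.bra r with _ | ⟨b, v⟩ <;>
      simp only [hx, hy] at h ⊢
    · rw [hs _ h]; simp
    · exact absurd rfl h
    · exact absurd rfl h
    · split_ifs at h
      · rw [hs _ h]; simp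
      · exact absurd rfl h
  · simp only [Instr.eval] at h ⊢
    split_ifs at h
    · rw [hs _ h]; simp
    · exact absurd rfl h
  · by_cases h0 : ∀ r ∈ T, c.ket r = c.bra r
    · rw [Instr.eval_reset_of_forall h0] at h
      rw [Instr.eval_reset_of_forall fun r _ => rfl, hs _ h]
      simp
    · rw [Instr.eval_reset_of_not_forall h0] at h
      exact absurd rfl h

end trace

/-! ### Computation paths -/

section paths

variable {R S O P X : Type}

/-- The basis configuration of the ket of a matrix entry. -/
def Cfg.point (c : Cfg R) : Point R := ⟨c.cl, c.ket⟩

/-- The part of a basis configuration in the registers `f r`. -/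
def Point.restrict (f : R → S) (m : Point S) : Point R := ⟨m.cl ∘ f, m.q ∘ f⟩

/-- The configuration `m`, with the contents of the registers `f r` replaced by `w`. -/
def Point.overlay (f : R → S) (m : Point S) (w : Point R) : Point S :=
  ⟨Function.extend f w.cl m.cl, Function.extend f w.q m.q⟩

theorem Point.overlay_eq {f : R → S} (hf : f.Injective) {m m' : Point S}
    (h : ∀ s ∉ Set.range f, m'.cl s = m.cl s ∧ m'.q s = m.q s) :
    m' = m.overlay f (m'.restrict f) := by
  have hx : ∀ x y : Store S, (∀ s ∉ Set.range f, x s = y s) →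
      x = Function.extend f (x ∘ f) y := by
    intro x y hxy
    funext s
    by_cases hs : ∃ r, f r = s
    · obtain ⟨r, rfl⟩ := hs; simp [hf.extend_apply]
    · rw [Function.extend_apply' _ _ _ hs, hxy s hs]
  obtain ⟨a, b⟩ := m'
  simp only [Point.overlay, Point.restrict, Point.mk.injEq]
  exact ⟨hx a _ fun s hs => (h s hs).1, hx b _ fun s hs => (h s hs).2⟩

/-- No computation path gets stuck. -/
theorem Instr.exists_eval_ne_zero (i : Instr R) (m : Point R) :
    ∃ m' : Point R, i.eval ⟨m.cl, m.q, m.q⟩ ⟨m'.cl, m'.q, m'.q⟩ ≠ 0 := by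
  have h := i.ev_eval_trace (c := ⟨m.cl, m.q, m.q⟩) fun _ => rfl
  by_contra! hne
  have h0 : ev (i.eval ⟨m.cl, m.q, m.q⟩) Cfg.trace = ev (i.eval ⟨m.cl, m.q, m.q⟩) fun _ => 0 := by
    refine ev_congr fun c hc => ?_
    rw [Cfg.trace, if_neg]
    intro hkb
    obtain ⟨l, x, y⟩ := c
    simp only at hkb
    subst hkb
    exact hc (hne ⟨l, x⟩)
  rw [h, ev_zero_right, Cfg.trace, if_pos rfl] at h0
  exact one_ne_zero h0

theorem Outcome.iter_nonempty {f : Point R → Set (Outcome R O)} (h : ∀ m, (f m).Nonempty) (n : ℕ)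
    (m : Point R) : (Outcome.iter f n m).Nonempty := by
  induction n generalizing m with
  | zero => exact ⟨_, rfl⟩
  | succ n ih =>
    obtain ⟨o₁, h₁⟩ := h m
    obtain ⟨o₂, h₂⟩ := ih o₁.final
    exact ⟨_, o₁, h₁, o₂, h₂, rfl⟩

theorem Prog.paths_nonempty (ans : Set R) (p : Prog R O) (m : Point R) :
    (p.paths ans m).Nonempty := by
  induction p generalizing m with
  | skip => exact ⟨_, rfl⟩
  | instr i =>
    obtain ⟨m', h⟩ := i.exists_eval_ne_zero m
    exact ⟨⟨m', i.cost m, []⟩, h, rfl, rfl⟩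
  | seq p q ihp ihq =>
    obtain ⟨o₁, h₁⟩ := ihp m
    obtain ⟨o₂, h₂⟩ := ihq o₁.final
    exact ⟨_, o₁, h₁, o₂, h₂, rfl⟩
  | ite r p q ihp ihq =>
    simp only [Prog.paths]
    split_ifs
    · obtain ⟨o₂, h₂⟩ := ihp m
      exact ⟨_, _, rfl, o₂, h₂, rfl⟩
    · obtain ⟨o₂, h₂⟩ := ihq m
      exact ⟨_, _, rfl, o₂, h₂, rfl⟩
  | loop r p ih => exact Outcome.iter_nonempty ih _ _
  | query o => exact ⟨⟨m, 1, [(o, m.cl)]⟩, fun r _ => ⟨rfl, rfl⟩, rfl, rfl⟩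

/-- Two interpretations of a program agree if the oracles agree in the situations that can occur.
`K l x` says that the state `x` is possible after the list `l` of oracle calls, and `W` is a
property of all lists of oracle calls on computation paths. -/
theorem Prog.transform_congr_paths {get : X → Cfg R} {set : X → Cfg R → X}
    (hgs : ∀ x w, get (set x w) = w) {G G' : O → (X → ℂ) → X → ℂ} (ans : Set R)
    (K : List (O × Store R) → X → Prop) (W : List (O × Store R) → Prop)
    (hW : ∀ l l', W (l ++ l') → W l)
    (hK : ∀ l x w (i : Instr R), K l x → i.eval (get x) w ≠ 0 → K l (set x w))
    (hG : ∀ o l x φ φ', W (l ++ [(o, (get x).cl)]) → K l x →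
      (∀ x', (∀ r ∉ ans, (get x').cl r = (get x).cl r ∧ (get x').ket r = (get x).ket r) →
        K (l ++ [(o, (get x).cl)]) x' → φ x' = φ' x') → G o φ x = G' o φ' x)
    (p : Prog R O) : ∀ l x φ φ', K l x → (∀ o ∈ p.paths ans (get x).point, W (l ++ o.calls)) →
      (∀ o ∈ p.paths ans (get x).point, ∀ x', (get x').point = o.final →
        K (l ++ o.calls) x' → φ x' = φ' x') →
      p.transform get set G φ x = p.transform get set G' φ' x := by
  induction p with
  | skip =>
    intro l x φ φ' hx _ hφ
    exact hφ ⟨(get x).point, 1, []⟩ rfl x rfl (by simpa using hx)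
  | instr i =>
    intro l x φ φ' hx _ hφ
    refine ev_congr fun w hw => ?_
    refine hφ ⟨w.point, i.cost (get x).point, []⟩ ⟨i.eval_diag_ne_zero hw, rfl, rfl⟩ _
      (by rw [hgs]) (by simpa using hK l x w i hx hw)
  | seq p q ihp ihq =>
    intro l x φ φ' hx hV hφ
    refine ihp l x _ _ hx (fun o₁ h₁ => ?_) fun o₁ h₁ x' hx' hK' => ?_
    · obtain ⟨o₂, h₂⟩ := q.paths_nonempty ans o₁.final
      have := hV _ ⟨o₁, h₁, o₂, h₂, rfl⟩
      rw [← List.append_assoc] at this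
      exact hW _ _ this
    · refine ihq _ x' φ φ' hK' (fun o₂ h₂ => ?_) fun o₂ h₂ x'' hx'' hK'' => ?_
      · rw [hx'] at h₂
        rw [List.append_assoc]
        exact hV _ ⟨o₁, h₁, o₂, h₂, rfl⟩
      · rw [hx'] at h₂
        rw [List.append_assoc] at hK''
        exact hφ _ ⟨o₁, h₁, o₂, h₂, rfl⟩ x'' hx'' hK''
  | ite r p q ihp ihq =>
    intro l x φ φ' hx hV hφ
    simp only [Prog.paths] at hV hφ
    simp only [Prog.transform]
    have hcl : (get x).point.cl = (get x).cl := rfl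
    rw [hcl] at hV hφ
    split_ifs with hr
    · rw [if_pos hr] at hV hφ
      exact ihp l x φ φ' hx (fun o ho => hV ⟨o.final, 1 + o.time, [] ++ o.calls⟩ ⟨_, rfl, o, ho, rfl⟩)
        fun o ho => hφ ⟨o.final, 1 + o.time, [] ++ o.calls⟩ ⟨_, rfl, o, ho, rfl⟩
    · rw [if_neg hr] at hV hφ
      exact ihq l x φ φ' hx (fun o ho => hV ⟨o.final, 1 + o.time, [] ++ o.calls⟩ ⟨_, rfl, o, ho, rfl⟩)
        fun o ho => hφ ⟨o.final, 1 + o.time, [] ++ o.calls⟩ ⟨_, rfl, o, ho, rfl⟩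
  | loop r p ih =>
    intro l x φ φ' hx hV hφ
    simp only [Prog.paths] at hV hφ
    simp only [Prog.transform]
    have hcl : (get x).point.cl = (get x).cl := rfl
    rw [hcl] at hV hφ
    clear hcl
    generalize ((get x).cl r).length = n at hV hφ ⊢
    induction n generalizing l x with
    | zero => exact hφ ⟨(get x).point, 1, []⟩ rfl x rfl (by simpa using hx)
    | succ n ihn =>
      simp only [Function.iterate_succ_apply']
      refine ih l x _ _ hx (fun o₁ h₁ => ?_) fun o₁ h₁ x' hx' hK' => ?_
      -- The path of the first part extends to a path of the program, so that `W` applies to it.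
      · obtain ⟨o₂, h₂⟩ := Outcome.iter_nonempty (p.paths_nonempty ans) n o₁.final
        have := hV _ ⟨o₁, h₁, o₂, h₂, rfl⟩
        rw [← List.append_assoc] at this
        exact hW _ _ this
      · refine ihn _ x' hK' (fun o₂ h₂ => ?_) fun o₂ h₂ x'' hx'' hK'' => ?_
        · rw [hx'] at h₂
          rw [List.append_assoc]
          exact hV _ ⟨o₁, h₁, o₂, h₂, rfl⟩
        · rw [hx'] at h₂
          rw [List.append_assoc] at hK''
          exact hφ _ ⟨o₁, h₁, o₂, h₂, rfl⟩ x'' hx'' hK''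
  | query o =>
    intro l x φ φ' hx hV hφ
    refine hG o l x φ φ' ?_ hx fun x' hx' hK' => ?_
    · exact hV ⟨(get x).point, 1, [(o, (get x).cl)]⟩ ⟨fun r _ => ⟨rfl, rfl⟩, rfl, rfl⟩
    · exact hφ ⟨(get x').point, 1, [(o, (get x).cl)]⟩ ⟨hx', rfl, rfl⟩ x' rfl hK'

/-- A program without oracles is its own interpretation on configurations. -/
theorem Prog.wp_eq_transform (p : Prog R Empty) :
    p.wp = p.transform (X := Cfg R) id (fun _ w => w) fun o => o.elim := by
  induction p with
  | skip => funext φ; exact Prog.wp_skip φ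
  | instr i => rfl
  | seq p q ihp ihq => funext φ; simp only [Prog.wp_seq, Prog.transform, ihp, ihq]
  | ite r p q ihp ihq => funext φ c; simp only [Prog.wp_ite, Prog.transform, ihp, ihq]; rfl
  | loop r p ih => funext φ c; simp only [Prog.wp_loop, Prog.transform, ih]; rfl
  | query o => exact o.elim

/-- Only the final states at the ends of computation paths matter. -/
theorem Prog.wp_congr_paths (p : Prog R Empty) {c : Cfg R} {φ φ' : Cfg R → ℂ} (hc : c.Balanced)
    (h : ∀ o ∈ p.paths ∅ c.point, ∀ c' : Cfg R, c'.Balanced → c'.point = o.final → φ c' = φ' c') :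
    p.wp φ c = p.wp φ' c := by
  rw [Prog.wp_eq_transform]
  refine Prog.transform_congr_paths (fun _ _ => rfl) ∅ (fun _ c => c.Balanced) (fun _ => True)
    (fun _ _ _ => trivial) (fun _ x w i hx hw => i.balanced_of_eval hx hw) (fun o => o.elim) p []
    c φ φ' hc (fun _ _ => trivial) fun o ho x' hx' hb => h o ho x' hb hx'

/-- The outcomes of a program without oracles have total probability one. -/
theorem Prog.wp_trace (p : Prog R Empty) {c : Cfg R} (hc : c.Balanced) :
    p.wp Cfg.trace c = c.trace := by
  induction p generalizing c with
  | skip => rw [Prog.wp_skip]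
  | instr i => exact i.ev_eval_trace hc
  | seq p q ihp ihq =>
    rw [Prog.wp_seq, p.wp_congr_paths hc fun _ _ c' hc' _ => ihq hc', ihp hc]
  | ite r p q ihp ihq =>
    rw [Prog.wp_ite]
    split_ifs
    · exact ihp hc
    · exact ihq hc
  | loop r p ih =>
    rw [Prog.wp_loop]
    generalize (c.cl r).length = n
    induction n generalizing c with
    | zero => rfl
    | succ n ihn =>
      rw [Function.iterate_succ_apply', p.wp_congr_paths hc fun _ _ c' hc' _ => ihn hc', ih hc]
  | query o => exact o.elim

/-! ### Lengths of strings and number of oracle calls -/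

theorem length_pairCode (x y : List Bool) : (pairCode x y).length = 2 * x.length + 1 + y.length := by
  induction x with
  | nil => simp [pairCode]; omega
  | cons b x ih => simp [pairCode, ih]; omega

theorem length_unpairCode_le (z : List Bool) :
    (unpairCode z).1.length ≤ z.length ∧ (unpairCode z).2.length ≤ z.length := by
  fun_induction unpairCode z with
  | case1 y => simp
  | case2 b z ih => simp only [List.length_cons]; omega
  | case3 => simp

/-- An instruction lengthens the strings by at most twice its cost; the factor is due to `pair`, whose
result codes every bit of the first string by two. -/
theorem Instr.length_le_of_eval (i : Instr R) {ans : Set R} {L : ℕ} {m m' : Point R}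
    (hm : ∀ r ∉ ans, (m.cl r).length ≤ L)
    (h : i.eval ⟨m.cl, m.q, m.q⟩ ⟨m'.cl, m'.q, m'.q⟩ ≠ 0) :
    ∀ r ∉ ans, (m'.cl r).length ≤ L + 2 * i.cost m := by
  classical
  have hs : ∀ d : Cfg R, Finsupp.single d (1 : ℂ) ⟨m'.cl, m'.q, m'.q⟩ ≠ 0 → m'.cl = d.cl := by
    intro d h; by_contra hne
    exact h (by rw [Finsupp.single_apply, if_neg]; rintro rfl; exact hne rfl)
  have hu : ∀ (x : Store R) r v k, (∀ s ∉ ans, (x s).length ≤ L + k) → v.length ≤ L + k →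
      ∀ s ∉ ans, (Function.update x r v s).length ≤ L + k := by
    intro x r v k hx hv s hs'
    by_cases hsr : s = r
    · subst hsr; simpa using hv
    · simpa [hsr] using hx s hs'
  have hu1 : ∀ (x : Store R) r b k, (∀ s ∉ ans, (x s).length ≤ L + k) →
      ∀ s ∉ ans, (Function.update x r (b :: x r) s).length ≤ L + (k + 1) := by
    intro x r v k hx s hs'
    by_cases hsr : s = r
    · subst hsr; have := hx s hs'; simp; omega
    · have := hx s hs'; simp [hsr]; omega
  have hcj : ∀ V, Cfg.conjugate V ⟨m.cl, m.q, m.q⟩ ⟨m'.cl, m'.q, m'.q⟩ ≠ 0 →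
      ∀ r ∉ ans, (m'.cl r).length ≤ L + 2 * 1 := by
    intro V h
    rw [Cfg.conjugate_apply] at h
    split_ifs at h with hcl
    · intro r hr; have := hm r hr; simp only at hcl; rw [← hcl]; omega
    · exact absurd rfl h
  have hm' : ∀ k, ∀ r ∉ ans, (m.cl r).length ≤ L + k := fun k r hr => (hm r hr).trans (by omega)
  cases i with
  | push b r =>
    rw [hs _ h]
    exact hu1 _ _ _ 1 (hm' _)
  | pop r =>
    rw [hs _ h]
    intro s hs'
    by_cases hsr : s = r
    · subst hsr; have := hm s hs'; simp; omega
    · have := hm s hs'; simp [hsr]; omega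
  | copy r s =>
    rw [hs _ h]
    exact hu _ _ _ _ (hm' _) (by simp only [Instr.cost]; omega)
  | cut r s =>
    rw [hs _ h]
    exact hu _ _ _ _ (hm' _) (by simp only [Instr.cost, List.length_take]; omega)
  | pair r s t =>
    rw [hs _ h]
    exact hu _ _ _ _ (hm' _) (by simp only [Instr.cost, length_pairCode]; omega)
  | unpair r s t =>
    rw [hs _ h]
    have := length_unpairCode_le (m.cl t)
    exact hu _ _ _ _ (hu _ _ _ _ (hm' _) (by simp only [Instr.cost]; omega))
      (by simp only [Instr.cost]; omega)
  | qnew r => simp only [Instr.eval] at h; exact hcj _ h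
  | had r => simp only [Instr.eval] at h; exact hcj _ h
  | tgate r => simp only [Instr.eval] at h; exact hcj _ h
  | cnot r s => simp only [Instr.eval] at h; exact hcj _ h
  | qmove r s => simp only [Instr.eval] at h; exact hcj _ h
  | qswap r s => simp only [Instr.eval] at h; exact hcj _ h
  | meas r s =>
    simp only [Instr.eval] at h
    rcases hx : m.q r with _ | ⟨a, u⟩ <;> simp only [hx] at h
    · rw [hs _ h]
      exact hm' _
    · rw [if_true] at h
      rw [hs _ h]
      exact hu1 _ _ _ 1 (hm' _)
  | qtest r s =>
    simp only [Instr.eval, if_true] at h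
    rw [hs _ h]
    exact hu1 _ _ _ 1 (hm' _)
  | reset T =>
    rw [Instr.eval_reset_of_forall fun _ _ => rfl] at h
    rw [hs _ h]
    intro s hs'
    have := hm' (2 * (Instr.reset T).cost m) s hs'
    simp only
    split_ifs
    · simp
    · exact this

/-- A program that runs for `t` steps makes at most `t` oracle calls, and lengthens the strings
outside the registers for the answers by at most `2 * t`. -/
theorem Prog.length_le_of_mem_paths (ans : Set R) (p : Prog R O) : ∀ (L : ℕ) (m : Point R),
    (∀ r ∉ ans, (m.cl r).length ≤ L) → ∀ o ∈ p.paths ans m,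
      (∀ r ∉ ans, (o.final.cl r).length ≤ L + 2 * o.time) ∧
      (∀ e ∈ o.calls, ∀ r ∉ ans, (e.2 r).length ≤ L + 2 * o.time) ∧ o.calls.length ≤ o.time := by
  have hseq : ∀ (L : ℕ) (X : Set (Outcome R O)) (f : Point R → Set (Outcome R O)),
      (∀ o ∈ X, (∀ r ∉ ans, (o.final.cl r).length ≤ L + 2 * o.time) ∧
        (∀ e ∈ o.calls, ∀ r ∉ ans, (e.2 r).length ≤ L + 2 * o.time) ∧ o.calls.length ≤ o.time) →
      (∀ L m, (∀ r ∉ ans, (m.cl r).length ≤ L) → ∀ o ∈ f m,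
        (∀ r ∉ ans, (o.final.cl r).length ≤ L + 2 * o.time) ∧
        (∀ e ∈ o.calls, ∀ r ∉ ans, (e.2 r).length ≤ L + 2 * o.time) ∧ o.calls.length ≤ o.time) →
      ∀ o ∈ Outcome.andThen X f, (∀ r ∉ ans, (o.final.cl r).length ≤ L + 2 * o.time) ∧
        (∀ e ∈ o.calls, ∀ r ∉ ans, (e.2 r).length ≤ L + 2 * o.time) ∧
          o.calls.length ≤ o.time := by
    rintro L X f hX hf _ ⟨o₁, h₁, o₂, h₂, rfl⟩
    obtain ⟨a₁, b₁, c₁⟩ := hX o₁ h₁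
    obtain ⟨a₂, b₂, c₂⟩ := hf _ _ a₁ o₂ h₂
    refine ⟨fun r hr => (a₂ r hr).trans (by simp only; omega), fun e he r hr => ?_, ?_⟩
    · rcases List.mem_append.1 he with he | he
      · exact (b₁ e he r hr).trans (by simp only; omega)
      · exact (b₂ e he r hr).trans (by simp only; omega)
    · simp only [List.length_append]; omega
  have hunit : ∀ L (m : Point R), (∀ r ∉ ans, (m.cl r).length ≤ L) →
      ∀ o ∈ ({⟨m, 1, []⟩} : Set (Outcome R O)),
      (∀ r ∉ ans, (o.final.cl r).length ≤ L + 2 * o.time) ∧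
        (∀ e ∈ o.calls, ∀ r ∉ ans, (e.2 r).length ≤ L + 2 * o.time) ∧
          o.calls.length ≤ o.time := by
    rintro L m hm _ rfl
    exact ⟨fun r hr => (hm r hr).trans (by simp), by simp, by simp⟩
  induction p with
  | skip => exact hunit
  | instr i =>
    rintro L m hm o ⟨h, ht, hc⟩
    rw [ht, hc]
    exact ⟨i.length_le_of_eval hm h, by simp, by simp⟩
  | seq p q ihp ihq =>
    intro L m hm
    exact hseq L _ _ (ihp L m hm) ihq
  | ite r p q ihp ihq =>
    intro L m hm
    refine hseq L _ _ (hunit L m hm) ?_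
    split_ifs
    · exact ihp
    · exact ihq
  | loop r p ih =>
    intro L m hm
    simp only [Prog.paths]
    generalize (m.cl r).length = n
    induction n generalizing L m with
    | zero => exact hunit L m hm
    | succ n ihn => exact hseq L _ _ (ih L m hm) ihn
  | query o =>
    rintro L m hm w ⟨h, ht, hc⟩
    rw [ht, hc]
    refine ⟨fun r hr => ?_, fun e he r hr => ?_, by simp⟩
    · rw [(h r hr).1]; exact (hm r hr).trans (by simp)
    · rw [List.mem_singleton.1 he]; exact (hm r hr).trans (by simp)

/-! ### Computation paths of composed programs -/

theorem Instr.eval_map_ne_zero {f : R → S} (hf : f.Injective) (i : Instr R) {m m' : Point S}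
    (h : (i.map f).eval ⟨m.cl, m.q, m.q⟩ ⟨m'.cl, m'.q, m'.q⟩ ≠ 0) :
    (∀ s ∉ Set.range f, m'.cl s = m.cl s ∧ m'.q s = m.q s) ∧
      i.eval ⟨m.cl ∘ f, m.q ∘ f, m.q ∘ f⟩ ⟨m'.cl ∘ f, m'.q ∘ f, m'.q ∘ f⟩ ≠ 0 := by
  classical
  rw [Instr.eval_map hf] at h
  have hmem := Finsupp.mapDomain_support (Finsupp.mem_support_iff.2 h)
  obtain ⟨w, hw, hwm⟩ := Finset.mem_image.1 hmem
  have hw' : w = ⟨m'.cl ∘ f, m'.q ∘ f, m'.q ∘ f⟩ := by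
    rw [← Cfg.restrict_overlay hf ⟨m.cl, m.q, m.q⟩ w, hwm]; rfl
  constructor
  · intro s hs
    have h1 := congrArg Cfg.cl hwm
    have h2 := congrArg Cfg.ket hwm
    simp only [Cfg.overlay] at h1 h2
    rw [← h1, ← h2]
    exact ⟨Function.extend_apply' _ _ _ hs, Function.extend_apply' _ _ _ hs⟩
  · rw [← hw']
    exact Finsupp.mem_support_iff.1 hw

theorem Instr.cost_map (f : R → S) (i : Instr R) (m : Point S) :
    (i.map f).cost m = i.cost (m.restrict f) := by
  cases i <;> rfl

/-- The computation paths of a program whose oracle calls are replaced by programs. `I l m` is an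
invariant of the memory `m` outside the registers of the program after the list `l` of calls;
`cost` bounds the running time of the inserted programs, and `Good` relates the calls that they
make to the calls that they answer. -/
theorem Prog.mem_paths_subst {f : R → S} (hf : f.Injective) {h : O → Prog S P} (ans : Set R)
    (ans' : Set S) (I : List (P × Store S) → Point S → Prop) (cost : O × Store R → ℕ)
    (Good : O × Store R → P × Store S → Prop)
    (hI : ∀ l m m', (∀ s ∉ Set.range f, m'.cl s = m.cl s ∧ m'.q s = m.q s) → I l m → I l m')
    (hO : ∀ o l m, I l m → ∀ w ∈ (h o).paths ans' m, I (l ++ w.calls) w.final ∧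
      (∀ r ∉ ans, w.final.cl (f r) = m.cl (f r) ∧ w.final.q (f r) = m.q (f r)) ∧
      w.time ≤ cost (o, m.cl ∘ f) ∧ ∀ d ∈ w.calls, Good (o, m.cl ∘ f) d) (A : Prog R O) :
    ∀ l m, I l m → ∀ w ∈ (A.subst f h).paths ans' m, I (l ++ w.calls) w.final ∧
      ∃ u ∈ A.paths ans (m.restrict f), u.final = w.final.restrict f ∧
        w.time ≤ u.time + (u.calls.map cost).sum ∧ ∀ d ∈ w.calls, ∃ e ∈ u.calls, Good e d := by
  have hseq : ∀ (l : List (P × Store S)) (m : Point R) (B : Set (Outcome S P))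
      (B' : Set (Outcome R O)) (C : Point S → Set (Outcome S P)) (C' : Point R → Set (Outcome R O)),
      (∀ w ∈ B, I (l ++ w.calls) w.final ∧
        ∃ u ∈ B', u.final = w.final.restrict f ∧ w.time ≤ u.time + (u.calls.map cost).sum ∧
          ∀ d ∈ w.calls, ∃ e ∈ u.calls, Good e d) →
      (∀ l m, I l m → ∀ w ∈ C m, I (l ++ w.calls) w.final ∧
        ∃ u ∈ C' (m.restrict f), u.final = w.final.restrict f ∧
          w.time ≤ u.time + (u.calls.map cost).sum ∧ ∀ d ∈ w.calls, ∃ e ∈ u.calls, Good e d) →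
      ∀ w ∈ Outcome.andThen B C, I (l ++ w.calls) w.final ∧
        ∃ u ∈ Outcome.andThen B' C', u.final = w.final.restrict f ∧
          w.time ≤ u.time + (u.calls.map cost).sum ∧ ∀ d ∈ w.calls, ∃ e ∈ u.calls, Good e d := by
    rintro l m B B' C C' hB hC _ ⟨w₁, h₁, w₂, h₂, rfl⟩
    obtain ⟨i₁, u₁, hu₁, f₁, t₁, g₁⟩ := hB w₁ h₁
    obtain ⟨i₂, u₂, hu₂, f₂, t₂, g₂⟩ := hC _ _ i₁ w₂ h₂
    refine ⟨by simpa using i₂, _, ⟨u₁, hu₁, u₂, by rwa [f₁], rfl⟩, f₂, ?_, fun d hd => ?_⟩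
    · simp only [List.map_append, List.sum_append]; omega
    · rcases List.mem_append.1 hd with hd | hd
      · obtain ⟨e, he, hg⟩ := g₁ d hd
        exact ⟨e, List.mem_append_left _ he, hg⟩
      · obtain ⟨e, he, hg⟩ := g₂ d hd
        exact ⟨e, List.mem_append_right _ he, hg⟩
  have hunit : ∀ l m, I l m → ∀ w ∈ ({⟨m, 1, []⟩} : Set (Outcome S P)),
      I (l ++ w.calls) w.final ∧ ∃ u ∈ ({⟨m.restrict f, 1, []⟩} : Set (Outcome R O)),
        u.final = w.final.restrict f ∧ w.time ≤ u.time + (u.calls.map cost).sum ∧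
          ∀ d ∈ w.calls, ∃ e ∈ u.calls, Good e d := by
    rintro l m hm _ rfl
    exact ⟨by simpa using hm, _, rfl, rfl, by simp, by simp⟩
  induction A with
  | skip => exact hunit
  | instr i =>
    rintro l m hm w ⟨hw, ht, hc⟩
    obtain ⟨h1, h2⟩ := i.eval_map_ne_zero hf hw
    refine ⟨by rw [hc, List.append_nil]; exact hI l m _ h1 hm,
      ⟨w.final.restrict f, i.cost (m.restrict f), []⟩, ⟨h2, rfl, rfl⟩, rfl, ?_, by simp [hc]⟩
    rw [ht, Instr.cost_map]; simp
  | seq p q ihp ihq =>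
    intro l m hm
    exact hseq l (m.restrict f) _ _ _ _ (ihp l m hm) ihq
  | ite r p q ihp ihq =>
    intro l m hm
    refine hseq l (m.restrict f) _ _ _ _ (hunit l m hm) ?_
    have : (m.restrict f).cl r = m.cl (f r) := rfl
    rw [this]
    split_ifs
    · exact ihp
    · exact ihq
  | loop r p ih =>
    intro l m hm
    simp only [Prog.subst, Prog.paths]
    have : (m.restrict f).cl r = m.cl (f r) := rfl
    rw [this]
    generalize (m.cl (f r)).length = n
    induction n generalizing l m with
    | zero => exact hunit l m hm
    | succ n ihn => exact hseq l (m.restrict f) _ _ _ _ (ih l m hm) fun l m hm => ihn l m hm rfl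
  | query o =>
    intro l m hm w hw
    obtain ⟨h1, h2, h3, h4⟩ := hO o l m hm w hw
    exact ⟨h1, ⟨w.final.restrict f, 1, [(o, m.cl ∘ f)]⟩, ⟨h2, rfl, rfl⟩, rfl,
      by simpa using h3.trans (Nat.le_add_left _ _), fun d hd => ⟨_, List.mem_singleton_self _, h4 d hd⟩⟩

theorem Prog.mem_paths_place {f : R → S} (hf : f.Injective) (ans : Set S) (p : Prog R Empty)
    (m : Point S) (w : Outcome S P) (hw : w ∈ (p.place f).paths ans m) :
    w.calls = [] ∧ ∃ u ∈ p.paths ∅ (m.restrict f),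
      w.final = m.overlay f u.final ∧ w.time ≤ u.time := by
  obtain ⟨h1, u, hu, h2, h3, h4⟩ := Prog.mem_paths_subst hf (∅ : Set R) ans
    (fun l m' => l = [] ∧ ∀ s ∉ Set.range f, m'.cl s = m.cl s ∧ m'.q s = m.q s)
    (fun _ => 0) (fun _ _ => True)
    (fun l m₁ m₂ h hl => ⟨hl.1, fun s hs =>
      ⟨(h s hs).1.trans (hl.2 s hs).1, (h s hs).2.trans (hl.2 s hs).2⟩⟩)
    (fun o => o.elim) p [] m ⟨rfl, fun _ _ => ⟨rfl, rfl⟩⟩ w hw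
  refine ⟨h1.1, u, hu, ?_, ?_⟩
  · rw [h2]; exact Point.overlay_eq hf h1.2
  · have hc : u.calls = [] := by
      rcases hu' : u.calls with _ | ⟨⟨o, _⟩, _⟩
      · rfl
      · exact o.elim
    simpa [hc] using h3

end paths

/-! ### Channels of algorithms -/

section channels

variable {R S P ι : Type}

open Classical in
/-- Overwrite the string in the register `r`. -/
def setReg (x : Store R) (r : R) (v : List Bool) : Store R := Function.update x r v

open Classical in
theorem setReg_apply (x : Store R) (r s : R) (v : List Bool) :
    setReg x r v s = if s = r then v else x s := by
  simp [setReg, Function.update_apply]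

@[simp] theorem setReg_self (x : Store R) (r : R) (v : List Bool) : setReg x r v r = v := by
  simp [setReg]

theorem setReg_of_ne (x : Store R) {r s : R} (v : List Bool) (h : s ≠ r) :
    setReg x r v s = x s := by
  simp [setReg, h]

/-- Memory of an algorithm with the strings `a`, `b`, `c` in its three input registers. -/
def inputStore (a b c : List Bool) : Store ℕ := fun r =>
  if r = 0 then a else if r = 1 then b else if r = 2 then c else []

/-- Initial matrix unit of an algorithm with the classical inputs `a`, `b`, `c`. -/
def inputCfg (a b c : List Bool) : Cfg ℕ := ⟨inputStore a b c, fun _ => [], fun _ => []⟩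

theorem inputPoint_eq (n : ℕ) (x y : List Bool) :
    inputPoint n x y [] [] = (inputCfg (List.replicate n true) x y).point := by
  simp only [inputPoint, inputCfg, Cfg.point, Point.mk.injEq]
  exact ⟨rfl, by funext r; simp⟩

open Classical in
/-- Joint distribution of the final classical contents of the registers of the algorithm `p` on the
classical inputs `a`, `b`, `c`; the qubits are discarded. -/
def Prog.outC (p : Prog ℕ Empty) (a b c : List Bool) : Store ℕ →₀ ℂ :=
  (p.run (inputCfg a b c)).sum fun w z =>
    z • if w.ket = w.bra then Finsupp.single w.cl 1 else 0

open Classical in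
/-- As `Prog.outC`, but the qubits of the output register `3` are kept. -/
def Prog.outQ (p : Prog ℕ Empty) (a b c : List Bool) :
    (Store ℕ × List Bool × List Bool) →₀ ℂ :=
  (p.run (inputCfg a b c)).sum fun w z =>
    z • if ∀ r, r ≠ 3 → w.ket r = w.bra r then Finsupp.single (w.cl, w.ket 3, w.bra 3) 1 else 0

open Classical in
theorem Prog.ev_outC (p : Prog ℕ Empty) (a b c : List Bool) (φ : Store ℕ → ℂ) :
    ev (p.outC a b c) φ = p.wp (fun w => if w.ket = w.bra then φ w.cl else 0) (inputCfg a b c) := by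
  rw [Prog.outC, ev_sum_left, Prog.wp]
  congr 1
  funext w
  split_ifs <;> simp

open Classical in
theorem Prog.ev_outQ (p : Prog ℕ Empty) (a b c : List Bool)
    (φ : Store ℕ × List Bool × List Bool → ℂ) :
    ev (p.outQ a b c) φ =
      p.wp (fun w => if ∀ r, r ≠ 3 → w.ket r = w.bra r then φ (w.cl, w.ket 3, w.bra 3) else 0)
        (inputCfg a b c) := by
  rw [Prog.outQ, ev_sum_left, Prog.wp]
  congr 1
  funext w
  split_ifs <;> simp

theorem inputCfg_balanced (a b c : List Bool) : (inputCfg a b c).Balanced := fun _ => rfl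

theorem Prog.ev_outC_one (p : Prog ℕ Empty) (a b c : List Bool) :
    (ev (p.outC a b c) fun _ => 1) = 1 := by
  rw [Prog.ev_outC]
  refine (p.wp_trace (inputCfg_balanced a b c)).trans ?_
  simp [Cfg.trace, inputCfg]

theorem Prog.ev_outC_const (p : Prog ℕ Empty) (a b c : List Bool) (k : ℂ) :
    (ev (p.outC a b c) fun _ => k) = k := by
  rw [ev_const, Prog.ev_outC_one, one_mul]

theorem Prog.ev_outC_congr (p : Prog ℕ Empty) {a b c : List Bool} {φ φ' : Store ℕ → ℂ}
    (h : ∀ o ∈ p.paths ∅ (inputCfg a b c).point, φ o.final.cl = φ' o.final.cl) :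
    ev (p.outC a b c) φ = ev (p.outC a b c) φ' := by
  rw [Prog.ev_outC, Prog.ev_outC]
  refine p.wp_congr_paths (inputCfg_balanced a b c) fun o ho c' _ hc' => ?_
  have := h o ho
  rw [← hc'] at this
  simp only [Cfg.point] at this
  rw [this]

theorem Prog.ev_outQ_congr (p : Prog ℕ Empty) {a b c : List Bool}
    {φ φ' : Store ℕ × List Bool × List Bool → ℂ}
    (h : ∀ o ∈ p.paths ∅ (inputCfg a b c).point, ∀ k l, φ (o.final.cl, k, l) = φ' (o.final.cl, k, l)) :
    ev (p.outQ a b c) φ = ev (p.outQ a b c) φ' := by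
  rw [Prog.ev_outQ, Prog.ev_outQ]
  refine p.wp_congr_paths (inputCfg_balanced a b c) fun o ho c' _ hc' => ?_
  have := h o ho
  rw [← hc'] at this
  simp only [Cfg.point] at this
  rw [this]

/-! ### Discarding the qubits of the work registers -/

/-- A matrix entry on the qubits of the registers `v i` only, with the classical contents of all
registers. -/
structure View (S ι : Type) : Type where
  cl : Store S
  ket : ι → List Bool
  bra : ι → List Bool

open Classical in
/-- The functional "discard the qubits in all registers but the `v i`, then apply `φ`". -/
def traceOut (v : ι → S) (φ : View S ι → ℂ) (c : Cfg S) : ℂ :=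
  if ∀ s, (∀ i, v i ≠ s) → c.ket s = c.bra s then φ ⟨c.cl, c.ket ∘ v, c.bra ∘ v⟩ else 0

/-- As `traceOut`, but the qubits of the register `e` are kept as well. -/
def traceOutKeep (v : ι → S) (e : S) (φ : View S ι → List Bool → List Bool → ℂ) : Cfg S → ℂ :=
  traceOut (fun o : Option ι => o.elim e v) fun z =>
    φ ⟨z.cl, z.ket ∘ some, z.bra ∘ some⟩ (z.ket none) (z.bra none)

open Classical in
theorem traceOutKeep_apply (v : ι → S) (e : S) (φ : View S ι → List Bool → List Bool → ℂ) (c : Cfg S) :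
    traceOutKeep v e φ c = if ∀ s, s ≠ e → (∀ i, v i ≠ s) → c.ket s = c.bra s then
      φ ⟨c.cl, c.ket ∘ v, c.bra ∘ v⟩ (c.ket e) (c.bra e) else 0 := by
  simp only [traceOutKeep, traceOut, Option.forall, Option.elim, and_imp, ne_comm (a := e)]
  rfl

section classical

variable (v : ι → S) (φ : View S ι → ℂ)

theorem wp_classical_traceOut {i : Instr S} {g : Store S → Store S}
    (h : ∀ c, i.eval c = Finsupp.single { c with cl := g c.cl } 1) :
    (Prog.instr i).wp (traceOut v φ) = traceOut v fun z => φ { z with cl := g z.cl } := by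
  funext c
  simp only [Prog.wp_instr, h, ev_single, one_mul, traceOut]

theorem wp_copy_traceOut (r s : S) : (Prog.copy r s : Prog S Empty).wp (traceOut v φ) =
    traceOut v fun z => φ { z with cl := setReg z.cl r (z.cl s) } :=
  wp_classical_traceOut v φ (g := fun x => setReg x r (x s)) fun _ => rfl

theorem wp_cut_traceOut (r s : S) : (Prog.instr (.cut r s)).wp (traceOut v φ) =
    traceOut v fun z => φ { z with cl := setReg z.cl r ((z.cl r).take (z.cl s).length) } :=
  wp_classical_traceOut v φ (g := fun x => setReg x r ((x r).take (x s).length)) fun _ => rfl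

theorem wp_pair_traceOut (r s t : S) : (Prog.instr (.pair r s t)).wp (traceOut v φ) =
    traceOut v fun z => φ { z with cl := setReg z.cl r (pairCode (z.cl s) (z.cl t)) } :=
  wp_classical_traceOut v φ (g := fun x => setReg x r (pairCode (x s) (x t))) fun _ => rfl

theorem wp_unpair_traceOut (r s t : S) : (Prog.instr (.unpair r s t)).wp (traceOut v φ) =
    traceOut v fun z => φ { z with
      cl := setReg (setReg z.cl r (unpairCode (z.cl t)).1) s (unpairCode (z.cl t)).2 } :=
  wp_classical_traceOut v φ
    (g := fun x => setReg (setReg x r (unpairCode (x t)).1) s (unpairCode (x t)).2) fun _ => rfl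

variable (e : S) (ψ : View S ι → List Bool → List Bool → ℂ)

theorem wp_copy_traceOutKeep (r s : S) : (Prog.copy r s : Prog S Empty).wp (traceOutKeep v e ψ) =
    traceOutKeep v e fun z => ψ { z with cl := setReg z.cl r (z.cl s) } :=
  wp_copy_traceOut _ _ r s

theorem wp_cut_traceOutKeep (r s : S) : (Prog.instr (.cut r s)).wp (traceOutKeep v e ψ) =
    traceOutKeep v e fun z => ψ { z with cl := setReg z.cl r ((z.cl r).take (z.cl s).length) } :=
  wp_cut_traceOut _ _ r s

theorem wp_pair_traceOutKeep (r s t : S) : (Prog.instr (.pair r s t)).wp (traceOutKeep v e ψ) =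
    traceOutKeep v e fun z => ψ { z with cl := setReg z.cl r (pairCode (z.cl s) (z.cl t)) } :=
  wp_pair_traceOut _ _ r s t

end classical

/-! ### Calling an algorithm -/

/-- `Prog.load g args` prepares the memory `g 0, g 1, …` with the inputs `a`, `b`, `c`. -/
def Loads (g : ℕ → S) (args : List (ℕ × S)) (a b c : Store S → List Bool) : Prop :=
  open Classical in
  ∀ (ψ : Cfg S → ℂ) (x : Cfg S), (Prog.load g args : Prog S Empty).wp ψ x =
    if ∀ k, x.ket (g k) = x.bra (g k) then
      ψ (x.overlay g (inputCfg (a x.cl) (b x.cl) (c x.cl))) else 0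

open Classical in
theorem wp_reset_range (g : ℕ → S) (ψ : Cfg S → ℂ) (x : Cfg S) :
    (Prog.instr (.reset (Set.range g))).wp ψ x =
      if ∀ k, x.ket (g k) = x.bra (g k) then
        ψ (x.overlay g ⟨fun _ => [], fun _ => [], fun _ => []⟩) else 0 := by
  have hr : ∀ x : Store S, (fun r => if r ∈ Set.range g then [] else x r) =
      Function.extend g (fun _ => []) x := by
    intro x
    funext s
    by_cases h : ∃ k, g k = s
    · rw [if_pos (show s ∈ Set.range g from h)]; unfold Function.extend; rw [dif_pos h]
    · rw [if_neg (show s ∉ Set.range g from h), Function.extend_apply' _ _ _ h]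
  rw [Prog.wp_instr]
  by_cases h : ∀ k, x.ket (g k) = x.bra (g k)
  · rw [if_pos h, Instr.eval_reset_of_forall (by simpa using h), ev_single, one_mul]
    simp only [hr]; rfl
  · rw [if_neg h, Instr.eval_reset_of_not_forall (by simpa using h), ev_zero_left]

theorem wp_copy_overlay {g : ℕ → S} (hg : g.Injective) (k : ℕ) (s : S) (hs : ∀ k, g k ≠ s)
    (ψ : Cfg S → ℂ) (x : Cfg S) (w : Cfg ℕ) :
    (Prog.copy (g k) s : Prog S Empty).wp ψ (x.overlay g w) =
      ψ (x.overlay g { w with cl := setReg w.cl k (x.cl s) }) := by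
  classical
  rw [Prog.copy, Prog.wp_instr, Instr.eval, ev_single, one_mul]
  congr 1
  simp only [Cfg.overlay, Cfg.mk.injEq, and_true]
  rw [Function.extend_apply' _ _ s (by simpa using hs), setReg, extend_update hg]

theorem loads_one {g : ℕ → S} (hg : g.Injective) {s : S} (hs : ∀ k, g k ≠ s) :
    Loads g [(0, s)] (fun x => x s) (fun _ => []) fun _ => [] := by
  classical
  intro ψ x
  simp only [Prog.load, List.foldl, Prog.wp_seq, wp_reset_range]
  refine if_congr Iff.rfl ?_ rfl
  rw [wp_copy_overlay hg _ _ hs]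
  congr 2
  simp only [inputCfg, Cfg.mk.injEq, and_true]
  funext r
  simp [setReg_apply, inputStore]

theorem loads_two {g : ℕ → S} (hg : g.Injective) {s t : S} (hs : ∀ k, g k ≠ s)
    (ht : ∀ k, g k ≠ t) :
    Loads g [(0, s), (1, t)] (fun x => x s) (fun x => x t) fun _ => [] := by
  classical
  intro ψ x
  simp only [Prog.load, List.foldl, Prog.wp_seq, wp_reset_range]
  refine if_congr Iff.rfl ?_ rfl
  rw [wp_copy_overlay hg _ _ hs, wp_copy_overlay hg _ _ ht]
  congr 2
  simp only [inputCfg, Cfg.mk.injEq, and_true]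
  funext r
  simp only [setReg_apply, inputStore, ite_self]
  split_ifs <;> simp_all

theorem loads_three {g : ℕ → S} (hg : g.Injective) {s t u : S} (hs : ∀ k, g k ≠ s)
    (ht : ∀ k, g k ≠ t) (hu : ∀ k, g k ≠ u) :
    Loads g [(0, s), (1, t), (2, u)] (fun x => x s) (fun x => x t) fun x => x u := by
  classical
  intro ψ x
  simp only [Prog.load, List.foldl, Prog.wp_seq, wp_reset_range]
  refine if_congr Iff.rfl ?_ rfl
  rw [wp_copy_overlay hg _ _ hs, wp_copy_overlay hg _ _ ht, wp_copy_overlay hg _ _ hu]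
  congr 2
  simp only [inputCfg, Cfg.mk.injEq, and_true]
  funext r
  simp only [setReg_apply, inputStore]
  split_ifs <;> simp_all

theorem wp_load_traceOut {g : ℕ → S} {v : ι → S} {args : List (ℕ × S)} {a b c : Store S → List Bool}
    (hl : Loads g args a b c) (hv : ∀ k i, v i ≠ g k) (φ : View S ι → ℂ) :
    (Prog.load g args : Prog S Empty).wp (traceOut v φ) = traceOut v fun z =>
      φ { z with cl := Function.extend g (inputStore (a z.cl) (b z.cl) (c z.cl)) z.cl } := by
  classical
  funext x
  rw [hl]
  have hv' : ∀ (y : Store S) w, Function.extend g w y ∘ v = y ∘ v := by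
    intro y w; funext i
    exact Function.extend_apply' _ _ _ fun ⟨k, hk⟩ => hv k i hk.symm
  by_cases h : ∀ k, x.ket (g k) = x.bra (g k)
  · rw [if_pos h]
    simp only [traceOut, Cfg.overlay, inputCfg, hv']
    refine if_congr ⟨fun h' s hs => ?_, fun h' s hs => ?_⟩ rfl rfl
    · by_cases hg : ∃ k, g k = s
      · obtain ⟨k, rfl⟩ := hg; exact h k
      · simpa only [Function.extend_apply' _ _ _ hg] using h' s hs
    · by_cases hg : ∃ k, g k = s
      · unfold Function.extend; rw [dif_pos hg, dif_pos hg]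
      · simpa only [Function.extend_apply' _ _ _ hg] using h' s hs
  · rw [if_neg h, traceOut, if_neg]
    intro h'
    exact h fun k => h' _ (hv k)

/-- Calling an algorithm whose output qubits are discarded amounts to drawing its classical output
from the distribution `Prog.outC`. -/
theorem wp_call_traceOut {g : ℕ → S} {v : ι → S} {args : List (ℕ × S)} {a b c : Store S → List Bool}
    (hg : g.Injective) (hl : Loads g args a b c) (hv : ∀ k i, v i ≠ g k) (p : Prog ℕ Empty)
    (φ : View S ι → ℂ) :
    (Prog.call g p args : Prog S Empty).wp (traceOut v φ) = traceOut v fun z =>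
      ev (p.outC (a z.cl) (b z.cl) (c z.cl)) fun w =>
        φ { z with cl := Function.extend g w z.cl } := by
  classical
  funext x
  rw [Prog.call, Prog.wp_seq, hl]
  have hv' : ∀ (y : Store S) w, Function.extend g w y ∘ v = y ∘ v := by
    intro y w; funext i
    exact Function.extend_apply' _ _ _ fun ⟨k, hk⟩ => hv k i hk.symm
  rw [Prog.wp_place hg, Cfg.restrict_overlay hg]
  simp only [Cfg.overlay_overlay]
  -- The off-diagonal entries of the old contents of the memory are lost in the reset, and vanish under
  -- `traceOut` as well.
  by_cases h : ∀ k, x.ket (g k) = x.bra (g k)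
  · rw [if_pos h]
    by_cases h' : ∀ s, (∀ i, v i ≠ s) → x.ket s = x.bra s
    · rw [traceOut, if_pos h', Prog.ev_outC]
      congr 1
      funext w
      simp only [traceOut, Cfg.overlay, hv']
      refine if_congr ⟨fun h'' => ?_, fun h'' s hs => ?_⟩ rfl rfl
      · funext k
        simpa [hg.extend_apply] using h'' (g k) (hv k)
      · rw [h'']
        by_cases hgs : ∃ k, g k = s
        · obtain ⟨k, rfl⟩ := hgs; simp [hg.extend_apply]
        · simpa only [Function.extend_apply' _ _ _ hgs] using h' s hs
    · rw [traceOut, if_neg h', Prog.wp]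
      refine Eq.trans ?_ (ev_zero_right (p.run (inputCfg (a x.cl) (b x.cl) (c x.cl))))
      congr 1
      funext w
      rw [traceOut, if_neg]
      intro h''
      refine h' fun s hs => ?_
      by_cases hgs : ∃ k, g k = s
      · obtain ⟨k, rfl⟩ := hgs; exact h k
      · simpa only [Cfg.overlay, Function.extend_apply' _ _ _ hgs] using h'' s hs
  · rw [if_neg h, traceOut, if_neg]
    intro h'
    exact h fun k => h' _ (hv k)

theorem wp_call_traceOutKeep {g : ℕ → S} {v : ι → S} {e : S} {args : List (ℕ × S)}
    {a b c : Store S → List Bool} (hg : g.Injective) (hl : Loads g args a b c)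
    (hv : ∀ k i, v i ≠ g k) (he : ∀ k, e ≠ g k) (p : Prog ℕ Empty)
    (φ : View S ι → List Bool → List Bool → ℂ) :
    (Prog.call g p args : Prog S Empty).wp (traceOutKeep v e φ) = traceOutKeep v e fun z k l =>
      ev (p.outC (a z.cl) (b z.cl) (c z.cl)) fun w =>
        φ { z with cl := Function.extend g w z.cl } k l :=
  wp_call_traceOut hg hl (v := fun o : Option ι => o.elim e v)
    (fun k i => by cases i <;> simp [he, hv]) p _

/-- Calling an algorithm and keeping the qubits of its output register. -/
theorem wp_call_keep {g : ℕ → S} {v : ι → S} {args : List (ℕ × S)}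
    {a b c : Store S → List Bool} (hg : g.Injective) (hl : Loads g args a b c)
    (hv : ∀ k i, v i ≠ g k) (p : Prog ℕ Empty)
    (φ : View S ι → List Bool → List Bool → ℂ) :
    (Prog.call g p args : Prog S Empty).wp (traceOutKeep v (g 3) φ) = traceOut v fun z =>
      ev (p.outQ (a z.cl) (b z.cl) (c z.cl)) fun w =>
        φ { z with cl := Function.extend g w.1 z.cl } w.2.1 w.2.2 := by
  classical
  funext x
  rw [Prog.call, Prog.wp_seq, hl]
  have hv' : ∀ (y : Store S) w, Function.extend g w y ∘ v = y ∘ v := by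
    intro y w; funext i
    exact Function.extend_apply' _ _ _ fun ⟨k, hk⟩ => hv k i hk.symm
  rw [Prog.wp_place hg, Cfg.restrict_overlay hg]
  simp only [Cfg.overlay_overlay]
  by_cases h : ∀ k, x.ket (g k) = x.bra (g k)
  · rw [if_pos h]
    by_cases h' : ∀ s, (∀ i, v i ≠ s) → x.ket s = x.bra s
    · rw [traceOut, if_pos h', Prog.ev_outQ]
      congr 1
      funext w
      simp only [traceOutKeep_apply, Cfg.overlay, hv', hg.extend_apply]
      refine if_congr ⟨fun h'' k hk => ?_, fun h'' s hs3 hs => ?_⟩ rfl rfl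
      · simpa [hg.extend_apply] using h'' (g k) (by simpa [hg.eq_iff] using hk) (hv k)
      · by_cases hgs : ∃ k, g k = s
        · obtain ⟨k, rfl⟩ := hgs
          simpa [hg.extend_apply] using h'' k (by simpa [hg.eq_iff] using hs3)
        · simpa only [Function.extend_apply' _ _ _ hgs] using h' s hs
    · rw [traceOut, if_neg h', Prog.wp]
      refine Eq.trans ?_ (ev_zero_right (p.run (inputCfg (a x.cl) (b x.cl) (c x.cl))))
      congr 1
      funext w
      rw [traceOutKeep_apply, if_neg]
      intro h''
      refine h' fun s hs => ?_
      by_cases hgs : ∃ k, g k = s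
      · obtain ⟨k, rfl⟩ := hgs; exact h k
      · simpa only [Cfg.overlay, Function.extend_apply' _ _ _ hgs] using
          h'' s (by rintro rfl; exact hgs ⟨3, rfl⟩) hs
  · rw [if_neg h, traceOut, if_neg]
    intro h'
    exact h fun k => h' _ (hv k)

/-! ### Moving qubits -/

/-- `φ` after the qubits of the register `v i` have been replaced by `k`, `l`, and the old ones
have been discarded. -/
def View.replace (i : ι) (φ : View S ι → ℂ) (z : View S ι) (k l : List Bool) : ℂ :=
  open Classical in
  if z.ket i = z.bra i then
    φ { z with ket := Function.update z.ket i k, bra := Function.update z.bra i l } else 0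

theorem Cfg.conjugate_single (g : Store S → Store S) (c : Cfg S) :
    c.conjugate (fun x => Finsupp.single (g x) 1) =
      Finsupp.single ⟨c.cl, g c.ket, g c.bra⟩ 1 := by
  rw [Cfg.conjugate, Finsupp.sum_single_index (by simp), Finsupp.sum_single_index (by simp),
    map_one, mul_one]

theorem wp_qswap_traceOut {v : ι → S} (hv : v.Injective) {e : S} (he : ∀ i, v i ≠ e) (i : ι)
    (φ : View S ι → ℂ) :
    (Prog.instr (.qswap (v i) e)).wp (traceOut v φ) = traceOutKeep v e (View.replace i φ) := by
  classical
  funext c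
  have h : (Instr.qswap (v i) e).eval c = Finsupp.single
      ⟨c.cl, c.ket ∘ Equiv.swap (v i) e, c.bra ∘ Equiv.swap (v i) e⟩ 1 := by
    exact Cfg.conjugate_single (fun x => x ∘ Equiv.swap _ _) c
  have hcomp : ∀ x : Store S, (x ∘ Equiv.swap (v i) e) ∘ v = Function.update (x ∘ v) i (x e) := by
    intro x
    funext j
    by_cases hj : j = i
    · subst hj; simp
    · simp [hj, Equiv.swap_apply_of_ne_of_ne (hv.ne hj) (he j)]
  rw [Prog.wp_instr, h, ev_single, one_mul, traceOutKeep_apply]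
  simp only [traceOut, hcomp, View.replace]
  have hs : (∀ s, (∀ i, v i ≠ s) → (c.ket ∘ Equiv.swap (v i) e) s =
        (c.bra ∘ Equiv.swap (v i) e) s) ↔
      (∀ s, s ≠ e → (∀ i, v i ≠ s) → c.ket s = c.bra s) ∧ c.ket (v i) = c.bra (v i) := by
    constructor
    · intro h'
      refine ⟨fun s hse hs => ?_, by simpa using h' e he⟩
      simpa [Equiv.swap_apply_of_ne_of_ne (hs i).symm hse] using h' s hs
    · rintro ⟨h1, h2⟩ s hs
      by_cases hse : s = e
      · subst hse; simpa using h2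
      · simpa [Equiv.swap_apply_of_ne_of_ne (hs i).symm hse] using h1 s hse hs
  simp only [Function.comp]
  split_ifs <;> first | rfl | simp_all

theorem wp_qswap_traceOutKeep {v : ι → S} {d e : S} (hd : ∀ i, v i ≠ d) (he : ∀ i, v i ≠ e)
    (φ : View S ι → List Bool → List Bool → ℂ) :
    (Prog.instr (.qswap d e)).wp (traceOutKeep v d φ) = traceOutKeep v e φ := by
  classical
  funext c
  have h : (Instr.qswap d e).eval c = Finsupp.single
      ⟨c.cl, c.ket ∘ Equiv.swap d e, c.bra ∘ Equiv.swap d e⟩ 1 := by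
    exact Cfg.conjugate_single (fun x => x ∘ Equiv.swap _ _) c
  have hcomp : ∀ x : Store S, (x ∘ Equiv.swap d e) ∘ v = x ∘ v := by
    intro x
    funext j
    simp [Equiv.swap_apply_of_ne_of_ne (hd j) (he j)]
  rw [Prog.wp_instr, h, ev_single, one_mul, traceOutKeep_apply, traceOutKeep_apply]
  simp only [hcomp, Function.comp, Equiv.swap_apply_left]
  refine if_congr ⟨fun h' s hse hs => ?_, fun h' s hsd hs => ?_⟩ rfl rfl
  · by_cases hsd : s = d
    · subst hsd
      simpa using h' e hse.symm he
    · simpa [Equiv.swap_apply_of_ne_of_ne hsd hse] using h' s hsd hs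
  · by_cases hse : s = e
    · subst hse
      simpa using h' d hsd.symm hd
    · simpa [Equiv.swap_apply_of_ne_of_ne hsd hse] using h' s hse hs

open Classical in
theorem wp_reset_singleton (s : S) (ψ : Cfg S → ℂ) (c : Cfg S) :
    (Prog.instr (.reset {s})).wp ψ c = if c.ket s = c.bra s then
      ψ ⟨setReg c.cl s [], Function.update c.ket s [], Function.update c.bra s []⟩ else 0 := by
  have hr : ∀ x : Store S, (fun r => @ite _ (r ∈ ({s} : Set S)) (Classical.propDecidable _) []
      (x r)) = Function.update x s [] := by
    intro x; funext t
    by_cases h : t = s <;> simp [h]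
  rw [Prog.wp_instr]
  by_cases h : c.ket s = c.bra s
  · rw [if_pos h, Instr.eval_reset_of_forall (by simpa using h), ev_single, one_mul]
    simp only [hr]; rfl
  · rw [if_neg h, Instr.eval_reset_of_not_forall (by simpa using h), ev_zero_left]

theorem wp_reset_traceOutKeep {v : ι → S} {s e : S} (hs : ∀ i, v i ≠ s) (hse : e ≠ s)
    (φ : View S ι → List Bool → List Bool → ℂ) :
    (Prog.instr (.reset {s})).wp (traceOutKeep v e φ) =
      traceOutKeep v e fun z => φ { z with cl := setReg z.cl s [] } := by
  classical
  funext c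
  rw [wp_reset_singleton, traceOutKeep_apply, traceOutKeep_apply]
  have hcomp : ∀ x : Store S, Function.update x s [] ∘ v = x ∘ v := by
    intro x; funext j; simp [hs j]
  simp only [hcomp, Function.update_of_ne hse]
  have h : (∀ t, t ≠ e → (∀ i, v i ≠ t) → c.ket t = c.bra t) ↔ c.ket s = c.bra s ∧
      ∀ t, t ≠ e → (∀ i, v i ≠ t) → Function.update c.ket s [] t = Function.update c.bra s [] t := by
    constructor
    · intro h
      refine ⟨h s hse.symm hs, fun t ht ht' => ?_⟩
      by_cases hts : t = s
      · subst hts; simp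
      · simpa [hts] using h t ht ht'
    · rintro ⟨h1, h2⟩ t ht ht'
      by_cases hts : t = s
      · subst hts; exact h1
      · simpa [hts] using h2 t ht ht'
  simp only [h, ite_and]

theorem wp_reset_visible_traceOutKeep {v : ι → S} (hv : v.Injective) {e : S} (he : ∀ i, v i ≠ e)
    (i : ι) (φ : View S ι → List Bool → List Bool → ℂ) :
    (Prog.instr (.reset {v i})).wp (traceOutKeep v e φ) =
      traceOutKeep v e fun z k l =>
        View.replace i (fun z => φ { z with cl := setReg z.cl (v i) [] } k l) z [] [] := by
  classical
  funext c
  rw [wp_reset_singleton, traceOutKeep_apply, traceOutKeep_apply]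
  have hcomp : ∀ x : Store S, Function.update x (v i) [] ∘ v = Function.update (x ∘ v) i [] := by
    intro x; exact Function.update_comp_eq_of_injective x hv i []
  simp only [hcomp, Function.update_of_ne (he i).symm, View.replace]
  have h : (∀ t, t ≠ e → (∀ i, v i ≠ t) →
        Function.update c.ket (v i) [] t = Function.update c.bra (v i) [] t) ↔
      ∀ t, t ≠ e → (∀ i, v i ≠ t) → c.ket t = c.bra t := by
    refine forall_congr' fun t => forall_congr' fun _ => forall_congr' fun ht => ?_
    rw [Function.update_of_ne (ht i).symm, Function.update_of_ne (ht i).symm]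
  simp only [h, Function.comp]
  split_ifs <;> rfl

/-! ### Running an oracle program -/

/-- The part of a state that belongs to a program with the registers `f r`. -/
def View.get (f : ℕ → S) (z : View S ℕ) : Cfg ℕ := ⟨z.cl ∘ f, z.ket, z.bra⟩

/-- The state `z` with the part that belongs to a program with the registers `f r` replaced by `w`. -/
def View.set (f : ℕ → S) (z : View S ℕ) (w : Cfg ℕ) : View S ℕ :=
  ⟨Function.extend f w.cl z.cl, w.ket, w.bra⟩

theorem View.get_set {f : ℕ → S} (hf : f.Injective) (z : View S ℕ) (w : Cfg ℕ) :
    (z.set f w).get f = w := by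
  cases w; simp [View.get, View.set, extend_comp_left hf]

open Classical in
/-- The acceptance probability as a functional of the initial state. All qubits are discarded in the
end, so that any registers `v i` may be the visible ones. -/
theorem acceptProb_eq (p : Prog S Empty) (m : Store S) (r : S) (v : ι → S) :
    p.acceptProb m r = (p.wp (traceOut v fun z =>
      if z.ket = z.bra ∧ (z.cl r).head? = some true then 1 else 0)
        ⟨m, fun _ => [], fun _ => []⟩).re := by
  rw [Prog.acceptProb, Prog.wp, ev, Finsupp.sum, Finsupp.sum, Complex.re_sum]
  refine Finset.sum_congr rfl fun c _ => ?_
  have h : (∀ s, (∀ i, v i ≠ s) → c.ket s = c.bra s) ∧ c.ket ∘ v = c.bra ∘ v ↔ c.ket = c.bra := by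
    constructor
    · rintro ⟨h1, h2⟩
      funext s
      by_cases hs : ∃ i, v i = s
      · obtain ⟨i, rfl⟩ := hs; exact congrFun h2 i
      · exact h1 s (by simpa using hs)
    · intro h; simp [h]
  simp only [traceOut, ← ite_and, ← and_assoc, h]
  split_ifs <;> simp

theorem traceOut_init (v : ι → S) (φ : View S ι → ℂ) (m : Store S) :
    traceOut v φ ⟨m, fun _ => [], fun _ => []⟩ = φ ⟨m, fun _ => [], fun _ => []⟩ := by
  simp [traceOut]; rfl

end channels

/-! ### Sampling a uniform index -/

section deterministic

variable {R : Type}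

/-- The program maps the classical memory `x` to `x'`, does not touch the qubits, and takes at most
`t` steps. -/
structure Prog.Computes (p : Prog R Empty) (x x' : Store R) (t : ℕ) : Prop where
  wp_eq : ∀ φ k l, p.wp φ ⟨x, k, l⟩ = φ ⟨x', k, l⟩
  paths_eq : ∀ q, ∀ o ∈ p.paths ∅ ⟨x, q⟩, o.final = ⟨x', q⟩ ∧ o.time ≤ t

theorem Prog.computes_skip (x : Store R) : (Prog.skip : Prog R Empty).Computes x x 1 where
  wp_eq φ k l := by rw [Prog.wp_skip]
  paths_eq := by rintro q _ rfl; exact ⟨rfl, le_rfl⟩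

theorem Prog.computes_instr {i : Instr R} {x x' : Store R} {t : ℕ}
    (h : ∀ k l, i.eval ⟨x, k, l⟩ = Finsupp.single ⟨x', k, l⟩ 1) (ht : ∀ q, i.cost ⟨x, q⟩ ≤ t) :
    (Prog.instr i).Computes x x' t where
  wp_eq φ k l := by rw [Prog.wp_instr, h, ev_single, one_mul]
  paths_eq := by
    classical
    rintro q o ⟨ho, hto, -⟩
    rw [h, Finsupp.single_apply] at ho
    refine ⟨?_, hto ▸ ht q⟩
    split_ifs at ho with h'
    · obtain ⟨⟨a, b⟩, _, _⟩ := o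
      simp only [Cfg.mk.injEq] at h'
      simp [h'.1, h'.2.1]
    · exact absurd rfl ho

theorem Prog.computes_push (b : Bool) (r : R) (x : Store R) :
    (Prog.instr (.push b r)).Computes x (setReg x r (b :: x r)) 1 :=
  Prog.computes_instr (fun _ _ => rfl) fun _ => le_rfl

theorem Prog.computes_pop (r : R) (x : Store R) :
    (Prog.instr (.pop r)).Computes x (setReg x r (x r).tail) 1 :=
  Prog.computes_instr (fun _ _ => rfl) fun _ => le_rfl

theorem Prog.computes_copy (r s : R) (x : Store R) :
    (Prog.copy r s).Computes x (setReg x r (x s)) (1 + (x s).length) :=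
  Prog.computes_instr (fun _ _ => rfl) fun _ => le_rfl

theorem Prog.Computes.seq {p q : Prog R Empty} {x x' x'' : Store R} {t t' : ℕ}
    (hp : p.Computes x x' t) (hq : q.Computes x' x'' t') : (p ;; q).Computes x x'' (t + t') where
  wp_eq φ k l := by rw [Prog.wp_seq, hp.wp_eq, hq.wp_eq]
  paths_eq := by
    rintro m _ ⟨o₁, h₁, o₂, h₂, rfl⟩
    obtain ⟨hf, ht⟩ := hp.paths_eq m o₁ h₁
    rw [hf] at h₂
    obtain ⟨hf', ht'⟩ := hq.paths_eq m o₂ h₂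
    exact ⟨hf', by simp only; omega⟩

theorem Prog.Computes.ite_pos {p q : Prog R Empty} {r : R} {x x' : Store R} {t : ℕ}
    (hr : (x r).head? = some true) (hp : p.Computes x x' t) :
    (Prog.ite r p q).Computes x x' (1 + t) where
  wp_eq φ k l := by rw [Prog.wp_ite, if_pos hr, hp.wp_eq]
  paths_eq := by
    rintro m _ ⟨_, rfl, o₂, h₂, rfl⟩
    simp only [if_pos hr] at h₂
    obtain ⟨hf, ht⟩ := hp.paths_eq m o₂ h₂
    exact ⟨hf, by simp only; omega⟩

theorem Prog.Computes.ite_neg {p q : Prog R Empty} {r : R} {x x' : Store R} {t : ℕ}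
    (hr : (x r).head? ≠ some true) (hq : q.Computes x x' t) :
    (Prog.ite r p q).Computes x x' (1 + t) where
  wp_eq φ k l := by rw [Prog.wp_ite, if_neg hr, hq.wp_eq]
  paths_eq := by
    rintro m _ ⟨_, rfl, o₂, h₂, rfl⟩
    simp only [if_neg hr] at h₂
    obtain ⟨hf, ht⟩ := hq.paths_eq m o₂ h₂
    exact ⟨hf, by simp only; omega⟩

theorem Prog.exists_computes_loop {p : Prog R Empty} {r : R} (Inv : ℕ → Store R → Prop) {t n : ℕ}
    (hp : ∀ i < n, ∀ x, Inv i x → ∃ x', p.Computes x x' t ∧ Inv (i + 1) x') {x : Store R}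
    (hx : Inv 0 x) (hr : (x r).length = n) :
    ∃ x', (Prog.loop r p).Computes x x' (n * t + 1) ∧ Inv n x' := by
  have h : ∀ m j, j + m = n → ∀ x, Inv j x → ∃ x', Inv n x' ∧
      (∀ φ k l, p.wp^[m] φ ⟨x, k, l⟩ = φ ⟨x', k, l⟩) ∧
      ∀ q, ∀ o ∈ Outcome.iter (p.paths ∅) m ⟨x, q⟩, o.final = ⟨x', q⟩ ∧ o.time ≤ m * t + 1 := by
    intro m
    induction m with
    | zero =>
      intro j hj x hx
      rw [Nat.add_zero] at hj; subst hj
      refine ⟨x, hx, fun _ _ _ => rfl, ?_⟩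
      rintro q _ rfl
      exact ⟨rfl, by simp⟩
    | succ m ih =>
      intro j hj x hx
      obtain ⟨x', h', hx'⟩ := hp j (by omega) x hx
      obtain ⟨x'', h1, h2, h3⟩ := ih (j + 1) (by omega) x' hx'
      refine ⟨x'', h1, fun φ k l => ?_, ?_⟩
      · rw [Function.iterate_succ_apply', h'.wp_eq, h2]
      · rintro q _ ⟨o₁, h₁, o₂, h₂, rfl⟩
        obtain ⟨hf, ht⟩ := h'.paths_eq q o₁ h₁
        rw [hf] at h₂
        obtain ⟨hf', ht'⟩ := h3 q o₂ h₂
        refine ⟨hf', ?_⟩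
        simp only [Nat.add_mul, one_mul]; omega
  obtain ⟨x', h1, h2, h3⟩ := h n 0 (by omega) x hx
  refine ⟨x', ⟨fun φ k l => ?_, fun q o ho => ?_⟩, h1⟩
  · rw [Prog.wp_loop, hr, h2]
  · simp only [Prog.paths, hr] at ho
    exact h3 q o ho

end deterministic

/-- The string of `n` ones. -/
abbrev ones (n : ℕ) : List Bool := List.replicate n true

/-- Put `c` ones in front of the string in `r`. -/
def pushOnes (r : ℕ) : ℕ → Prog ℕ Empty
  | 0 => .skip
  | c + 1 => .instr (.push true r) ;; pushOnes r c

/-- Put `m ^ k` ones in front of the string in `d`, where `m` is the length of the string in `r`. -/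
def pushPow (r d : ℕ) : ℕ → Prog ℕ Empty
  | 0 => .instr (.push true d)
  | k + 1 => .loop r (pushPow r d k)

/-- Put a fair coin in front of the string in register `6`. -/
def coin : Prog ℕ Empty := .instr (.qnew 6) ;; .instr (.had 6) ;; .instr (.meas 6 6)

/-- One round of the sampler. Register `8` holds `D` in unary, register `3` holds an index `i < D`;
with a fair coin, `i` is replaced by `i` or `i + D`, and `D` by `2 * D`, while register `7` counts
down by `D`. -/
def samplerRound : Prog ℕ Empty :=
  Prog.copy 9 8 ;; coin ;;
  .loop 9 (.instr (.pop 7) ;; .instr (.push true 8) ;; .ite 6 (.instr (.push true 3)) .skip)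

/-- Output `Q = (n + c) ^ k` in unary in register `4`, and an index that is uniform below a power of
two between `Q + 1` and `2 * Q + 1` in unary in register `3`. -/
def sampler (c k : ℕ) : Prog ℕ Empty :=
  Prog.copy 5 0 ;; pushOnes 5 c ;; pushPow 5 4 k ;; Prog.copy 7 4 ;; .instr (.push true 8) ;;
  .loop 4 (.ite 7 samplerRound .skip)

theorem ones_succ (n : ℕ) : true :: ones n = ones (n + 1) := rfl

theorem tail_ones (n : ℕ) : (ones n).tail = ones (n - 1) := by
  cases n <;> simp [ones, List.replicate_succ]

theorem head?_ones (n : ℕ) : (ones n).head? = some true ↔ 0 < n := by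
  cases n <;> simp [ones, List.replicate_succ]

theorem computes_pushOnes (r c : ℕ) (x : Store ℕ) (n : ℕ) (hx : x r = ones n) :
    (pushOnes r c).Computes x (setReg x r (ones (n + c))) (c + 1) := by
  induction c generalizing x n with
  | zero =>
    have : setReg x r (ones (n + 0)) = x := by
      funext s; rw [setReg_apply]; split_ifs with h
      · rw [h, hx]; rfl
      · rfl
    rw [this]; exact Prog.computes_skip x
  | succ c ih =>
    have h := (Prog.computes_push true r x).seq (ih (setReg x r (true :: x r)) (n + 1) (by
      rw [setReg_self, hx, ones_succ]))
    have h2 : setReg (setReg x r (true :: x r)) r (ones (n + 1 + c)) =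
        setReg x r (ones (n + (c + 1))) := by
      funext s; simp only [setReg_apply, show n + 1 + c = n + (c + 1) by omega]
      split_ifs <;> rfl
    rw [h2, Nat.add_comm 1] at h
    exact h

theorem computes_pushPow {r d : ℕ} (hrd : r ≠ d) (k : ℕ) (x : Store ℕ) (n : ℕ) (hx : x d = ones n) :
    (pushPow r d k).Computes x (setReg x d (ones (n + (x r).length ^ k)))
      (((x r).length + 1) ^ k) := by
  induction k generalizing x n with
  | zero =>
    have := Prog.computes_push true d x
    rwa [hx, ones_succ] at this
  | succ k ih =>
    obtain ⟨x', h1, h2⟩ := Prog.exists_computes_loop (p := pushPow r d k) (r := r) (x := x)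
      (n := (x r).length) (t := ((x r).length + 1) ^ k)
      (fun i y => y = setReg x d (ones (n + i * (x r).length ^ k)))
      (fun i _ y hy => by
        have hr : y r = x r := by rw [hy, setReg_of_ne _ _ hrd]
        have h := ih y (n + i * (x r).length ^ k) (by rw [hy, setReg_self])
        rw [hr] at h
        refine ⟨_, h, ?_⟩
        rw [hy]
        funext s
        simp only [setReg_apply, Nat.add_mul, one_mul, Nat.add_assoc]
        split_ifs <;> rfl)
      (by
        funext s
        rw [setReg_apply]
        split_ifs with h
        · rw [h, hx]; simp
        · rfl) rfl
    rw [h2, ← pow_succ'] at h1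
    refine ⟨h1.wp_eq, fun q o ho => ⟨(h1.paths_eq q o ho).1, (h1.paths_eq q o ho).2.trans ?_⟩⟩
    rw [pow_succ (_ + 1), Nat.mul_add, mul_one, Nat.mul_comm]
    exact Nat.add_le_add_left (Nat.one_le_pow _ _ (Nat.succ_pos _)) _

/-- The unary counters of the sampler: the index `i`, the bound `Q`, and the range `D`. -/
structure SamplerState (Q i D : ℕ) (x : Store ℕ) : Prop where
  index : x 3 = ones i
  bound : x 4 = ones Q
  rest : x 7 = ones (Q + 1 - D)
  range : x 8 = ones D

theorem exists_computes_samplerLoop (Q i D : ℕ) (b : Bool) (x : Store ℕ)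
    (hx : SamplerState Q i D x) (h9 : (x 9).length = D) (h6 : (x 6).head? = some b) :
    ∃ x', (Prog.loop 9 (.instr (.pop 7) ;; .instr (.push true 8) ;;
        .ite 6 (.instr (.push true 3)) .skip)).Computes x x' (D * 4 + 1) ∧
      SamplerState Q (i + if b then D else 0) (D + D) x' := by
  obtain ⟨x', h1, h2⟩ := Prog.exists_computes_loop (R := ℕ)
    (p := (.instr (.pop 7) ;; .instr (.push true 8) ;; .ite 6 (.instr (.push true 3)) .skip))
    (r := 9) (x := x) (n := D) (t := 4)
    (fun j y => y 3 = ones (i + if b then j else 0) ∧ y 4 = ones Q ∧ y 7 = ones (Q + 1 - D - j) ∧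
      y 8 = ones (D + j) ∧ (y 6).head? = some b)
    (fun j _ y hy => by
      obtain ⟨h3, h4, h7, h8, h6⟩ := hy
      have hb := (Prog.computes_pop 7 y).seq (Prog.computes_push true 8 (setReg y 7 (y 7).tail))
      set y' := setReg (setReg y 7 (y 7).tail) 8 (true :: setReg y 7 (y 7).tail 8) with hy'
      have e3 : y' 3 = y 3 := by simp [hy', setReg_apply]
      have e4 : y' 4 = y 4 := by simp [hy', setReg_apply]
      have e6 : y' 6 = y 6 := by simp [hy', setReg_apply]
      have e7 : y' 7 = ones (Q + 1 - D - (j + 1)) := by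
        simp only [hy', setReg_apply, h7, tail_ones, Nat.sub_sub, Nat.add_assoc]; rfl
      have e8 : y' 8 = ones (D + (j + 1)) := by
        simp only [hy', setReg_apply, h8]; simp [ones_succ, Nat.add_assoc]
      cases b with
      | true =>
        have hite := Prog.Computes.ite_pos (q := Prog.skip) (show (y' 6).head? = some true by
          rw [e6, h6]) (Prog.computes_push true 3 y')
        refine ⟨_, (Prog.computes_pop 7 y).seq
          ((Prog.computes_push true 8 (setReg y 7 (y 7).tail)).seq hite), ?_, ?_, ?_, ?_, ?_⟩
        · rw [setReg_self, e3, h3]; rfl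
        · rw [setReg_of_ne _ _ (by norm_num), e4, h4]
        · rw [setReg_of_ne _ _ (by norm_num), e7]
        · rw [setReg_of_ne _ _ (by norm_num), e8]
        · rw [setReg_of_ne _ _ (by norm_num), e6, h6]
      | false =>
        have hite := Prog.Computes.ite_neg (p := Prog.instr (.push true 3))
          (show (y' 6).head? ≠ some true by rw [e6, h6]; simp) (Prog.computes_skip y')
        exact ⟨_, (Prog.computes_pop 7 y).seq
          ((Prog.computes_push true 8 (setReg y 7 (y 7).tail)).seq hite),
          by rw [e3, h3]; rfl, by rw [e4, h4], e7, e8, by rw [e6, h6]⟩)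
    ⟨by rw [hx.index]; simp, hx.bound, by simpa using hx.rest, by simpa using hx.range, h6⟩ h9
  obtain ⟨h3, h4, h7, h8, -⟩ := h2
  exact ⟨x', h1, h3, h4, by rw [h7, Nat.sub_sub], h8⟩

theorem wp_coin (φ : Cfg ℕ → ℂ) (x : Store ℕ) :
    coin.wp φ ⟨x, fun _ => [], fun _ => []⟩ =
      (φ ⟨setReg x 6 (false :: x 6), fun _ => [], fun _ => []⟩ +
        φ ⟨setReg x 6 (true :: x 6), fun _ => [], fun _ => []⟩) / 2 := by
  classical
  have e : setReg (fun _ : ℕ => ([] : List Bool)) 6 [] = fun _ => [] := by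
    funext s; simp [setReg_apply]
  have h2 : ((Real.sqrt 2 : ℝ) : ℂ) * ((Real.sqrt 2 : ℝ) : ℂ) = 2 := by
    rw [← Complex.ofReal_mul, Real.mul_self_sqrt (by norm_num)]; norm_num
  have h0 : ((Real.sqrt 2 : ℝ) : ℂ) ≠ 0 := by
    intro h'; rw [h'] at h2; norm_num at h2
  have hsum : ∀ (f g : Store ℕ) (p q : ℂ) (k : Store ℕ → ℂ → CQState ℕ), (∀ x, k x 0 = 0) →
      (∀ x s t, k x (s + t) = k x s + k x t) →
      (Finsupp.single f p + Finsupp.single g q).sum k = k f p + k g q := by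
    intro f g p q k h0 h1
    rw [Finsupp.sum_add_index' h0 h1, Finsupp.sum_single_index (h0 _),
      Finsupp.sum_single_index (h0 _)]
  rw [coin, Prog.wp_seq, Prog.wp_seq, Prog.wp_instr, Instr.eval, Cfg.conjugate_single, ev_single,
    one_mul, Prog.wp_instr,
    Instr.eval, Cfg.conjugate]
  simp only [Function.update_self]
  rw [hsum _ _ _ _ _ (by simp) (by intro x s t; simp [add_mul, Finsupp.sum_add]),
    hsum _ _ _ _ _ (by simp) (by intro x s t; simp [mul_add]),
    hsum _ _ _ _ _ (by simp) (by intro x s t; simp [mul_add])]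
  simp only [Function.update_idem, ev_add_left, ev_single, Prog.wp_instr, Instr.eval,
    Function.update_self, if_true, reduceCtorEq, if_false, ev_zero_left, mul_zero, add_zero,
    zero_add, one_mul]
  simp only [setReg] at e
  have e1 : hadamardEntry false false * starRingEnd ℂ (hadamardEntry false false) = 1 / 2 := by
    simp [hadamardEntry, ← h2]
  have e2 : hadamardEntry true false * starRingEnd ℂ (hadamardEntry true false) = 1 / 2 := by
    simp [hadamardEntry, ← h2]
  rw [e1, e2, e]
  simp only [setReg]
  ring

theorem coin_paths (x : Store ℕ) (o : Outcome ℕ Empty)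
    (ho : o ∈ coin.paths ∅ ⟨x, fun _ => []⟩) :
    o.time = 3 ∧ ∃ b, o.final = ⟨setReg x 6 (b :: x 6), fun _ => []⟩ := by
  classical
  have hs : ∀ (d c' : Cfg ℕ), Finsupp.single d (1 : ℂ) c' ≠ 0 → c' = d := by
    intro d c' h; by_contra hne
    exact h (by rw [Finsupp.single_apply, if_neg (Ne.symm hne)])
  obtain ⟨o₁, ⟨h₁, t₁, -⟩, o₂, ⟨o₃, ⟨h₃, t₃, -⟩, o₄, ⟨h₄, t₄, -⟩, rfl⟩, rfl⟩ := ho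
  obtain ⟨⟨x₁, q₁⟩, _, _⟩ := o₁
  obtain ⟨⟨x₃, q₃⟩, _, _⟩ := o₃
  obtain ⟨⟨x₄, q₄⟩, _, _⟩ := o₄
  simp only at *
  subst t₁ t₃ t₄
  refine ⟨rfl, ?_⟩
  rw [Instr.eval, Cfg.conjugate_single] at h₁
  have := hs _ _ h₁
  simp only [Cfg.mk.injEq] at this
  obtain ⟨rfl, rfl, -⟩ := this
  rw [Instr.eval, Cfg.conjugate_apply] at h₃
  split_ifs at h₃ with hcl
  · simp only at hcl; subst hcl
    have h := left_ne_zero_of_mul h₃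
    simp only [Function.update_self, Function.update_idem, Finsupp.add_apply,
      Finsupp.single_apply] at h
    obtain ⟨b, hb⟩ : ∃ b, q₃ = setReg (fun _ => []) 6 [b] := by
      split_ifs at h with ha hb hb
      · exact ⟨_, ha.symm⟩
      · exact ⟨_, ha.symm⟩
      · exact ⟨_, hb.symm⟩
      · simp at h
    subst hb
    simp only [Instr.eval, setReg_self, if_true] at h₄
    have := hs _ _ h₄
    simp only [Cfg.mk.injEq] at this
    refine ⟨b, ?_⟩
    rw [this.1, this.2.1]
    simp only [Point.mk.injEq, setReg, true_and, Function.update_idem]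
    funext s; by_cases h : s = 6 <;> simp [h]
  · exact absurd rfl h₃

/-- A round of the sampler ends in one of two memories, with probability one half each. -/
theorem samplerRound_spec (Q i D : ℕ) (x : Store ℕ) (hx : SamplerState Q i D x) :
    ∃ x₀ x₁, SamplerState Q i (D + D) x₀ ∧ SamplerState Q (i + D) (D + D) x₁ ∧
      (∀ φ, samplerRound.wp φ ⟨x, fun _ => [], fun _ => []⟩ =
        (φ ⟨x₀, fun _ => [], fun _ => []⟩ + φ ⟨x₁, fun _ => [], fun _ => []⟩) / 2) ∧
      ∀ o ∈ samplerRound.paths ∅ ⟨x, fun _ => []⟩,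
        (o.final = ⟨x₀, fun _ => []⟩ ∨ o.final = ⟨x₁, fun _ => []⟩) ∧ o.time ≤ 5 * D + 5 := by
  have hc := Prog.computes_copy 9 8 x
  set y := setReg x 9 (x 8) with hy
  have hst : ∀ b, SamplerState Q i D (setReg y 6 (b :: y 6)) := fun b =>
    ⟨by simp [hy, setReg_apply, hx.index], by simp [hy, setReg_apply, hx.bound],
      by simp [hy, setReg_apply, hx.rest], by simp [hy, setReg_apply, hx.range]⟩
  have h9 : ∀ b, (setReg y 6 (b :: y 6) 9).length = D := by
    intro b; simp [hy, setReg_apply, hx.range]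
  obtain ⟨x₀, c₀, s₀⟩ := exists_computes_samplerLoop Q i D false _ (hst false) (h9 false) (by simp)
  obtain ⟨x₁, c₁, s₁⟩ := exists_computes_samplerLoop Q i D true _ (hst true) (h9 true) (by simp)
  refine ⟨x₀, x₁, by simpa using s₀, by simpa using s₁, fun φ => ?_, ?_⟩
  · rw [samplerRound, Prog.wp_seq, Prog.wp_seq, hc.wp_eq, wp_coin, c₀.wp_eq, c₁.wp_eq]
  · rintro _ ⟨o₁, h₁, _, ⟨o₂, h₂, o₃, h₃, rfl⟩, rfl⟩
    obtain ⟨f₁, t₁⟩ := hc.paths_eq _ o₁ h₁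
    rw [f₁] at h₂
    obtain ⟨t₂, b, f₂⟩ := coin_paths _ o₂ h₂
    rw [f₂] at h₃
    have h8 : (x 8).length = D := by simp [hx.range]
    rw [h8] at t₁
    simp only
    cases b
    · obtain ⟨f₃, t₃⟩ := c₀.paths_eq _ o₃ h₃
      exact ⟨.inl f₃, by omega⟩
    · obtain ⟨f₃, t₃⟩ := c₁.paths_eq _ o₃ h₃
      exact ⟨.inr f₃, by omega⟩

theorem sum_range_two_mul (N : ℕ) (f : ℕ → ℂ) :
    ∑ a ∈ Finset.range (2 * N), f a = ∑ a ∈ Finset.range N, (f (2 * a) + f (2 * a + 1)) := by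
  induction N with
  | zero => simp
  | succ N ih =>
    rw [show 2 * (N + 1) = 2 * N + 1 + 1 by ring, Finset.sum_range_succ, Finset.sum_range_succ, ih,
      Finset.sum_range_succ, add_assoc]

/-- The number of doublings in `m` rounds that start with the range `D`. -/
def doublings (Q : ℕ) : ℕ → ℕ → ℕ
  | 0, _ => 0
  | m + 1, D => if D ≤ Q then doublings Q m (D + D) + 1 else doublings Q m D

theorem doublings_spec (Q m D : ℕ) :
    2 ^ doublings Q m D * D ≤ max D (2 * Q) ∧
      (doublings Q m D = m ∨ Q < 2 ^ doublings Q m D * D) := by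
  induction m generalizing D with
  | zero => simp [doublings]
  | succ m ih =>
    rw [doublings]
    split_ifs with h
    · obtain ⟨h1, h2⟩ := ih (D + D)
      have e : 2 ^ (doublings Q m (D + D) + 1) * D = 2 ^ doublings Q m (D + D) * (D + D) := by ring
      rw [e]
      refine ⟨?_, by omega⟩
      rw [max_eq_right (by omega)] at h1 ⊢
      exact h1
    · obtain ⟨h1, h2⟩ := ih D
      refine ⟨h1, .inr ?_⟩
      have : 1 ≤ 2 ^ doublings Q m D := Nat.one_le_two_pow
      nlinarith

/-- The main loop of the sampler chooses uniformly among the indices `i`, `i + D`, `i + 2 * D`, …. -/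
theorem samplerLoop_wp (Q : ℕ) {φ : Cfg ℕ → ℂ} {ψ : List Bool → List Bool → ℂ}
    (hφ : ∀ x, φ ⟨x, fun _ => [], fun _ => []⟩ = ψ (x 3) (x 4)) (m i D : ℕ) (x : Store ℕ)
    (hx : SamplerState Q i D x) :
    (Prog.ite 7 samplerRound .skip).wp^[m] φ ⟨x, fun _ => [], fun _ => []⟩ =
      (2 ^ doublings Q m D)⁻¹ *
        ∑ a ∈ Finset.range (2 ^ doublings Q m D), ψ (ones (i + a * D)) (ones Q) := by
  induction m generalizing i D x with
  | zero => simp [doublings, hφ, hx.index, hx.bound]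
  | succ m ih =>
    rw [Function.iterate_succ_apply', Prog.wp_ite, doublings, Prog.wp_skip]
    simp only [hx.rest]
    by_cases h : D ≤ Q
    · rw [if_pos ((head?_ones _).2 (by omega)), if_pos h]
      obtain ⟨x₀, x₁, h₀, h₁, hw, -⟩ := samplerRound_spec Q i D x hx
      rw [hw, ih _ _ _ h₀, ih _ _ _ h₁, pow_succ' (2 : ℕ), sum_range_two_mul, Finset.sum_add_distrib]
      have e₀ : ∀ a, i + a * (D + D) = i + 2 * a * D := fun a => by ring
      have e₁ : ∀ a, i + D + a * (D + D) = i + (2 * a + 1) * D := fun a => by ring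
      simp only [e₀, e₁]
      rw [pow_succ' (2 : ℂ), mul_inv]
      ring
    · rw [if_neg (by rw [head?_ones]; omega), if_neg h]
      exact ih i D x hx

/-- The memory of the sampler when it enters its main loop. -/
theorem sampler_init (c k n : ℕ) : ∃ x, SamplerState ((n + c) ^ k) 0 1 x ∧
    (Prog.copy 5 0 ;; pushOnes 5 c ;; pushPow 5 4 k ;; Prog.copy 7 4 ;;
      Prog.instr (.push true 8)).Computes (inputStore (ones n) [] []) x
        (n + c + (n + c + 1) ^ k + (n + c) ^ k + 4) := by
  set x := inputStore (ones n) [] []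
  have h1 := Prog.computes_copy 5 0 x
  set x1 := setReg x 5 (x 0)
  have h2 := computes_pushOnes 5 c x1 n (by simp [x1, x, inputStore])
  set x2 := setReg x1 5 (ones (n + c)) with hx2
  have h25 : x2 5 = ones (n + c) := by simp [hx2]
  have h24 : x2 4 = ones 0 := by simp [hx2, x1, setReg_apply, x, inputStore]
  have h3 := computes_pushPow (r := 5) (d := 4) (by norm_num) k x2 0 h24
  rw [h25, List.length_replicate, Nat.zero_add] at h3
  set x3 := setReg x2 4 (ones ((n + c) ^ k)) with hx3
  have h4 := Prog.computes_copy 7 4 x3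
  set x4 := setReg x3 7 (x3 4) with hx4
  have h5 := Prog.computes_push true 8 x4
  refine ⟨setReg x4 8 (true :: x4 8), ⟨?_, ?_, ?_, ?_⟩, ?_⟩
  rotate_left 4
  · have h := h1.seq (h2.seq (h3.seq (h4.seq h5)))
    refine ⟨h.wp_eq, fun q o ho => ⟨(h.paths_eq q o ho).1, (h.paths_eq q o ho).2.trans ?_⟩⟩
    have e0 : (x 0).length = n := by simp [x, inputStore]
    have e4 : (x3 4).length = (n + c) ^ k := by simp [hx3]
    rw [e0, e4]
    omega
  · simp [hx4, hx3, hx2, x1, setReg_apply, x, inputStore, ones]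
  · simp [hx4, hx3, setReg_apply]
  · simp [hx4, hx3, setReg_apply]
  · simp [hx4, hx3, hx2, x1, setReg_apply, x, inputStore, ones]

/-- The number of indices from which the sampler chooses. -/
def samplerRange (Q : ℕ) : ℕ := 2 ^ doublings Q Q 1

theorem samplerRange_spec (Q : ℕ) : Q < samplerRange Q ∧ samplerRange Q ≤ 2 * Q + 1 := by
  obtain ⟨h1, h2⟩ := doublings_spec Q Q 1
  rw [mul_one] at h1 h2
  refine ⟨?_, h1.trans (by omega)⟩
  rcases h2 with h2 | h2
  · rw [samplerRange, h2]; exact Nat.lt_two_pow_self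
  · exact h2

/-- The output of the sampler is uniform below `samplerRange`. -/
theorem sampler_ev (c k n : ℕ) (ψ : List Bool → List Bool → ℂ) :
    (ev ((sampler c k).outC (ones n) [] []) fun w => ψ (w 3) (w 4)) =
      (samplerRange ((n + c) ^ k) : ℂ)⁻¹ *
        ∑ i ∈ Finset.range (samplerRange ((n + c) ^ k)), ψ (ones i) (ones ((n + c) ^ k)) := by
  classical
  obtain ⟨x, hx, hc⟩ := sampler_init c k n
  rw [Prog.ev_outC, inputCfg]
  have hs : ∀ φ, (sampler c k).wp φ = (Prog.copy 5 0 ;; pushOnes 5 c ;; pushPow 5 4 k ;;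
      Prog.copy 7 4 ;; Prog.instr (.push true 8)).wp
        ((Prog.loop 4 (.ite 7 samplerRound .skip)).wp φ) := by
    intro φ; simp only [sampler, Prog.wp_seq]
  rw [hs, hc.wp_eq, Prog.wp_loop]
  simp only [hx.bound, List.length_replicate]
  rw [samplerLoop_wp ((n + c) ^ k) (ψ := ψ) (by simp) _ 0 1 x hx]
  simp [samplerRange]

theorem samplerLoop_paths (Q m : ℕ) : ∀ i D x, D ≤ 2 * Q + 1 → SamplerState Q i D x →
    ∀ o ∈ Outcome.iter ((Prog.ite 7 samplerRound .skip).paths ∅) m ⟨x, fun _ => []⟩,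
      o.time ≤ m * (5 * Q + 6) + 1 := by
  induction m with
  | zero =>
    rintro i D x hD hx _ rfl
    simp
  | succ m ih =>
    rintro i D x hD hx _ ⟨_, ⟨_, rfl, o₁, h₁, rfl⟩, o₂, h₂, rfl⟩
    simp only [Nat.add_mul m, one_mul]
    simp only [hx.rest, head?_ones] at h₁
    split_ifs at h₁ with h
    · obtain ⟨x₀, x₁, s₀, s₁, -, hp⟩ := samplerRound_spec Q i D x hx
      obtain ⟨hf, ht⟩ := hp o₁ h₁
      rcases hf with hf | hf
      · simp only [hf] at h₂
        have := ih _ _ _ (by omega) s₀ o₂ h₂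
        omega
      · simp only [hf] at h₂
        have := ih _ _ _ (by omega) s₁ o₂ h₂
        omega
    · obtain ⟨hf, ht⟩ := (Prog.computes_skip x).paths_eq _ o₁ h₁
      simp only [hf] at h₂
      have := ih _ _ _ hD hx o₂ h₂
      omega

/-- The sampler runs in polynomial time, for fixed `c` and `k`. -/
theorem sampler_time (c k n : ℕ) :
    ∀ o ∈ (sampler c k).paths ∅ (inputCfg (ones n) [] []).point,
      o.time ≤ n + c + (n + c + 1) ^ k + (n + c) ^ k + 4 +
        ((n + c) ^ k * (5 * (n + c) ^ k + 6) + 1) := by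
  obtain ⟨x, hx, hc⟩ := sampler_init c k n
  rintro _ ⟨o₁, h₁, _, ⟨o₂, h₂, _, ⟨o₃, h₃, _, ⟨o₄, h₄, _, ⟨o₅, h₅, o₆, h₆, rfl⟩, rfl⟩, rfl⟩, rfl⟩, rfl⟩
  obtain ⟨hf, ht⟩ := hc.paths_eq _ _ ⟨o₁, h₁, _, ⟨o₂, h₂, _, ⟨o₃, h₃, _, ⟨o₄, h₄, o₅, h₅, rfl⟩,
    rfl⟩, rfl⟩, rfl⟩
  simp only at hf ht
  simp only [Prog.paths, hf, hx.bound, List.length_replicate] at h₆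
  have := samplerLoop_paths _ _ 0 1 x (by omega) hx o₆ h₆
  simp only
  omega

/-! ### Registers of the games -/

theorem block_injective (j : ℕ) : (block j).Injective := fun r s h => by
  simpa [block, Nat.pair_eq_pair] using h

@[simp] theorem block_eq_block {i j r s : ℕ} : block i r = block j s ↔ i = j ∧ r = s := by
  simp [block, Nat.pair_eq_pair]

theorem five_le_block (j r : ℕ) : 5 ≤ block j r := Nat.le_add_right _ _

@[simp] theorem block_ne_zero (j r : ℕ) : block j r ≠ 0 := by have := five_le_block j r; omega
@[simp] theorem block_ne_one (j r : ℕ) : block j r ≠ 1 := by have := five_le_block j r; omega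
@[simp] theorem block_ne_two (j r : ℕ) : block j r ≠ 2 := by have := five_le_block j r; omega
@[simp] theorem block_ne_three (j r : ℕ) : block j r ≠ 3 := by have := five_le_block j r; omega
@[simp] theorem block_ne_four (j r : ℕ) : block j r ≠ 4 := by have := five_le_block j r; omega
@[simp] theorem zero_ne_block (j r : ℕ) : 0 ≠ block j r := (block_ne_zero j r).symm
@[simp] theorem one_ne_block (j r : ℕ) : 1 ≠ block j r := (block_ne_one j r).symm
@[simp] theorem two_ne_block (j r : ℕ) : 2 ≠ block j r := (block_ne_two j r).symm

@[simp] theorem injective_party (P : Party) : Function.Injective fun r : ℕ => (P, r) :=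
  Prod.mk_right_injective P

@[simp] theorem injective_party_block (P : Party) (j : ℕ) :
    Function.Injective fun r : ℕ => (P, block j r) := fun r s h => by simpa using h

open Classical in
@[simp] theorem extend_party (P Q : Party) (w : Store ℕ) (x : Store (Party × ℕ)) (s : ℕ) :
    Function.extend (fun r => (P, r)) w x (Q, s) = if Q = P then w s else x (Q, s) := by
  split_ifs with h
  · subst h; exact (injective_party Q).extend_apply w x s
  · exact Function.extend_apply' _ _ _ fun ⟨r, hr⟩ => h (congrArg Prod.fst hr).symm

open Classical in
@[simp] theorem extend_party_block (P Q : Party) (i j : ℕ) (w : Store ℕ) (x : Store (Party × ℕ))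
    (s : ℕ) : Function.extend (fun r => (P, block j r)) w x (Q, block i s) =
      if Q = P ∧ i = j then w s else x (Q, block i s) := by
  split_ifs with h
  · obtain ⟨rfl, rfl⟩ := h; exact (injective_party_block Q i).extend_apply w x s
  · refine Function.extend_apply' _ _ _ fun ⟨r, hr⟩ => h ?_
    simp only [Prod.mk.injEq, block_eq_block] at hr
    exact ⟨hr.1.symm, hr.2.1.symm⟩

@[simp] theorem extend_party_block_of_lt (P Q : Party) (j : ℕ) (w : Store ℕ)
    (x : Store (Party × ℕ)) {s : ℕ} (hs : s < 5) :
    Function.extend (fun r => (P, block j r)) w x (Q, s) = x (Q, s) := by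
  refine Function.extend_apply' _ _ _ fun ⟨r, hr⟩ => ?_
  have := five_le_block j r
  simp only [Prod.mk.injEq] at hr
  omega

theorem extend_party_of_ne {P Q : Party} (h : ℕ → ℕ) (w : Store ℕ) (x : Store (Party × ℕ)) (s : ℕ)
    (hQ : Q ≠ P) : Function.extend (fun r => (P, h r)) w x (Q, s) = x (Q, s) :=
  Function.extend_apply' _ _ _ fun ⟨_, hr⟩ => hQ (congrArg Prod.fst hr).symm

section call

variable {S ι : Type} {g : ℕ → S} {v : ι → S} {e s₀ s₁ s₂ : S}

theorem wp_call₁ (hg : g.Injective) (hv : ∀ k i, v i ≠ g k)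
    (p : Prog ℕ Empty) (h₀ : ∀ k, g k ≠ s₀) (φ : View S ι → ℂ) :
    (Prog.call g p [(0, s₀)] : Prog S Empty).wp (traceOut v φ) = traceOut v fun z =>
      ev (p.outC (z.cl s₀) [] []) fun w => φ { z with cl := Function.extend g w z.cl } :=
  wp_call_traceOut hg (loads_one hg h₀) hv p φ

theorem wp_call₂ (hg : g.Injective) (hv : ∀ k i, v i ≠ g k)
    (p : Prog ℕ Empty) (h₀ : ∀ k, g k ≠ s₀) (h₁ : ∀ k, g k ≠ s₁) (φ : View S ι → ℂ) :
    (Prog.call g p [(0, s₀), (1, s₁)] : Prog S Empty).wp (traceOut v φ) = traceOut v fun z =>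
      ev (p.outC (z.cl s₀) (z.cl s₁) []) fun w =>
        φ { z with cl := Function.extend g w z.cl } :=
  wp_call_traceOut hg (loads_two hg h₀ h₁) hv p φ

theorem wp_call₃ (hg : g.Injective) (hv : ∀ k i, v i ≠ g k)
    (p : Prog ℕ Empty) (h₀ : ∀ k, g k ≠ s₀) (h₁ : ∀ k, g k ≠ s₁) (h₂ : ∀ k, g k ≠ s₂)
    (φ : View S ι → ℂ) :
    (Prog.call g p [(0, s₀), (1, s₁), (2, s₂)] : Prog S Empty).wp (traceOut v φ) =
      traceOut v fun z => ev (p.outC (z.cl s₀) (z.cl s₁) (z.cl s₂)) fun w =>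
        φ { z with cl := Function.extend g w z.cl } :=
  wp_call_traceOut hg (loads_three hg h₀ h₁ h₂) hv p φ

theorem wp_call₃_other (hg : g.Injective) (hv : ∀ k i, v i ≠ g k)
    (p : Prog ℕ Empty) (he : ∀ k, e ≠ g k) (h₀ : ∀ k, g k ≠ s₀) (h₁ : ∀ k, g k ≠ s₁)
    (h₂ : ∀ k, g k ≠ s₂) (φ : View S ι → List Bool → List Bool → ℂ) :
    (Prog.call g p [(0, s₀), (1, s₁), (2, s₂)] : Prog S Empty).wp (traceOutKeep v e φ) =
      traceOutKeep v e fun z k l => ev (p.outC (z.cl s₀) (z.cl s₁) (z.cl s₂)) fun w =>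
        φ { z with cl := Function.extend g w z.cl } k l :=
  wp_call_traceOutKeep hg (loads_three hg h₀ h₁ h₂) hv he p φ

theorem wp_call₃_keep (hg : g.Injective) (hv : ∀ k i, v i ≠ g k)
    (p : Prog ℕ Empty) (he : e = g 3) (h₀ : ∀ k, g k ≠ s₀) (h₁ : ∀ k, g k ≠ s₁)
    (h₂ : ∀ k, g k ≠ s₂) (φ : View S ι → List Bool → List Bool → ℂ) :
    (Prog.call g p [(0, s₀), (1, s₁), (2, s₂)] : Prog S Empty).wp (traceOutKeep v e φ) =
      traceOut v fun z => ev (p.outQ (z.cl s₀) (z.cl s₁) (z.cl s₂)) fun w =>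
        φ { z with cl := Function.extend g w.1 z.cl } w.2.1 w.2.2 := by
  subst he
  exact wp_call_keep hg (loads_three hg h₀ h₁ h₂) hv p φ

theorem wp_load₃ (hg : g.Injective) (hv : ∀ k i, v i ≠ g k)
    (h₀ : ∀ k, g k ≠ s₀) (h₁ : ∀ k, g k ≠ s₁) (h₂ : ∀ k, g k ≠ s₂)
    (φ : View S ι → ℂ) :
    (Prog.load g [(0, s₀), (1, s₁), (2, s₂)] : Prog S Empty).wp (traceOut v φ) =
      traceOut v fun z => φ { z with
        cl := Function.extend g (inputStore (z.cl s₀) (z.cl s₁) (z.cl s₂)) z.cl } :=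
  wp_load_traceOut (loads_three hg h₀ h₁ h₂) hv φ

end call

/-! ### Games in terms of channels -/

/-- `ψ` after the string `s` and the qubits `k`, `l` have been delivered in register `1`. -/
def deliverTo (s k l : List Bool) (ψ : Cfg ℕ → ℂ) (c : Cfg ℕ) : ℂ :=
  open Classical in
  if c.ket 1 = c.bra 1 then ψ ⟨setReg c.cl 1 s, setReg c.ket 1 k, setReg c.bra 1 l⟩ else 0

/-- The adversary receives an encryption of `m` by the collusion-resistant scheme with the encryption
key `ek`; the second component of the ciphertext is truncated by `κ`. -/
def freshAnswer (U : UTSKE) (N : SKNCER) (n : ℕ) (ek : List Bool) (κ : List Bool → List Bool)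
    (m : List Bool) (ψ : Cfg ℕ → ℂ) (c : Cfg ℕ) : ℂ :=
  ev (U.gen.outC (ones n) [] []) fun g => ev (N.enc.outC (ones n) ek (g 3)) fun t =>
    ev (U.enc.outQ (ones n) (g 3) m) fun w =>
      deliverTo (pairCode (w.1 3) (κ (t 3))) w.2.1 w.2.2 ψ c

/-- The adversary receives an encryption of `m` by the single-key scheme with the key `sk`, whose
classical part is truncated by `κ`, together with `ct`. -/
def keyedAnswer (U : UTSKE) (n : ℕ) (sk ct : List Bool) (κ : List Bool → List Bool)
    (m : List Bool) (ψ : Cfg ℕ → ℂ) (c : Cfg ℕ) : ℂ :=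
  ev (U.enc.outQ (ones n) sk m) fun w =>
    deliverTo (pairCode (κ (w.1 3)) ct) w.2.1 w.2.2 ψ c

/-- The register that holds the message `m_b` of a query. -/
abbrev msgReg (b : Bool) : ℕ := if b then 4 else 3

/-- All queries are answered by encryptions of `m_b`. -/
def plainOracle (U : UTSKE) (N : SKNCER) (n : ℕ) (ek : List Bool) (b : Bool)
    (φ : Cfg ℕ × Unit → ℂ) (x : Cfg ℕ × Unit) : ℂ :=
  freshAnswer U N n ek id (x.1.cl (msgReg b)) (fun c => φ (c, ())) x.1

/-- A counter, the second component of the state, is decremented by every query; the queries are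
answered by encryptions of `m₁` while the counter is positive, and of `m₀` afterwards. -/
def hybridOracle (U : UTSKE) (N : SKNCER) (n : ℕ) (ek : List Bool)
    (φ : Cfg ℕ × ℕ → ℂ) (x : Cfg ℕ × ℕ) : ℂ :=
  if 0 < x.2 then freshAnswer U N n ek id (x.1.cl 4) (fun c => φ (c, x.2 - 1)) x.1
  else freshAnswer U N n ek id (x.1.cl 3) (fun c => φ (c, x.2)) x.1

/-- As `hybridOracle`, with the counter in unary, except that the first query for which the counter
is zero is answered by an encryption of `m_β` that uses the one-time key `sk` and the ciphertext `ct`.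
The last component of the state says whether this has happened. -/
def eagerOracle (U : UTSKE) (N : SKNCER) (n : ℕ) (ek sk ct : List Bool)
    (κ₁ κ₂ : List Bool → List Bool) (β : Bool) (φ : Cfg ℕ × List Bool × Bool → ℂ)
    (x : Cfg ℕ × List Bool × Bool) : ℂ :=
  if x.2.1.head? = some true then
    freshAnswer U N n ek κ₁ (x.1.cl 4) (fun c => φ (c, x.2.1.tail, x.2.2)) x.1
  else if x.2.2 = true then freshAnswer U N n ek κ₁ (x.1.cl 3) (fun c => φ (c, x.2)) x.1
  else keyedAnswer U n sk ct κ₂ (x.1.cl (msgReg β)) (fun c => φ (c, x.2.1, true)) x.1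

/-- The second-stage adversary, on the state in register `3` of the first-stage adversary and the
decryption key `dk`, outputs `1`. -/
def finish (B : Prog ℕ Empty) (n : ℕ) (dk : List Bool) (c : Cfg ℕ) : ℂ :=
  open Classical in
  if c.ket = c.bra then
    ev (B.outC (ones n) (c.cl 3) dk) fun w => if (w 3).head? = some true then 1 else 0
  else 0

/-- The first-stage adversary, run with the oracle `G` on a state with the additional component `V`. -/
def runStage {V O : Type} (A : Prog ℕ O) (n : ℕ) (G : O → (Cfg ℕ × V → ℂ) → Cfg ℕ × V → ℂ)
    (φ : Cfg ℕ × V → ℂ) (v : V) : ℂ :=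
  A.transform Prod.fst (fun x w => (w, x.2)) G φ (inputCfg (ones n) [] [], v)

/-- The functional `Φ` discards all qubits outside the registers `f r`, and then agrees, in the
memories with the invariant `Inv`, with the functional `ψ` of the registers `f r` and of the value
`rd`. -/
def Agree {S V : Type} (f : ℕ → S) (Inv : Store S → Prop) (rd : Store S → V) (Φ : Cfg S → ℂ)
    (ψ : Cfg ℕ × V → ℂ) : Prop :=
  ∃ φ, Φ = traceOut f φ ∧ ∀ z : View S ℕ, Inv z.cl → φ z = ψ (z.get f, rd z.cl)

/-- A functional of a view is determined by the functional of the state; hence the functional in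
`Agree` does not depend on the invariant. -/
theorem traceOut_injective {S : Type} {f : ℕ → S} (hf : f.Injective) :
    Function.Injective (traceOut f) := by
  intro φ φ' h
  funext z
  have h' := congrFun h ⟨z.cl, Function.extend f z.ket fun _ => [], Function.extend f z.bra fun _ => []⟩
  have hs : ∀ s, (∀ i, f i ≠ s) → Function.extend f z.ket (fun _ => []) s =
      Function.extend f z.bra (fun _ => []) s := by
    intro s hs
    rw [Function.extend_apply' _ _ _ (by simpa using hs), Function.extend_apply' _ _ _ (by simpa using hs)]
  simpa only [traceOut, if_pos hs, extend_comp_left hf] using h'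

/-- If `Φ` agrees with `ψ i` on the memories with the invariant `Inv i`, for every `i`, then one
functional of views describes `Φ` in all these memories. -/
theorem Agree.exists_uniform {S V I : Type} [Nonempty I] {f : ℕ → S} (hf : f.Injective)
    {Inv : I → Store S → Prop} {rd : Store S → V} {Φ : Cfg S → ℂ} {ψ : I → Cfg ℕ × V → ℂ}
    (h : ∀ i, Agree f (Inv i) rd Φ (ψ i)) :
    ∃ φ, Φ = traceOut f φ ∧ ∀ i (z : View S ℕ), Inv i z.cl → φ z = ψ i (z.get f, rd z.cl) := by
  choose φ hφ hφ' using h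
  obtain ⟨i₀⟩ := ‹Nonempty I›
  refine ⟨φ i₀, hφ i₀, fun i => ?_⟩
  rw [traceOut_injective hf ((hφ i₀).symm.trans (hφ i))]
  exact hφ' i

/-- A game and its description in terms of channels agree if the oracles do. -/
theorem Agree.subst {S V O : Type} {f : ℕ → S} (hf : f.Injective) {Inv : Store S → Prop}
    {rd : Store S → V} (hInv : ∀ x w, Inv x → Inv (Function.extend f w x))
    (hrd : ∀ x w, rd (Function.extend f w x) = rd x) {h : O → Prog S Empty}
    {G : O → (Cfg ℕ × V → ℂ) → Cfg ℕ × V → ℂ}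
    (hO : ∀ o Φ ψ, Agree f Inv rd Φ ψ → Agree f Inv rd ((h o).wp Φ) (G o ψ))
    (A : Prog ℕ O) {Φ : Cfg S → ℂ} {ψ : Cfg ℕ × V → ℂ} (hΦ : Agree f Inv rd Φ ψ) :
    Agree f Inv rd ((A.subst f h).wp Φ) (A.transform Prod.fst (fun x w => (w, x.2)) G ψ) := by
  classical
  rw [Prog.wp_subst hf]
  refine Prog.transform_rel (Agree f Inv rd) ?_ hO ?_ A hΦ
  · rintro i _ ψ ⟨φ, rfl, hφ⟩
    refine ⟨fun z => ev (i.eval (z.get f)) fun w => φ (z.set f w), ?_, fun z hz => ?_⟩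
    · funext c
      have h1 : ∀ w : Cfg ℕ, traceOut f φ (c.overlay f w) =
          if ∀ s, (∀ i, f i ≠ s) → c.ket s = c.bra s then
            φ ((⟨c.cl, c.ket ∘ f, c.bra ∘ f⟩ : View S ℕ).set f w) else 0 := by
        intro w
        simp only [traceOut, Cfg.overlay, extend_comp_left hf, View.set]
        refine if_congr (forall_congr' fun s => forall_congr' fun hs => ?_) rfl rfl
        have : ¬ ∃ k, f k = s := by simpa using hs
        rw [Function.extend_apply' _ _ _ this, Function.extend_apply' _ _ _ this]
      simp only [h1]
      simp only [traceOut]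
      split_ifs
      · rfl
      · rw [ev_zero_right]
    · refine congrArg _ (funext fun w => ?_)
      rw [hφ _ (hInv _ _ hz), View.get_set hf]
      simp only [View.set, hrd]
  · intro r Φ Ψ h
    choose φ hφ hφ' using h
    refine ⟨fun z => φ (z.cl (f r)) z, ?_, fun z hz => hφ' _ z hz⟩
    funext c
    simp only [hφ, traceOut]
    rfl

/-! ### The collusion-resistance game -/

theorem gameInput_main (n : ℕ) : gameInput n (Party.main, 0) = ones n := by simp [gameInput]

theorem gameInput_of_ne (n : ℕ) {r : Party × ℕ} (h : r ≠ (Party.main, 0)) : gameInput n r = [] := by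
  simp [gameInput, h]

/-- Two successive replacements of the qubits of the adversary's register `1`, by none and by `k`,
`l`, together with the classical operation `F`, amount to a delivery in this register. -/
theorem replace_replace_eq {S V : Type} {f : ℕ → S} {Inv : Store S → Prop} {rd : Store S → V}
    {φ : View S ℕ → ℂ} {ψ : Cfg ℕ × V → ℂ}
    (hφ : ∀ z : View S ℕ, Inv z.cl → φ z = ψ (z.get f, rd z.cl)) (F : Store S → Store S)
    {k l s : List Bool} {x : Store S} {z : View S ℕ} (hI : Inv (F x)) (hrd : rd (F x) = rd z.cl)
    (hF : ∀ r, F x (f r) = if r = 1 then s else z.cl (f r)) :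
    View.replace 1 (fun z => View.replace 1 φ ⟨F z.cl, z.ket, z.bra⟩ k l) ⟨x, z.ket, z.bra⟩ [] [] =
      deliverTo s k l (fun w => ψ (w, rd z.cl)) (z.get f) := by
  classical
  by_cases h : z.ket 1 = z.bra 1
  · rw [deliverTo, if_pos (show (z.get f).ket 1 = (z.get f).bra 1 from h)]
    simp only [View.replace, if_pos h, Function.update_self, Function.update_idem, if_true]
    rw [hφ _ hI]
    refine congrArg ψ (Prod.ext ?_ hrd)
    simp only [View.get, Cfg.mk.injEq, setReg]
    exact ⟨funext fun r => by simp [hF, Function.update_apply], trivial, trivial⟩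
  · rw [deliverTo, if_neg (show ¬ (z.get f).ket 1 = (z.get f).bra 1 from h)]
    simp only [View.replace, if_neg h]

/-- The challenger's storage in the collusion-resistance game. -/
def KeysStored (n : ℕ) (ek dk : List Bool) (x : Store (Party × ℕ)) : Prop :=
  x (.main, 0) = ones n ∧ x (.main, 1) = ek ∧ x (.main, 2) = dk

theorem crChallenge_eq (U : UTSKE) (N : SKNCER) (b : Bool) :
    (crUTE U N).challenge b =
      (Prog.load (Party.enc, ·) [(0, (.main, 0)), (1, (.main, 1)), (2, (.adv, msgReg b))] ;;
        Prog.call (fun r => (Party.enc, block 0 r)) U.gen [(0, (.enc, 0))] ;;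
        Prog.call (fun r => (Party.enc, block 1 r)) U.enc
          [(0, (.enc, 0)), (1, (.enc, block 0 3)), (2, (.enc, 2))] ;;
        Prog.call (fun r => (Party.enc, block 2 r)) N.enc
          [(0, (.enc, 0)), (1, (.enc, 1)), (2, (.enc, block 0 3))] ;;
        .instr (.pair (.enc, 3) (.enc, block 1 3) (.enc, block 2 3)) ;;
        .instr (.qswap (.enc, 3) (.enc, block 1 3))) ;;
      .instr (.reset {(.adv, 1)}) ;;
      Prog.copy (.adv, 1) (.enc, 3) ;;
      .instr (.qswap (.adv, 1) (.enc, 3)) := by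
  simp only [SplitUTSKE.challenge, crUTE, crEnc]
  rw [Prog.call, Prog.place, Prog.subst]
  simp only [Prog.subst, Prog.subst_call]
  rfl

/-- The challenger's answer is a fresh encryption of `m_b`. -/
theorem crChallenge_agree (U : UTSKE) (N : SKNCER) (b : Bool) (n : ℕ) (ek dk : List Bool)
    {Φ : Cfg (Party × ℕ) → ℂ} {ψ : Cfg ℕ × Unit → ℂ}
    (h : Agree (fun r => (Party.adv, r)) (KeysStored n ek dk) (fun _ => ()) Φ ψ) :
    Agree (fun r => (Party.adv, r)) (KeysStored n ek dk) (fun _ => ())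
      (((crUTE U N).challenge b).wp Φ) (plainOracle U N n ek b ψ) := by
  obtain ⟨φ, rfl, hφ⟩ := h
  have e1 := fun φ => wp_qswap_traceOut (injective_party Party.adv) (e := (Party.enc, 3))
    (by simp) 1 φ
  have e2 := fun φ => wp_reset_visible_traceOutKeep (injective_party Party.adv)
    (e := (Party.enc, 3)) (by simp) 1 φ
  simp (disch := simp) only [crChallenge_eq, Prog.wp_seq, e1, wp_copy_traceOutKeep, e2,
    wp_qswap_traceOutKeep, wp_pair_traceOutKeep, wp_call₃_other, wp_call₃_keep, wp_call₁, wp_load₃]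
  refine ⟨_, rfl, fun z hz => ?_⟩
  obtain ⟨h₀, h₁, h₂⟩ := hz
  simp only [plainOracle, freshAnswer, extend_party, extend_party_block, ↓extend_party_block_of_lt,
    Nat.reduceLT, and_self, if_true, inputStore, h₀, h₁]
  simp
  refine congrArg (ev _) (funext fun g => ?_)
  rw [ev_comm]
  refine congrArg (ev _) (funext fun t => congrArg (ev _) (funext fun w => ?_))
  refine replace_replace_eq (rd := fun _ => ()) hφ (fun x => setReg (setReg x (Party.adv, 1) []) (Party.adv, 1)
    (setReg x (Party.adv, 1) [] (Party.enc, 3))) ?_ rfl ?_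
  · simp [KeysStored, setReg_apply, *]
  · intro r
    simp (disch := simp) only [setReg_apply, extend_party_of_ne, extend_party, Prod.mk.injEq, reduceCtorEq,
      false_and, true_and, if_false]
    split_ifs <;> rfl

/-- The collusion-resistance game in terms of channels. -/
theorem crUTE_winProb (U : UTSKE) (N : SKNCER) (A : Prog ℕ Unit) (B : Prog ℕ Empty) (b : Bool)
    (n : ℕ) : (crUTE U N).winProb A B b n =
      (ev (N.kg.outC (ones n) [] []) fun g => runStage A n (fun _ => plainOracle U N n (g 3) b)
        (fun x => finish B n (g 4) x.1) ()).re := by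
  classical
  have hA : ∀ k : List Bool × List Bool, Agree (fun r => (Party.adv, r)) (KeysStored n k.1 k.2)
      (fun _ => ()) ((A.subst (Party.adv, ·) (fun _ => (crUTE U N).challenge b)).wp
        ((Prog.call (Party.dist, ·) B
          [(0, (.main, 0)), (1, (.adv, 3)), (2, (.main, 2))]).wp
            (traceOut (fun r => (Party.adv, r)) fun z =>
              if z.ket = z.bra ∧ (z.cl (Party.dist, 3)).head? = some true then 1 else 0)))
      (A.transform Prod.fst (fun x w => (w, x.2)) (fun _ => plainOracle U N n k.1 b)
        fun x => finish B n k.2 x.1) := by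
    rintro ⟨ek, dk⟩
    refine Agree.subst (injective_party _) ?_ (fun _ _ => rfl)
      (fun _ _ _ h => crChallenge_agree U N b n ek dk h) A ?_
    · rintro x w ⟨h₀, h₁, h₂⟩
      simp [KeysStored, *]
    · simp (disch := simp) only [wp_call₃]
      refine ⟨_, rfl, ?_⟩
      rintro z ⟨h₀, h₁, h₂⟩
      simp only [h₀, h₂, extend_party, if_true, finish, View.get, Function.comp]
      by_cases h : z.ket = z.bra
      · simp only [h, true_and, if_true]
      · simp only [h, false_and, if_false, ev_zero_right]
  obtain ⟨φ, hφ, hφ'⟩ := Agree.exists_uniform (injective_party _) hA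
  rw [SplitUTSKE.winProb, acceptProb_eq _ _ _ (fun r => (Party.adv, r)), SplitUTSKE.game]
  simp (disch := simp) only [Prog.wp_seq, hφ, wp_copy_traceOut, wp_call₁, traceOut_init]
  rw [gameInput_main]
  refine congrArg Complex.re (congrArg (ev _) (funext fun g => ?_))
  rw [hφ' (g 3, g 4) _ ?_]
  · refine congrArg _ (Prod.ext ?_ rfl)
    simp only [View.get, inputCfg, Cfg.mk.injEq, and_true]
    funext r
    by_cases hr : r = 0 <;>
      simp [setReg_apply, inputStore, gameInput_main, gameInput_of_ne, hr]
  · simp [KeysStored, setReg_apply, gameInput_main]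

/-! ### The reductions -/

section reductions

variable {O : Type}

/-- Deliver to the adversary in block `0` the output of the algorithm in block `2`, with its classical
part paired with the string in `s`. -/
def deliver (s : ℕ) : Prog ℕ O :=
  .instr (.reset {block 0 1}) ;; .instr (.pair (block 0 1) (block 2 3) s) ;;
    .instr (.qswap (block 0 1) (block 2 3))

/-- Answer a query by `fresh 4` as long as the counter in `block 3 3` is positive, the next query by
`chal`, and all further ones by `fresh 3`. -/
def slotted (fresh : ℕ → Prog ℕ O) (chal : Prog ℕ O) : Prog ℕ O :=
  .ite (block 3 3) (.instr (.pop (block 3 3)) ;; fresh 4)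
    (.ite (block 5 3) (fresh 3) (.instr (.push true (block 5 3)) ;; chal))

end reductions

/-- Encrypt the message in register `j` of the adversary under a fresh one-time key, which is
encrypted by the oracle. -/
def nceFresh (U : UTSKE) (j : ℕ) : Prog ℕ NCEQuery :=
  Prog.call (block 1) U.gen [(0, 0)] ;; Prog.copy 3 (block 1 3) ;; .query .encrypt ;;
  .instr (.cut 1 (block 3 4)) ;;
  Prog.call (block 2) U.enc [(0, 0), (1, block 1 3), (2, block 0 j)] ;; deliver 1

/-- Encrypt the message `m_β` under the one-time key of the challenge. -/
def nceChallenge (U : UTSKE) (β : Bool) : Prog ℕ NCEQuery :=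
  Prog.call (block 2) U.enc [(0, 0), (1, block 5 0), (2, block 0 (msgReg β))] ;; deliver (block 5 1)

/-- The adversary against the non-committing scheme. It obtains at the outset the challenge
ciphertext and the decryption key for a one-time key of its own, keeps these data in block `5`, and
uses them for the encryption of `m_β` in a random query. -/
def nceAdversary (U : UTSKE) (A : Prog ℕ Unit) (B : Prog ℕ Empty) (c k : ℕ) (β : Bool) :
    Prog ℕ NCEQuery :=
  Prog.call (block 3) (sampler c k) [(0, 0)] ;;
  Prog.call (block 1) U.gen [(0, 0)] ;;
  Prog.copy (block 5 0) (block 1 3) ;; Prog.copy 3 (block 1 3) ;;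
  .query .challenge ;;
  .instr (.cut 1 (block 3 4)) ;; .instr (.cut 2 (block 3 4)) ;;
  Prog.copy (block 5 1) 1 ;; Prog.copy (block 5 2) 2 ;;
  Prog.copy (block 0 0) 0 ;;
  A.subst (block 0) (fun _ => slotted (nceFresh U) (nceChallenge U β)) ;;
  Prog.call (block 4) B [(0, 0), (1, block 0 3), (2, block 5 2)] ;;
  Prog.copy 3 (block 4 3)

/-- Encrypt the message in register `j` of the adversary by the collusion-resistant scheme. -/
def uteFresh (U : UTSKE) (N : SKNCER) (j : ℕ) : Prog ℕ Unit :=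
  Prog.call (block 1) U.gen [(0, 0)] ;;
  Prog.call (block 8) N.enc [(0, 0), (1, block 6 3), (2, block 1 3)] ;;
  Prog.call (block 2) U.enc [(0, 0), (1, block 1 3), (2, block 0 j)] ;; deliver (block 8 3)

/-- Pass the query on to the oracle, and complete its answer by the fake ciphertext. -/
def uteChallenge : Prog ℕ Unit :=
  Prog.copy 3 (block 0 3) ;; Prog.copy 4 (block 0 4) ;; .query () ;;
  .instr (.cut 1 (block 3 4)) ;;
  .instr (.reset {block 0 1}) ;; .instr (.pair (block 0 1) 1 (block 7 3)) ;;
  .instr (.qswap (block 0 1) 1)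

/-- The first-stage adversary against the single-key scheme. It runs key generation and the fake
encryption of the non-committing scheme, and uses its own oracle in a random query. -/
def uteAdversary (U : UTSKE) (N : SKNCER) (A : Prog ℕ Unit) (c k : ℕ) : Prog ℕ Unit :=
  Prog.call (block 3) (sampler c k) [(0, 0)] ;;
  Prog.call (block 6) N.kg [(0, 0)] ;;
  Prog.call (block 7) N.fake [(0, 0), (1, block 6 3)] ;;
  Prog.copy (block 0 0) 0 ;;
  A.subst (block 0) (fun _ => slotted (uteFresh U N) uteChallenge) ;;
  .instr (.pair 3 (block 0 3) (block 7 4))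

/-- The second-stage adversary against the single-key scheme. It turns the one-time key into a
decryption key that explains the fake ciphertext. -/
def uteDistinguisher (N : SKNCER) (B : Prog ℕ Empty) : Prog ℕ Empty :=
  .instr (.unpair (block 0 0) (block 0 1) 1) ;;
  Prog.call (block 1) N.reveal [(0, 0), (1, block 0 1), (2, 2)] ;;
  Prog.call (block 2) B [(0, 0), (1, block 0 0), (2, block 1 3)] ;;
  Prog.copy 3 (block 2 3)

/-! ### The games of the reductions -/

theorem Agree.ite {S V : Type} {f : ℕ → S} {Inv : Store S → Prop} {rd : Store S → V}
    {p q : Prog S Empty} {Φ : Cfg S → ℂ} {ψ₁ ψ₂ : Cfg ℕ × V → ℂ} {r : S} {c : V → Prop}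
    [DecidablePred c] (hc : ∀ x, (x r).head? = some true ↔ c (rd x))
    (hp : Agree f Inv rd (p.wp Φ) ψ₁) (hq : Agree f Inv rd (q.wp Φ) ψ₂) :
    Agree f Inv rd ((Prog.ite r p q).wp Φ) fun x => if c x.2 then ψ₁ x else ψ₂ x := by
  obtain ⟨φ₁, h₁, h₁'⟩ := hp
  obtain ⟨φ₂, h₂, h₂'⟩ := hq
  refine ⟨fun z => if c (rd z.cl) then φ₁ z else φ₂ z, ?_, fun z hz => ?_⟩
  · funext x
    rw [Prog.wp_ite, h₁, h₂]
    simp only [traceOut, hc]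
    split_ifs <;> rfl
  · simp only [h₁' z hz, h₂' z hz]

theorem Agree.classical {S V : Type} {f : ℕ → S} {Inv : Store S → Prop} {rd : Store S → V}
    {i : Instr S} {g : Store S → Store S} {t : V → V}
    (h : ∀ c, i.eval c = Finsupp.single { c with cl := g c.cl } 1)
    (hInv : ∀ x, Inv x → Inv (g x)) (hf : ∀ x r, g x (f r) = x (f r))
    (hrd : ∀ x, rd (g x) = t (rd x)) {Φ : Cfg S → ℂ} {ψ : Cfg ℕ × V → ℂ}
    (hΦ : Agree f Inv rd Φ ψ) :
    Agree f Inv rd ((Prog.instr i).wp Φ) fun x => ψ (x.1, t x.2) := by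
  obtain ⟨φ, rfl, hφ⟩ := hΦ
  refine ⟨_, wp_classical_traceOut f φ h, fun z hz => ?_⟩
  rw [hφ _ (hInv _ hz), hrd]
  simp only [View.get, Function.comp_def, hf]

/-- The registers of the adversary that is run by a reduction. -/
abbrev innerReg (r : ℕ) : Party × ℕ := (Party.adv, block 0 r)

/-- The counter, and whether the challenge has been used. -/
def slotState (x : Store (Party × ℕ)) : List Bool × Bool :=
  (x (.adv, block 3 3), (x (.adv, block 5 3)).head? == some true)

/-- Agreement for an oracle of the form `slotted`. -/
theorem agree_slotted {O : Type} {Inv : Store (Party × ℕ) → Prop}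
    (h₁ : ∀ x l, Inv x → Inv (setReg x (.adv, block 3 3) l))
    (h₂ : ∀ x l, Inv x → Inv (setReg x (.adv, block 5 3) l))
    {fresh : ℕ → Prog ℕ O} {chal : Prog ℕ O} {G : O → Prog (Party × ℕ) Empty}
    {Φ : Cfg (Party × ℕ) → ℂ} {F : ℕ → Cfg ℕ × List Bool × Bool → ℂ} {C : Cfg ℕ × List Bool × Bool → ℂ}
    (hF : ∀ j, Agree innerReg Inv slotState (((fresh j).subst (Party.adv, ·) G).wp Φ) (F j))
    (hC : Agree innerReg Inv slotState ((chal.subst (Party.adv, ·) G).wp Φ) C) :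
    Agree innerReg Inv slotState (((slotted fresh chal).subst (Party.adv, ·) G).wp Φ) fun x =>
      if x.2.1.head? = some true then F 4 (x.1, x.2.1.tail, x.2.2)
      else if x.2.2 = true then F 3 x else C (x.1, x.2.1, true) := by
  refine Agree.ite (c := fun v => v.1.head? = some true) (fun x => Iff.rfl) ?_
    (Agree.ite (c := fun v => v.2 = true) (r := (Party.adv, block 5 3)) (fun x => by simp [slotState]) (hF 3) ?_)
  · simp only [Prog.subst, Instr.map, Prog.wp_seq]
    refine Agree.classical (i := .pop (Party.adv, block 3 3)) (g := fun x => setReg x (.adv, block 3 3) (x (.adv, block 3 3)).tail)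
      (t := fun v => (v.1.tail, v.2)) (fun _ => rfl) (fun x => h₁ x _) ?_ ?_ (hF 4)
    · simp [setReg_apply]
    · simp [setReg_apply, slotState]
  · simp only [Prog.subst, Instr.map, Prog.wp_seq]
    refine Agree.classical (i := .push true (Party.adv, block 5 3))
      (g := fun x => setReg x (.adv, block 5 3) (true :: x (.adv, block 5 3)))
      (t := fun v => (v.1, true)) (fun _ => rfl) (fun x => h₂ x _) ?_ ?_ hC
    · simp [setReg_apply]
    · simp [setReg_apply, slotState]

/-- The memory in the game of `nceAdversary`. -/
def NceStored (n : ℕ) (ek sk ct dk q : List Bool) (x : Store (Party × ℕ)) : Prop :=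
  x (.main, 0) = ones n ∧ x (.main, 1) = ek ∧ x (.adv, 0) = ones n ∧ x (.adv, block 3 4) = q ∧
    x (.adv, block 5 0) = sk ∧ x (.adv, block 5 1) = ct ∧ x (.adv, block 5 2) = dk

/-- Truncation to the length of `q`. The reductions truncate the strings that they receive from their
oracle, since they have to run in polynomial time even when an answer is arbitrarily long. -/
abbrev cutTo (q t : List Bool) : List Bool := t.take q.length

theorem nceFresh_eq (U : UTSKE) (N : SKNCER) (b : Bool) (j : ℕ) :
    (nceFresh U j).subst (Party.adv, ·) (N.answer b) =
      Prog.call (fun r => (Party.adv, block 1 r)) U.gen [(0, (.adv, 0))] ;;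
      Prog.copy (.adv, 3) (.adv, block 1 3) ;;
      (Prog.call (fun r => (Party.enc, r)) N.enc [(0, (.main, 0)), (1, (.main, 1)), (2, (.adv, 3))] ;;
        Prog.copy (.adv, 1) (.enc, 3)) ;;
      .instr (.cut (.adv, 1) (.adv, block 3 4)) ;;
      Prog.call (fun r => (Party.adv, block 2 r)) U.enc
        [(0, (.adv, 0)), (1, (.adv, block 1 3)), (2, (.adv, block 0 j))] ;;
      .instr (.reset {(.adv, block 0 1)}) ;;
      .instr (.pair (.adv, block 0 1) (.adv, block 2 3) (.adv, 1)) ;;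
      .instr (.qswap (.adv, block 0 1) (.adv, block 2 3)) := by
  simp only [nceFresh, deliver, Prog.subst, Prog.subst_call, Instr.map, Set.image_singleton]
  rfl

theorem nceFresh_agree (U : UTSKE) (N : SKNCER) (b : Bool) (n j : ℕ) (ek sk ct dk q : List Bool)
    {Φ : Cfg (Party × ℕ) → ℂ} {ψ : Cfg ℕ × List Bool × Bool → ℂ}
    (h : Agree innerReg (NceStored n ek sk ct dk q) slotState Φ ψ) :
    Agree innerReg (NceStored n ek sk ct dk q) slotState
      (((nceFresh U j).subst (Party.adv, ·) (N.answer b)).wp Φ) fun x =>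
        freshAnswer U N n ek (cutTo q) (x.1.cl j) (fun c => ψ (c, x.2)) x.1 := by
  obtain ⟨φ, rfl, hφ⟩ := h
  have e1 := fun φ => wp_qswap_traceOut (injective_party_block Party.adv 0)
    (e := (Party.adv, block 2 3)) (by simp) 1 φ
  have e2 := fun φ => wp_reset_visible_traceOutKeep (injective_party_block Party.adv 0)
    (e := (Party.adv, block 2 3)) (by simp) 1 φ
  simp (disch := simp) only [nceFresh_eq, Prog.wp_seq, e1, wp_copy_traceOut, wp_cut_traceOut, e2,
    wp_pair_traceOutKeep, wp_call₃, wp_call₃_keep, wp_call₁]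
  refine ⟨_, rfl, fun z hz => ?_⟩
  obtain ⟨h₀, h₁, h₂, h₃, h₄, h₅, h₆⟩ := id hz
  simp only [freshAnswer]
  simp [setReg_apply, h₀, h₁, h₂, h₃]
  refine congrArg (ev _) (funext fun g => congrArg (ev _) (funext fun t => congrArg (ev _) (funext fun w => ?_)))
  refine replace_replace_eq hφ (fun x => setReg (setReg x (Party.adv, block 0 1) [])
    (Party.adv, block 0 1) (pairCode (x (Party.adv, block 2 3)) (x (Party.adv, 1)))) ?_ ?_ ?_
  · simp [NceStored, setReg_apply, *]
  · simp [slotState, setReg_apply]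
  · intro r
    simp [setReg_apply]
    split_ifs <;> rfl

theorem nceChallenge_eq (U : UTSKE) (G : NCEQuery → Prog (Party × ℕ) Empty) (β : Bool) :
    (nceChallenge U β).subst (Party.adv, ·) G =
      Prog.call (fun r => (Party.adv, block 2 r)) U.enc
        [(0, (.adv, 0)), (1, (.adv, block 5 0)), (2, (.adv, block 0 (msgReg β)))] ;;
      .instr (.reset {(.adv, block 0 1)}) ;;
      .instr (.pair (.adv, block 0 1) (.adv, block 2 3) (.adv, block 5 1)) ;;
      .instr (.qswap (.adv, block 0 1) (.adv, block 2 3)) := by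
  simp only [nceChallenge, deliver, Prog.subst, Prog.subst_call, Instr.map, Set.image_singleton]
  rfl

theorem nceChallenge_agree (U : UTSKE) (G : NCEQuery → Prog (Party × ℕ) Empty) (β : Bool) (n : ℕ)
    (ek sk ct dk q : List Bool)
    {Φ : Cfg (Party × ℕ) → ℂ} {ψ : Cfg ℕ × List Bool × Bool → ℂ}
    (h : Agree innerReg (NceStored n ek sk ct dk q) slotState Φ ψ) :
    Agree innerReg (NceStored n ek sk ct dk q) slotState
      (((nceChallenge U β).subst (Party.adv, ·) G).wp Φ) fun x =>
        keyedAnswer U n sk ct id (x.1.cl (msgReg β)) (fun c => ψ (c, x.2)) x.1 := by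
  obtain ⟨φ, rfl, hφ⟩ := h
  have e1 := fun φ => wp_qswap_traceOut (injective_party_block Party.adv 0)
    (e := (Party.adv, block 2 3)) (by simp) 1 φ
  have e2 := fun φ => wp_reset_visible_traceOutKeep (injective_party_block Party.adv 0)
    (e := (Party.adv, block 2 3)) (by simp) 1 φ
  simp (disch := simp) only [nceChallenge_eq, Prog.wp_seq, e1, e2, wp_pair_traceOutKeep,
    wp_call₃_keep]
  refine ⟨_, rfl, fun z hz => ?_⟩
  obtain ⟨h₀, h₁, h₂, h₃, h₄, h₅, h₆⟩ := id hz
  simp only [keyedAnswer]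
  simp [setReg_apply, h₂, h₄]
  refine congrArg (ev _) (funext fun w => ?_)
  refine replace_replace_eq hφ (fun x => setReg (setReg x (Party.adv, block 0 1) [])
    (Party.adv, block 0 1) (pairCode (x (Party.adv, block 2 3)) (x (Party.adv, block 5 1)))) ?_ ?_ ?_
  · simp [NceStored, setReg_apply, *]
  · simp [slotState, setReg_apply]
  · intro r
    simp [setReg_apply, h₅]
    split_ifs <;> rfl

theorem nceOracle_agree (U : UTSKE) (N : SKNCER) (b β : Bool) (n : ℕ) (ek sk ct dk q : List Bool)
    {Φ : Cfg (Party × ℕ) → ℂ} {ψ : Cfg ℕ × List Bool × Bool → ℂ}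
    (h : Agree innerReg (NceStored n ek sk ct dk q) slotState Φ ψ) :
    Agree innerReg (NceStored n ek sk ct dk q) slotState
      (((slotted (nceFresh U) (nceChallenge U β)).subst (Party.adv, ·) (N.answer b)).wp Φ)
      (eagerOracle U N n ek sk ct (cutTo q) id β ψ) :=
  agree_slotted (by simp [NceStored, setReg_apply]) (by simp [NceStored, setReg_apply])
    (fun j => nceFresh_agree U N b n j ek sk ct dk q h)
    (nceChallenge_agree U (N.answer b) β n ek sk ct dk q h)

theorem nceAdversary_eq (U : UTSKE) (N : SKNCER) (A : Prog ℕ Unit) (B : Prog ℕ Empty) (c k : ℕ)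
    (b β : Bool) :
    N.game (nceAdversary U A B c k β) b =
      Prog.call (fun r => (Party.gen, r)) N.kg [(0, (.main, 0))] ;;
      Prog.copy (.main, 1) (.gen, 3) ;;
      Prog.copy (.main, 2) (.gen, 4) ;;
      Prog.copy (.adv, 0) (.main, 0) ;;
      Prog.call (fun r => (Party.adv, block 3 r)) (sampler c k) [(0, (.adv, 0))] ;;
      Prog.call (fun r => (Party.adv, block 1 r)) U.gen [(0, (.adv, 0))] ;;
      Prog.copy (.adv, block 5 0) (.adv, block 1 3) ;; Prog.copy (.adv, 3) (.adv, block 1 3) ;;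
      N.answer b .challenge ;;
      .instr (.cut (.adv, 1) (.adv, block 3 4)) ;; .instr (.cut (.adv, 2) (.adv, block 3 4)) ;;
      Prog.copy (.adv, block 5 1) (.adv, 1) ;; Prog.copy (.adv, block 5 2) (.adv, 2) ;;
      Prog.copy (.adv, block 0 0) (.adv, 0) ;;
      A.subst innerReg (fun _ =>
        (slotted (nceFresh U) (nceChallenge U β)).subst (Party.adv, ·) (N.answer b)) ;;
      Prog.call (fun r => (Party.adv, block 4 r)) B
        [(0, (.adv, 0)), (1, (.adv, block 0 3)), (2, (.adv, block 5 2))] ;;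
      Prog.copy (.adv, 3) (.adv, block 4 3) := by
  simp only [SKNCER.game, nceAdversary, Prog.subst, Prog.subst_call, Prog.subst_subst, Instr.map]
  rfl

/-- What the adversary against the non-committing scheme does after the challenge query. -/
theorem nceStage_agree (U : UTSKE) (N : SKNCER) (A : Prog ℕ Unit) (B : Prog ℕ Empty) (n : ℕ)
    (b β : Bool) :
    ∃ φ, (A.subst innerReg (fun _ =>
          (slotted (nceFresh U) (nceChallenge U β)).subst (Party.adv, ·) (N.answer b))).wp
        ((Prog.call (fun r => (Party.adv, block 4 r)) B
          [(0, (.adv, 0)), (1, (.adv, block 0 3)), (2, (.adv, block 5 2))]).wp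
          ((Prog.copy (.adv, 3) (.adv, block 4 3) : Prog _ Empty).wp
            (traceOut innerReg fun z => open Classical in
              if z.ket = z.bra ∧ (z.cl (Party.adv, 3)).head? = some true then 1 else 0))) =
        traceOut innerReg φ ∧
      ∀ (p : List Bool × List Bool × List Bool × List Bool × List Bool) (z : View (Party × ℕ) ℕ),
        NceStored n p.1 p.2.1 p.2.2.1 p.2.2.2.1 p.2.2.2.2 z.cl →
          φ z = A.transform Prod.fst (fun x w => (w, x.2))
            (fun _ => eagerOracle U N n p.1 p.2.1 p.2.2.1 (cutTo p.2.2.2.2) id β)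
            (fun x => finish B n p.2.2.2.1 x.1) (z.get innerReg, slotState z.cl) := by
  classical
  refine Agree.exists_uniform (injective_party_block _ _) fun p => ?_
  obtain ⟨ek, sk, ct, dk, q⟩ := p
  refine Agree.subst (injective_party_block _ _) ?_ ?_
    (fun _ _ _ h => nceOracle_agree U N b β n ek sk ct dk q h) A ?_
  · rintro x w h
    simpa [NceStored] using h
  · intro x w
    simp [slotState]
  · simp (disch := simp) only [wp_call₃, wp_copy_traceOut]
    refine ⟨_, rfl, ?_⟩
    rintro z ⟨h₀, h₁, h₂, h₃, h₄, h₅, h₆⟩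
    simp only [h₂, h₆, finish, View.get, Function.comp, setReg_self]
    by_cases h : z.ket = z.bra
    · simp [h]
    · simp only [h, false_and, if_false, ev_zero_right]

/-- The game of `nceAdversary` with a genuine challenge ciphertext and the genuine decryption key. -/
theorem nceAdversary_winProb_false (U : UTSKE) (N : SKNCER) (A : Prog ℕ Unit) (B : Prog ℕ Empty)
    (c k : ℕ) (β : Bool) (n : ℕ) : N.winProb (nceAdversary U A B c k β) false n =
      (ev (N.kg.outC (ones n) [] []) fun g => ev ((sampler c k).outC (ones n) [] []) fun s =>
        ev (U.gen.outC (ones n) [] []) fun u => ev (N.enc.outC (ones n) (g 3) (u 3)) fun t =>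
          runStage A n (fun _ => eagerOracle U N n (g 3) (u 3) (cutTo (s 4) (t 3)) (cutTo (s 4)) id β)
            (fun x => finish B n (cutTo (s 4) (g 4)) x.1) (s 3, false)).re := by
  classical
  obtain ⟨φ, hφ, hφ'⟩ := nceStage_agree U N A B n false β
  rw [SKNCER.winProb, acceptProb_eq _ _ _ innerReg, nceAdversary_eq]
  simp only [Prog.wp_seq, hφ, SKNCER.answer, if_false, Bool.false_eq_true]
  simp (disch := simp) only [wp_copy_traceOut, wp_cut_traceOut, wp_call₁, wp_call₃, traceOut_init]
  rw [gameInput_main]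
  refine congrArg Complex.re (congrArg (ev _) (funext fun g => ?_))
  simp [setReg_apply, gameInput_main]
  refine congrArg (ev _) (funext fun s => congrArg (ev _) (funext fun u =>
    congrArg (ev _) (funext fun t => ?_)))
  rw [hφ' (g 3, u 3, cutTo (s 4) (t 3), cutTo (s 4) (g 4), s 4) _ ?_]
  · refine congrArg _ (Prod.ext ?_ ?_)
    · simp only [View.get, inputCfg, Cfg.mk.injEq, and_true]
      funext r
      by_cases hr : r = 0 <;>
        simp [setReg_apply, inputStore, gameInput_of_ne, hr]
    · simp [slotState, setReg_apply, gameInput_of_ne]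
  · simp [NceStored, setReg_apply, gameInput_main]

/-- The game of `nceAdversary` with a fake challenge ciphertext and a revealed decryption key. -/
theorem nceAdversary_winProb_true (U : UTSKE) (N : SKNCER) (A : Prog ℕ Unit) (B : Prog ℕ Empty)
    (c k : ℕ) (β : Bool) (n : ℕ) : N.winProb (nceAdversary U A B c k β) true n =
      (ev (N.kg.outC (ones n) [] []) fun g => ev ((sampler c k).outC (ones n) [] []) fun s =>
        ev (U.gen.outC (ones n) [] []) fun u => ev (N.fake.outC (ones n) (g 3) []) fun t =>
          ev (N.reveal.outC (ones n) (t 4) (u 3)) fun r =>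
          runStage A n (fun _ => eagerOracle U N n (g 3) (u 3) (cutTo (s 4) (t 3)) (cutTo (s 4)) id β)
            (fun x => finish B n (cutTo (s 4) (r 3)) x.1) (s 3, false)).re := by
  classical
  obtain ⟨φ, hφ, hφ'⟩ := nceStage_agree U N A B n true β
  rw [SKNCER.winProb, acceptProb_eq _ _ _ innerReg, nceAdversary_eq]
  simp only [Prog.wp_seq, hφ, SKNCER.answer, if_true]
  simp (disch := simp) only [wp_copy_traceOut, wp_cut_traceOut, wp_call₁, wp_call₂, wp_call₃,
    traceOut_init]
  rw [gameInput_main]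
  refine congrArg Complex.re (congrArg (ev _) (funext fun g => ?_))
  simp [setReg_apply, gameInput_main]
  refine congrArg (ev _) (funext fun s => congrArg (ev _) (funext fun u =>
    congrArg (ev _) (funext fun t => congrArg (ev _) (funext fun r => ?_))))
  rw [hφ' (g 3, u 3, cutTo (s 4) (t 3), cutTo (s 4) (r 3), s 4) _ ?_]
  · refine congrArg _ (Prod.ext ?_ ?_)
    · simp only [View.get, inputCfg, Cfg.mk.injEq, and_true]
      funext r
      by_cases hr : r = 0 <;>
        simp [setReg_apply, inputStore, gameInput_of_ne, hr]
    · simp [slotState, setReg_apply, gameInput_of_ne]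
  · simp [NceStored, setReg_apply, gameInput_main]

/-- The memory in the game of `uteAdversary`. -/
def UteStored (n : ℕ) (ek st ct sk q : List Bool) (x : Store (Party × ℕ)) : Prop :=
  x (.main, 0) = ones n ∧ x (.main, 1) = sk ∧ x (.main, 2) = sk ∧ x (.adv, 0) = ones n ∧
    x (.adv, block 3 4) = q ∧ x (.adv, block 6 3) = ek ∧ x (.adv, block 7 3) = ct ∧
    x (.adv, block 7 4) = st

theorem uteFresh_eq (U : UTSKE) (N : SKNCER) (G : Unit → Prog (Party × ℕ) Empty) (j : ℕ) :
    (uteFresh U N j).subst (Party.adv, ·) G =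
      Prog.call (fun r => (Party.adv, block 1 r)) U.gen [(0, (.adv, 0))] ;;
      Prog.call (fun r => (Party.adv, block 8 r)) N.enc
        [(0, (.adv, 0)), (1, (.adv, block 6 3)), (2, (.adv, block 1 3))] ;;
      Prog.call (fun r => (Party.adv, block 2 r)) U.enc
        [(0, (.adv, 0)), (1, (.adv, block 1 3)), (2, (.adv, block 0 j))] ;;
      .instr (.reset {(.adv, block 0 1)}) ;;
      .instr (.pair (.adv, block 0 1) (.adv, block 2 3) (.adv, block 8 3)) ;;
      .instr (.qswap (.adv, block 0 1) (.adv, block 2 3)) := by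
  simp only [uteFresh, deliver, Prog.subst, Prog.subst_call, Instr.map, Set.image_singleton]
  rfl

theorem uteFresh_agree (U : UTSKE) (N : SKNCER) (G : Unit → Prog (Party × ℕ) Empty) (n j : ℕ)
    (ek st ct sk q : List Bool)
    {Φ : Cfg (Party × ℕ) → ℂ} {ψ : Cfg ℕ × List Bool × Bool → ℂ}
    (h : Agree innerReg (UteStored n ek st ct sk q) slotState Φ ψ) :
    Agree innerReg (UteStored n ek st ct sk q) slotState
      (((uteFresh U N j).subst (Party.adv, ·) G).wp Φ) fun x =>
        freshAnswer U N n ek id (x.1.cl j) (fun c => ψ (c, x.2)) x.1 := by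
  obtain ⟨φ, rfl, hφ⟩ := h
  have e1 := fun φ => wp_qswap_traceOut (injective_party_block Party.adv 0)
    (e := (Party.adv, block 2 3)) (by simp) 1 φ
  have e2 := fun φ => wp_reset_visible_traceOutKeep (injective_party_block Party.adv 0)
    (e := (Party.adv, block 2 3)) (by simp) 1 φ
  simp (disch := simp) only [uteFresh_eq, Prog.wp_seq, e1, e2, wp_pair_traceOutKeep, wp_call₃,
    wp_call₃_keep, wp_call₁]
  refine ⟨_, rfl, fun z hz => ?_⟩
  obtain ⟨h₀, h₁, h₂, h₃, h₄, h₅, h₆, h₇⟩ := id hz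
  simp only [freshAnswer]
  simp [setReg_apply, h₃, h₅]
  refine congrArg (ev _) (funext fun g => congrArg (ev _) (funext fun t =>
    congrArg (ev _) (funext fun w => ?_)))
  refine replace_replace_eq hφ (fun x => setReg (setReg x (Party.adv, block 0 1) [])
    (Party.adv, block 0 1) (pairCode (x (Party.adv, block 2 3)) (x (Party.adv, block 8 3)))) ?_ ?_ ?_
  · simp [UteStored, setReg_apply, *]
  · simp [slotState, setReg_apply]
  · intro r
    simp [setReg_apply]
    split_ifs <;> rfl

theorem uteChallenge_eq (U : UTSKE) (b : Bool) :
    uteChallenge.subst (Party.adv, ·) (fun _ => U.toSplit.challenge b) =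
      Prog.copy (.adv, 3) (.adv, block 0 3) ;; Prog.copy (.adv, 4) (.adv, block 0 4) ;;
      (Prog.call (fun r => (Party.enc, r)) U.enc
          [(0, (.main, 0)), (1, (.main, 1)), (2, (.adv, msgReg b))] ;;
        .instr (.reset {(.adv, 1)}) ;;
        Prog.copy (.adv, 1) (.enc, 3) ;;
        .instr (.qswap (.adv, 1) (.enc, 3))) ;;
      .instr (.cut (.adv, 1) (.adv, block 3 4)) ;;
      .instr (.reset {(.adv, block 0 1)}) ;;
      .instr (.pair (.adv, block 0 1) (.adv, 1) (.adv, block 7 3)) ;;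
      .instr (.qswap (.adv, block 0 1) (.adv, 1)) := by
  simp only [uteChallenge, Prog.subst, Instr.map, Set.image_singleton]
  rfl

theorem uteChallenge_agree (U : UTSKE) (b : Bool) (n : ℕ) (ek st ct sk q : List Bool)
    {Φ : Cfg (Party × ℕ) → ℂ} {ψ : Cfg ℕ × List Bool × Bool → ℂ}
    (h : Agree innerReg (UteStored n ek st ct sk q) slotState Φ ψ) :
    Agree innerReg (UteStored n ek st ct sk q) slotState
      ((uteChallenge.subst (Party.adv, ·) (fun _ => U.toSplit.challenge b)).wp Φ) fun x =>
        keyedAnswer U n sk ct (cutTo q) (x.1.cl (msgReg b)) (fun c => ψ (c, x.2)) x.1 := by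
  obtain ⟨φ, rfl, hφ⟩ := h
  have e1 := fun φ => wp_qswap_traceOut (injective_party_block Party.adv 0)
    (e := (Party.adv, 1)) (by simp) 1 φ
  have e2 := fun φ => wp_reset_visible_traceOutKeep (injective_party_block Party.adv 0)
    (e := (Party.adv, 1)) (by simp) 1 φ
  have e3 := fun φ => wp_qswap_traceOutKeep (v := fun r => (Party.adv, block 0 r))
    (d := (Party.adv, 1)) (e := (Party.enc, 3)) (by simp) (by simp) φ
  have e4 := fun φ => wp_reset_traceOutKeep (v := fun r => (Party.adv, block 0 r))
    (s := (Party.adv, 1)) (e := (Party.enc, 3)) (by simp) (by simp) φ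
  simp (disch := simp) only [uteChallenge_eq, Prog.wp_seq, e1, e2, e3, e4, wp_pair_traceOutKeep,
    wp_cut_traceOutKeep, wp_copy_traceOutKeep, wp_copy_traceOut, wp_call₃_keep]
  refine ⟨_, rfl, fun z hz => ?_⟩
  obtain ⟨h₀, h₁, h₂, h₃, h₄, h₅, h₆, h₇⟩ := id hz
  have hm : (if b = true then z.cl (Party.adv, block 0 4) else if b = false then
      z.cl (Party.adv, block 0 3) else z.cl (Party.adv, msgReg b)) =
        (View.get innerReg z).cl (msgReg b) := by
    cases b <;> rfl
  simp only [keyedAnswer]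
  simp [setReg_apply, h₀, h₁]
  rw [hm]
  refine congrArg (ev _) (funext fun w => ?_)
  refine replace_replace_eq hφ (fun x => setReg (setReg x (Party.adv, block 0 1) [])
    (Party.adv, block 0 1) (pairCode (x (Party.adv, 1)) (x (Party.adv, block 7 3)))) ?_ ?_ ?_
  · simp [UteStored, setReg_apply, *]
  · simp [slotState, setReg_apply]
  · intro r
    simp [setReg_apply, h₄, h₆]
    split_ifs <;> rfl

theorem uteOracle_agree (U : UTSKE) (N : SKNCER) (b : Bool) (n : ℕ) (ek st ct sk q : List Bool)
    {Φ : Cfg (Party × ℕ) → ℂ} {ψ : Cfg ℕ × List Bool × Bool → ℂ}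
    (h : Agree innerReg (UteStored n ek st ct sk q) slotState Φ ψ) :
    Agree innerReg (UteStored n ek st ct sk q) slotState
      (((slotted (uteFresh U N) uteChallenge).subst (Party.adv, ·)
        (fun _ => U.toSplit.challenge b)).wp Φ)
      (eagerOracle U N n ek sk ct id (cutTo q) b ψ) :=
  agree_slotted (by simp [UteStored, setReg_apply]) (by simp [UteStored, setReg_apply])
    (fun j => uteFresh_agree U N _ n j ek st ct sk q h)
    (uteChallenge_agree U b n ek st ct sk q h)

theorem uteAdversary_eq (U : UTSKE) (N : SKNCER) (A : Prog ℕ Unit) (B : Prog ℕ Empty) (c k : ℕ)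
    (b : Bool) :
    U.toSplit.game (uteAdversary U N A c k) (uteDistinguisher N B) b =
      Prog.call (fun r => (Party.gen, r)) U.toSplit.gen [(0, (.main, 0))] ;;
      Prog.copy (.main, 1) (.gen, 3) ;;
      Prog.copy (.main, 2) (.gen, 4) ;;
      Prog.copy (.adv, 0) (.main, 0) ;;
      (Prog.call (fun r => (Party.adv, block 3 r)) (sampler c k) [(0, (.adv, 0))] ;;
        Prog.call (fun r => (Party.adv, block 6 r)) N.kg [(0, (.adv, 0))] ;;
        Prog.call (fun r => (Party.adv, block 7 r)) N.fake [(0, (.adv, 0)), (1, (.adv, block 6 3))] ;;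
        Prog.copy (.adv, block 0 0) (.adv, 0) ;;
        A.subst innerReg (fun _ => (slotted (uteFresh U N) uteChallenge).subst (Party.adv, ·)
          (fun _ => U.toSplit.challenge b)) ;;
        .instr (.pair (.adv, 3) (.adv, block 0 3) (.adv, block 7 4))) ;;
      Prog.load (Party.dist, ·) [(0, (.main, 0)), (1, (.adv, 3)), (2, (.main, 2))] ;;
      .instr (.unpair (.dist, block 0 0) (.dist, block 0 1) (.dist, 1)) ;;
      Prog.call (fun r => (Party.dist, block 1 r)) N.reveal
        [(0, (.dist, 0)), (1, (.dist, block 0 1)), (2, (.dist, 2))] ;;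
      Prog.call (fun r => (Party.dist, block 2 r)) B
        [(0, (.dist, 0)), (1, (.dist, block 0 0)), (2, (.dist, block 1 3))] ;;
      Prog.copy (.dist, 3) (.dist, block 2 3) := by
  have hd : ∀ p args, (Prog.call (Party.dist, ·) p args : Prog (Party × ℕ) Empty) =
    Prog.load (Party.dist, ·) args ;; p.place (Party.dist, ·) := fun _ _ => rfl
  simp only [SplitUTSKE.game, uteAdversary, uteDistinguisher, Prog.subst, Prog.subst_call,
    Prog.subst_subst, Instr.map]
  rw [hd, Prog.place]
  simp only [Prog.subst, Prog.subst_call]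
  rfl

/-- The second-stage adversary against the single-key scheme, in terms of channels. -/
def finishReveal (N : SKNCER) (B : Prog ℕ Empty) (n : ℕ) (st sk : List Bool) (c : Cfg ℕ) : ℂ :=
  ev (N.reveal.outC (ones n) st sk) fun r => finish B n (r 3) c

/-- What the adversaries against the single-key scheme do after the preparations. -/
theorem uteStage_agree (U : UTSKE) (N : SKNCER) (A : Prog ℕ Unit) (B : Prog ℕ Empty) (n : ℕ)
    (b : Bool) :
    ∃ φ, (A.subst innerReg (fun _ => (slotted (uteFresh U N) uteChallenge).subst (Party.adv, ·)
          (fun _ => U.toSplit.challenge b))).wp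
        ((Prog.instr (.pair (.adv, 3) (.adv, block 0 3) (.adv, block 7 4))).wp
          ((Prog.load (Party.dist, ·) [(0, (.main, 0)), (1, (.adv, 3)), (2, (.main, 2))]).wp
          ((Prog.instr (.unpair (.dist, block 0 0) (.dist, block 0 1) (.dist, 1))).wp
          ((Prog.call (fun r => (Party.dist, block 1 r)) N.reveal
            [(0, (.dist, 0)), (1, (.dist, block 0 1)), (2, (.dist, 2))]).wp
          ((Prog.call (fun r => (Party.dist, block 2 r)) B
            [(0, (.dist, 0)), (1, (.dist, block 0 0)), (2, (.dist, block 1 3))]).wp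
          ((Prog.copy (.dist, 3) (.dist, block 2 3) : Prog _ Empty).wp
            (traceOut innerReg fun z => open Classical in
              if z.ket = z.bra ∧ (z.cl (Party.dist, 3)).head? = some true then 1 else 0))))))) =
        traceOut innerReg φ ∧
      ∀ (p : List Bool × List Bool × List Bool × List Bool × List Bool) (z : View (Party × ℕ) ℕ),
        UteStored n p.1 p.2.1 p.2.2.1 p.2.2.2.1 p.2.2.2.2 z.cl →
          φ z = A.transform Prod.fst (fun x w => (w, x.2))
            (fun _ => eagerOracle U N n p.1 p.2.2.2.1 p.2.2.1 id (cutTo p.2.2.2.2) b)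
            (fun x => finishReveal N B n p.2.1 p.2.2.2.1 x.1) (z.get innerReg, slotState z.cl) := by
  classical
  refine Agree.exists_uniform (injective_party_block _ _) fun p => ?_
  obtain ⟨ek, st, ct, sk, q⟩ := p
  refine Agree.subst (injective_party_block _ _) ?_ ?_
    (fun _ _ _ h => uteOracle_agree U N b n ek st ct sk q h) A ?_
  · rintro x w h
    simpa [UteStored] using h
  · intro x w
    simp [slotState]
  · simp (disch := simp) only [wp_call₃, wp_load₃, wp_pair_traceOut, wp_unpair_traceOut,
      wp_copy_traceOut]
    refine ⟨_, rfl, ?_⟩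
    rintro z ⟨h₀, h₁, h₂, h₃, h₄, h₅, h₆, h₇⟩
    simp [setReg_apply, inputStore, unpairCode_pairCode, h₀, h₂, h₇, finishReveal]
    refine congrArg (ev _) (funext fun r => ?_)
    by_cases h : z.ket = z.bra
    · simp [h, finish, View.get]
    · simp [h, finish, View.get, ev_zero_right]

theorem toSplit_gen_outC (U : UTSKE) (n : ℕ) (φ : Store ℕ → ℂ) :
    ev (U.toSplit.gen.outC (ones n) [] []) φ =
      ev (U.gen.outC (ones n) [] []) fun u => φ (setReg u 4 (u 3)) := by
  rw [Prog.ev_outC, Prog.ev_outC, UTSKE.toSplit, Prog.wp_seq]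
  congr 1
  funext w
  simp [Prog.copy, Prog.wp_instr, Instr.eval, setReg]

/-- Up to truncations and the order of sampling, this is the game of `nceAdversary` with a fake
challenge ciphertext, with the challenge bit in the place of `β`. -/
theorem uteAdversary_winProb (U : UTSKE) (N : SKNCER) (A : Prog ℕ Unit) (B : Prog ℕ Empty)
    (c k : ℕ) (b : Bool) (n : ℕ) :
    U.toSplit.winProb (uteAdversary U N A c k) (uteDistinguisher N B) b n =
      (ev (U.gen.outC (ones n) [] []) fun u => ev ((sampler c k).outC (ones n) [] []) fun s =>
        ev (N.kg.outC (ones n) [] []) fun g => ev (N.fake.outC (ones n) (g 3) []) fun t =>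
          runStage A n (fun _ => eagerOracle U N n (g 3) (u 3) (t 3) id (cutTo (s 4)) b)
            (fun x => finishReveal N B n (t 4) (u 3) x.1) (s 3, false)).re := by
  classical
  obtain ⟨φ, hφ, hφ'⟩ := uteStage_agree U N A B n b
  rw [SplitUTSKE.winProb, acceptProb_eq _ _ _ innerReg, uteAdversary_eq]
  simp only [Prog.wp_seq, hφ]
  simp (disch := simp) only [wp_copy_traceOut, wp_call₁, wp_call₂, traceOut_init]
  rw [gameInput_main, toSplit_gen_outC]
  refine congrArg Complex.re (congrArg (ev _) (funext fun u => ?_))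
  simp [setReg_apply, gameInput_main]
  refine congrArg (ev _) (funext fun s => congrArg (ev _) (funext fun g =>
    congrArg (ev _) (funext fun t => ?_)))
  rw [hφ' (g 3, t 4, t 3, u 3, s 4) _ ?_]
  · refine congrArg _ (Prod.ext ?_ ?_)
    · simp only [View.get, inputCfg, Cfg.mk.injEq, and_true]
      funext r
      by_cases hr : r = 0 <;>
        simp [setReg_apply, inputStore, gameInput_of_ne, hr]
    · simp [slotState, setReg_apply, gameInput_of_ne]
  · simp [UteStored, setReg_apply, gameInput_main]

/-! ### The hybrid argument -/

theorem deliverTo_ev {α : Type*} (d : α →₀ ℂ) (s k l : List Bool) (ψ : α → Cfg ℕ → ℂ) (c : Cfg ℕ) :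
    deliverTo s k l (fun c => ev d fun a => ψ a c) c = ev d fun a => deliverTo s k l (ψ a) c := by
  unfold deliverTo
  split_ifs
  · rfl
  · rw [ev_zero_right]

theorem freshAnswer_ev {α : Type*} (d : α →₀ ℂ) (U : UTSKE) (N : SKNCER) (n : ℕ) (ek : List Bool)
    (κ : List Bool → List Bool) (m : List Bool) (ψ : α → Cfg ℕ → ℂ) (c : Cfg ℕ) :
    freshAnswer U N n ek κ m (fun c => ev d fun a => ψ a c) c =
      ev d fun a => freshAnswer U N n ek κ m (ψ a) c := by
  simp only [freshAnswer, deliverTo_ev]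
  rw [ev_comm d]
  refine congrArg (ev _) (funext fun g => ?_)
  rw [ev_comm d]
  refine congrArg (ev _) (funext fun t => ?_)
  rw [ev_comm d]

theorem keyedAnswer_ev {α : Type*} (d : α →₀ ℂ) (U : UTSKE) (n : ℕ) (sk ct : List Bool)
    (κ : List Bool → List Bool) (m : List Bool) (ψ : α → Cfg ℕ → ℂ) (c : Cfg ℕ) :
    keyedAnswer U n sk ct κ m (fun c => ev d fun a => ψ a c) c =
      ev d fun a => keyedAnswer U n sk ct κ m (ψ a) c := by
  simp only [keyedAnswer, deliverTo_ev]
  rw [ev_comm d]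

theorem eagerOracle_ev {α : Type*} (d : α →₀ ℂ) (U : UTSKE) (N : SKNCER) (n : ℕ)
    (ek sk ct : List Bool) (κ₁ κ₂ : List Bool → List Bool) (β : Bool)
    (φ : α → Cfg ℕ × List Bool × Bool → ℂ) (x : Cfg ℕ × List Bool × Bool) :
    eagerOracle U N n ek sk ct κ₁ κ₂ β (fun x => ev d fun a => φ a x) x =
      ev d fun a => eagerOracle U N n ek sk ct κ₁ κ₂ β (φ a) x := by
  unfold eagerOracle
  split_ifs
  · exact freshAnswer_ev ..
  · exact freshAnswer_ev ..
  · exact keyedAnswer_ev ..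

section family

variable {R O I X Y : Type}

/-- A family of interpretations of a program, as one interpretation with the index in the state. -/
theorem Prog.transform_family {get : X → Cfg R} {set : X → Cfg R → X}
    (G : I → O → (X → ℂ) → X → ℂ) (A : Prog R O) (φ : I → X → ℂ) (x : X) (i : I) :
    A.transform (fun y : X × I => get y.1) (fun y w => (set y.1 w, y.2))
        (fun o ψ y => G y.2 o (fun x => ψ (x, y.2)) y.1) (fun y => φ y.2 y.1) (x, i) =
      A.transform get set (G i) (φ i) x :=
  Prog.transform_rel (fun (ψ : X × I → ℂ) φ => ∀ x, ψ (x, i) = φ x)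
    (fun j ψ φ h x => by simp only [h]) (fun o ψ φ h x => by simp only [h])
    (fun r Φ Ψ h x => h _ x) A (fun x => rfl) x

/-- A linear interpretation of a program commutes with expectations. -/
theorem Prog.transform_ev {α : Type} {get : X → Cfg R} {set : X → Cfg R → X}
    {G : O → (X → ℂ) → X → ℂ} (d : α →₀ ℂ)
    (hG : ∀ o (φ : α → X → ℂ) x, G o (fun x => ev d fun a => φ a x) x = ev d fun a => G o (φ a) x)
    (A : Prog R O) (φ : α → X → ℂ) (x : X) :
    A.transform get set G (fun x => ev d fun a => φ a x) x =
      ev d fun a => A.transform get set G (φ a) x := by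
  simp only [← Prog.transform_family (fun _ : α => G) A φ]
  refine Prog.transform_rel (get₁ := get) (set₁ := set) (G₁ := G) (get₂ := fun y : X × α => get y.1)
    (set₂ := fun y w => (set y.1 w, y.2)) (G₂ := fun o ψ y => G o (fun x => ψ (x, y.2)) y.1)
    (fun (ψ : X → ℂ) (Φ : X × α → ℂ) => ∀ x, ψ x = ev d fun a => Φ (x, a))
    ?_ ?_ ?_ A (ψ := fun y => φ y.2 y.1) (fun x => rfl) x
  · intro i ψ Φ h x
    simp only [h]
    exact ev_comm ..
  · intro o ψ Φ h x
    rw [funext h, hG]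
  · intro r Φ Ψ h x
    exact h ((get x).cl r) x

end family

section hybrids

variable (U : UTSKE) (N : SKNCER) (A : Prog ℕ Unit) (B : Prog ℕ Empty) (n : ℕ)

/-- The first hybrid is the game with the challenge bit `0`. -/
theorem runStage_hybrid_zero (ek : List Bool) (φ : Cfg ℕ → ℂ) :
    runStage A n (fun _ => hybridOracle U N n ek) (fun x => φ x.1) 0 =
      runStage A n (fun _ => plainOracle U N n ek false) (fun x => φ x.1) () := by
  refine Prog.transform_rel (fun (φ : Cfg ℕ × ℕ → ℂ) (ψ : Cfg ℕ × Unit → ℂ) =>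
    ∀ c, φ (c, 0) = ψ (c, ())) (fun i φ ψ h c => by simp only [h]) ?_ (fun r Φ Ψ h c => h _ c) A
    (fun c => rfl) _
  intro _ φ ψ h c
  simp only [hybridOracle, plainOracle, h, lt_self_iff_false, if_false]
  rfl

/-- The hybrid with at least as many encryptions of `m₁` as there are queries is the game with the
challenge bit `1`. -/
theorem runStage_hybrid_of_calls_le (ek : List Bool) (φ : Cfg ℕ → ℂ) (i : ℕ)
    (hi : ∀ o ∈ A.paths {1, 2} (inputCfg (ones n) [] []).point, o.calls.length ≤ i) :
    runStage A n (fun _ => hybridOracle U N n ek) (fun x => φ x.1) i =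
      runStage A n (fun _ => plainOracle U N n ek true) (fun x => φ x.1) () := by
  have h1 : runStage A n (fun _ => hybridOracle U N n ek) (fun x => φ x.1) i =
      runStage A n (fun _ ψ x => freshAnswer U N n ek id (x.1.cl 4) (fun c => ψ (c, x.2 - 1)) x.1)
        (fun x => φ x.1) i := by
    refine Prog.transform_congr_paths (get := fun x : Cfg ℕ × ℕ => x.1)
      (set := fun x w => (w, x.2)) (fun _ _ => rfl) {1, 2} (fun l (x : Cfg ℕ × ℕ) => x.2 = i - l.length)
      (fun l => l.length ≤ i) (fun l l' h => by simp only [List.length_append] at h; omega)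
      (fun l x w j hx _ => hx) ?_ A [] _ _ _ (by simp) (fun o ho => by simpa using hi o ho)
      (fun _ _ _ _ _ => rfl)
    intro _ l x φ φ' hW hK hφ
    simp only [List.length_append, List.length_singleton] at hW hφ
    rw [hybridOracle, if_pos (by omega)]
    simp only [freshAnswer, deliverTo]
    refine congrArg (ev _) (funext fun g => congrArg (ev _) (funext fun t =>
      congrArg (ev _) (funext fun w => if_congr Iff.rfl (hφ _ ?_ ?_) rfl)))
    · intro r hr
      have : r ≠ 1 := fun h => hr (by simp [h])
      exact ⟨setReg_of_ne _ _ this, setReg_of_ne _ _ this⟩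
    · simp only; omega
  rw [h1]
  refine Prog.transform_rel (fun (φ : Cfg ℕ × ℕ → ℂ) (ψ : Cfg ℕ × Unit → ℂ) =>
    ∀ c k, φ (c, k) = ψ (c, ())) (fun i φ ψ h c k => by simp only [h]) ?_
    (fun r Φ Ψ h c k => h _ c k) A (fun c k => rfl) _ _
  intro _ φ ψ h c k
  simp only [plainOracle, h]
  rfl

/-- Fixing the one-time key and the ciphertext of the distinguished query in advance makes no
difference. -/
theorem eager_eq_hybrid (ek : List Bool) (β : Bool) (φ : Cfg ℕ → ℂ) (i : ℕ) :
    (ev (U.gen.outC (ones n) [] []) fun u => ev (N.enc.outC (ones n) ek (u 3)) fun t =>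
      runStage A n (fun _ => eagerOracle U N n ek (u 3) (t 3) id id β) (fun x => φ x.1)
        (ones i, false)) =
      runStage A n (fun _ => hybridOracle U N n ek) (fun x => φ x.1) (i + β.toNat) := by
  have hf := fun (sk ct : List Bool) => Prog.transform_family
    (get := fun x : Cfg ℕ × List Bool × Bool => x.1) (set := fun x w => (w, x.2))
    (fun (p : List Bool × List Bool) (_ : Unit) => eagerOracle U N n ek p.1 p.2 id id β) A
    (fun _ x => φ x.1) (inputCfg (ones n) [] [], ones i, false) (sk, ct)
  unfold runStage
  simp only [← hf]
  -- Until the distinguished query the expectation over the key and the ciphertext is that of the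
  -- hybrid; afterwards neither is used any more, whatever they are.
  have key := Prog.transform_rel
    (get₁ := fun y : (Cfg ℕ × List Bool × Bool) × List Bool × List Bool => y.1.1)
    (set₁ := fun y w => ((w, y.1.2), y.2))
    (G₁ := fun (_ : Unit) ψ y => eagerOracle U N n ek y.2.1 y.2.2 id id β (fun x => ψ (x, y.2)) y.1)
    (get₂ := fun x : Cfg ℕ × ℕ => x.1) (set₂ := fun x w => (w, x.2))
    (G₂ := fun _ => hybridOracle U N n ek)
    (fun (φ : (Cfg ℕ × List Bool × Bool) × List Bool × List Bool → ℂ) (ψ : Cfg ℕ × ℕ → ℂ) =>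
      (∀ c k, (ev (U.gen.outC (ones n) [] []) fun u => ev (N.enc.outC (ones n) ek (u 3)) fun t =>
        φ ((c, ones k, false), u 3, t 3)) = ψ (c, k + β.toNat)) ∧
      ∀ c p, φ ((c, [], true), p) = ψ (c, 0)) ?_ ?_ ?_ A
      (φ := fun y => φ y.1.1) (ψ := fun x => φ x.1) ?_
  · exact key.1 _ i
  · rintro j φ ψ ⟨h₁, h₂⟩
    refine ⟨fun c k => ?_, fun c p => by simp only [h₂]⟩
    simp only [← h₁]
    rw [ev_comm]
    refine congrArg (ev _) (funext fun u => ?_)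
    rw [ev_comm]
  · rintro _ φ ψ ⟨h₁, h₂⟩
    refine ⟨fun c k => ?_, fun c p => ?_⟩
    · rcases k with _ | k
      -- The distinguished query consumes the key and the ciphertext, like a fresh encryption.
      · have hψ : hybridOracle U N n ek ψ (c, 0 + β.toNat) =
            freshAnswer U N n ek id (c.cl (msgReg β)) (fun c => ψ (c, 0)) c := by
          cases β <;> simp [hybridOracle] <;> rfl
        rw [hψ]
        have h0 : ¬ (ones 0).head? = some true := by simp [ones]
        simp only [eagerOracle, if_neg h0, Bool.false_eq_true, if_false]
        simp only [show ones 0 = [] from rfl, h₂]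
        rfl
      · have hψ : hybridOracle U N n ek ψ (c, k + 1 + β.toNat) =
            freshAnswer U N n ek id (c.cl 4) (fun c => ψ (c, k + β.toNat)) c := by
          simp only [hybridOracle]
          rw [if_pos (by omega)]
          simp only [show k + 1 + β.toNat - 1 = k + β.toNat by omega]
        rw [hψ]
        simp only [eagerOracle, if_pos ((head?_ones (k + 1)).2 k.succ_pos), tail_ones,
          Nat.add_sub_cancel, ← h₁]
        simp only [freshAnswer_ev]
    · simp only [eagerOracle, hybridOracle, h₂]
      simp
  · rintro r Φ Ψ h
    exact ⟨fun c => (h (c.cl r)).1 c, fun c => (h (c.cl r)).2 c⟩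
  · exact ⟨fun c k => by simp only [Prog.ev_outC_const], fun c p => rfl⟩

end hybrids

/-! ### Truncations that have no effect -/

/-- On classical inputs of length at most `s`, the running time and the lengths of the classical
outputs are at most `t`. -/
def Prog.BoundedBy (p : Prog ℕ Empty) (n s t : ℕ) : Prop :=
  ∀ x y : List Bool, x.length ≤ s → y.length ≤ s →
    ∀ o ∈ p.paths ∅ (inputCfg (ones n) x y).point,
      o.time ≤ t ∧ ∀ r, (o.final.cl r).length ≤ t

/-- Bounds for the games with security parameter `n`: `S` for the lengths of the keys and the messages,
`T` for the lengths of the fake ciphertexts and their states, and `Q` for all lengths and running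
times. -/
structure SizeBounds (U : UTSKE) (N : SKNCER) (A : Prog ℕ Unit) (n S T Q : ℕ) : Prop where
  gen : U.gen.BoundedBy n 0 S
  kg : N.kg.BoundedBy n 0 S
  fake : N.fake.BoundedBy n S T
  uenc : U.enc.BoundedBy n S Q
  nenc : N.enc.BoundedBy n S Q
  reveal : N.reveal.BoundedBy n T Q
  le₁ : S ≤ T
  le₂ : T ≤ Q
  calls : ∀ o ∈ A.paths {1, 2} (inputCfg (ones n) [] []).point, o.time ≤ Q ∧ o.calls.length ≤ Q ∧
    (o.final.cl 3).length ≤ Q ∧ ∀ e ∈ o.calls, (e.2 3).length ≤ S ∧ (e.2 4).length ≤ S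

theorem cutTo_eq {q t : List Bool} (h : t.length ≤ q.length) : cutTo q t = t :=
  List.take_of_length_le h

section

variable {U : UTSKE} {N : SKNCER} {A : Prog ℕ Unit} {n S T Q : ℕ}

theorem freshAnswer_cut (h : SizeBounds U N A n S T Q) {ek q : List Bool} (hek : ek.length ≤ S)
    (hq : Q ≤ q.length) (m : List Bool) (ψ : Cfg ℕ → ℂ) :
    freshAnswer U N n ek (cutTo q) m ψ = freshAnswer U N n ek id m ψ := by
  funext c
  refine Prog.ev_outC_congr _ fun o ho => Prog.ev_outC_congr _ fun o' ho' => ?_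
  rw [cutTo_eq (((h.nenc _ _ hek ((h.gen _ _ le_rfl le_rfl o ho).2 3) o' ho').2 3).trans hq)]
  rfl

theorem keyedAnswer_cut (h : SizeBounds U N A n S T Q) {sk ct q m : List Bool}
    (hsk : sk.length ≤ S) (hm : m.length ≤ S) (hq : Q ≤ q.length) (ψ : Cfg ℕ → ℂ) (c : Cfg ℕ) :
    keyedAnswer U n sk ct (cutTo q) m ψ c = keyedAnswer U n sk ct id m ψ c := by
  refine Prog.ev_outQ_congr _ fun o ho k l => ?_
  simp only
  rw [cutTo_eq (((h.uenc _ _ hsk hm o ho).2 3).trans hq)]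
  rfl

/-- The truncation of the oracle's answers has no effect when these are genuine. -/
theorem runStage_eager_cut₁ (h : SizeBounds U N A n S T Q) {ek q : List Bool}
    (hek : ek.length ≤ S) (hq : Q ≤ q.length) (sk ct : List Bool) (β : Bool)
    (φ : Cfg ℕ × List Bool × Bool → ℂ) (v : List Bool × Bool) :
    runStage A n (fun _ => eagerOracle U N n ek sk ct (cutTo q) id β) φ v =
      runStage A n (fun _ => eagerOracle U N n ek sk ct id id β) φ v := by
  have hG : eagerOracle U N n ek sk ct (cutTo q) id β = eagerOracle U N n ek sk ct id id β := by
    funext φ x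
    simp only [eagerOracle, freshAnswer_cut h hek hq]
  rw [hG]

/-- The truncation of the challenge ciphertext has no effect. The lengths of the messages matter
here, hence the bound on the queries along all computation paths. -/
theorem runStage_eager_cut₂ (h : SizeBounds U N A n S T Q) {sk q : List Bool}
    (hsk : sk.length ≤ S) (hq : Q ≤ q.length) (ek ct : List Bool) (β : Bool)
    (φ : Cfg ℕ × List Bool × Bool → ℂ) (v : List Bool × Bool) :
    runStage A n (fun _ => eagerOracle U N n ek sk ct id (cutTo q) β) φ v =
      runStage A n (fun _ => eagerOracle U N n ek sk ct id id β) φ v := by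
  have hc := h.calls
  refine Prog.transform_congr_paths (get := fun x : Cfg ℕ × List Bool × Bool => x.1)
    (set := fun x w => (w, x.2)) (fun _ _ => rfl) {1, 2} (fun _ _ => True)
    (fun l => ∀ e ∈ l, (e.2 3).length ≤ S ∧ (e.2 4).length ≤ S)
    (fun l l' hl e he => hl e (List.mem_append_left _ he)) (fun _ _ _ _ _ _ => trivial) ?_ A []
    _ _ _ trivial (fun o ho => (hc o ho).2.2.2) (fun _ _ _ _ _ => rfl)
  intro _ l x φ φ' hW _ hφ
  have hφ' : ∀ s k l' v, deliverTo s k l' (fun c => φ (c, v)) x.1 =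
      deliverTo s k l' (fun c => φ' (c, v)) x.1 := by
    intro s k l' v
    unfold deliverTo
    refine if_congr Iff.rfl (hφ _ (fun r hr => ?_) trivial) rfl
    have : r ≠ 1 := fun h => hr (by simp [h])
    exact ⟨setReg_of_ne _ _ this, setReg_of_ne _ _ this⟩
  have hm : (x.1.cl (msgReg β)).length ≤ S := by
    have := hW (_, x.1.cl) (List.mem_append_right _ (List.mem_singleton_self _))
    cases β
    · exact this.1
    · exact this.2
  unfold eagerOracle
  rw [keyedAnswer_cut h hsk hm hq]
  simp only [freshAnswer, keyedAnswer, hφ']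

end

/-! ### The games of the reductions and the hybrids -/

section

variable {U : UTSKE} {N : SKNCER} {A : Prog ℕ Unit} {B : Prog ℕ Empty} {n S T c k : ℕ}

/-- The expected value of the hybrid in which the first `i` queries are answered by encryptions of
`m₁`. -/
def hybridValue (U : UTSKE) (N : SKNCER) (A : Prog ℕ Unit) (B : Prog ℕ Empty) (n i : ℕ) : ℂ :=
  ev (N.kg.outC (ones n) [] []) fun g => runStage A n (fun _ => hybridOracle U N n (g 3))
    (fun x => finish B n (g 4) x.1) i

/-- The expected value of the common game of the two reductions, in which the distinguished query
uses a fake ciphertext. -/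
def fakeValue (U : UTSKE) (N : SKNCER) (A : Prog ℕ Unit) (B : Prog ℕ Empty) (n i : ℕ) (β : Bool) :
    ℂ :=
  ev (U.gen.outC (ones n) [] []) fun u => ev (N.kg.outC (ones n) [] []) fun g =>
    ev (N.fake.outC (ones n) (g 3) []) fun t =>
      runStage A n (fun _ => eagerOracle U N n (g 3) (u 3) (t 3) id id β)
        (fun x => finishReveal N B n (t 4) (u 3) x.1) (ones i, false)

/-- Average over the indices from which the sampler chooses. -/
def average (Q : ℕ) (F : ℕ → ℂ) : ℂ :=
  (samplerRange Q : ℂ)⁻¹ * ∑ i ∈ Finset.range (samplerRange Q), F i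

theorem ev_average {α : Type*} (d : α →₀ ℂ) (Q : ℕ) (F : α → ℕ → ℂ) :
    (ev d fun a => average Q (F a)) = average Q fun i => ev d fun a => F a i := by
  simp only [average]
  simp only [mul_comm (samplerRange Q : ℂ)⁻¹]
  rw [ev_mul_const, ev_sum_right]

theorem ev_sampler (c k n : ℕ) (ψ : List Bool → List Bool → ℂ) :
    (ev ((sampler c k).outC (ones n) [] []) fun w => ψ (w 3) (w 4)) =
      average ((n + c) ^ k) fun i => ψ (ones i) (ones ((n + c) ^ k)) :=
  sampler_ev c k n ψ

/-- With a genuine challenge, `nceAdversary` averages over the hybrids. -/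
theorem nceAdversary_winProb_false_eq (h : SizeBounds U N A n S T ((n + c) ^ k))
    (β : Bool) : N.winProb (nceAdversary U A B c k β) false n =
      (average ((n + c) ^ k) fun i => hybridValue U N A B n (i + β.toNat)).re := by
  rw [nceAdversary_winProb_false]
  refine congrArg Complex.re ?_
  simp only [hybridValue]
  rw [← ev_average]
  refine Prog.ev_outC_congr _ fun o ho => ?_
  obtain ⟨-, hr⟩ := h.kg _ _ le_rfl le_rfl o ho
  have h₃ := hr 3
  have h₄ := hr 4
  rw [ev_sampler c k n fun s₃ s₄ => ev (U.gen.outC (ones n) [] []) fun u =>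
    ev (N.enc.outC (ones n) (o.final.cl 3) (u 3)) fun t => runStage A n
      (fun _ => eagerOracle U N n (o.final.cl 3) (u 3) (cutTo s₄ (t 3)) (cutTo s₄) id β)
      (fun x => finish B n (cutTo s₄ (o.final.cl 4)) x.1) (s₃, false)]
  refine congrArg _ (funext fun i => ?_)
  rw [← eager_eq_hybrid]
  have hq : (n + c) ^ k ≤ (ones ((n + c) ^ k)).length := by simp [ones]
  rw [cutTo_eq ((h₄.trans (h.le₁.trans h.le₂)).trans hq)]
  refine Prog.ev_outC_congr _ fun o₁ ho₁ => Prog.ev_outC_congr _ fun o₂ ho₂ => ?_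
  rw [runStage_eager_cut₁ h h₃ hq,
    cutTo_eq (((h.nenc _ _ h₃ ((h.gen _ _ le_rfl le_rfl o₁ ho₁).2 3) o₂ ho₂).2 3).trans hq)]

theorem runStage_finishReveal (U : UTSKE) (N : SKNCER) (A : Prog ℕ Unit)
    (n : ℕ) (ek sk ct st : List Bool) (β : Bool) (v : List Bool × Bool) :
    runStage A n (fun _ => eagerOracle U N n ek sk ct id id β)
        (fun x => finishReveal N B n st sk x.1) v =
      ev (N.reveal.outC (ones n) st sk) fun r =>
        runStage A n (fun _ => eagerOracle U N n ek sk ct id id β)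
          (fun x => finish B n (r 3) x.1) v :=
  Prog.transform_ev (get := fun x : Cfg ℕ × List Bool × Bool => x.1)
    (set := fun x w => (w, x.2)) (N.reveal.outC (ones n) st sk)
    (fun _ φ x => eagerOracle_ev _ U N n ek sk ct id id β φ x) A
    (fun r x => finish B n (r 3) x.1) _

/-- With a fake challenge, `nceAdversary` averages over the games with a fake ciphertext. -/
theorem nceAdversary_winProb_true_eq (h : SizeBounds U N A n S T ((n + c) ^ k))
    (β : Bool) : N.winProb (nceAdversary U A B c k β) true n =
      (average ((n + c) ^ k) fun i => fakeValue U N A B n i β).re := by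
  rw [nceAdversary_winProb_true]
  refine congrArg Complex.re ?_
  simp only [fakeValue]
  have hcomm : ∀ i, (ev (U.gen.outC (ones n) [] []) fun u => ev (N.kg.outC (ones n) [] []) fun g =>
      ev (N.fake.outC (ones n) (g 3) []) fun t =>
        runStage A n (fun _ => eagerOracle U N n (g 3) (u 3) (t 3) id id β)
          (fun x => finishReveal N B n (t 4) (u 3) x.1) (ones i, false)) =
      ev (N.kg.outC (ones n) [] []) fun g => ev (U.gen.outC (ones n) [] []) fun u =>
      ev (N.fake.outC (ones n) (g 3) []) fun t =>
        runStage A n (fun _ => eagerOracle U N n (g 3) (u 3) (t 3) id id β)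
          (fun x => finishReveal N B n (t 4) (u 3) x.1) (ones i, false) := fun i => ev_comm ..
  simp only [hcomm]
  rw [← ev_average]
  refine Prog.ev_outC_congr _ fun o ho => ?_
  obtain ⟨-, hr⟩ := h.kg _ _ le_rfl le_rfl o ho
  have h₃ := hr 3
  have h₄ := hr 4
  rw [ev_sampler c k n fun s₃ s₄ => ev (U.gen.outC (ones n) [] []) fun u =>
    ev (N.fake.outC (ones n) (o.final.cl 3) []) fun t =>
    ev (N.reveal.outC (ones n) (t 4) (u 3)) fun r => runStage A n
      (fun _ => eagerOracle U N n (o.final.cl 3) (u 3) (cutTo s₄ (t 3)) (cutTo s₄) id β)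
      (fun x => finish B n (cutTo s₄ (r 3)) x.1) (s₃, false)]
  refine congrArg _ (funext fun i => ?_)
  have hq : (n + c) ^ k ≤ (ones ((n + c) ^ k)).length := by simp [ones]
  refine Prog.ev_outC_congr _ fun o₁ ho₁ => Prog.ev_outC_congr _ fun o₂ ho₂ => ?_
  obtain ⟨-, hr'⟩ := h.fake _ _ h₃ (Nat.zero_le _) o₂ ho₂
  have h₅ := hr' 3
  have h₆ := hr' 4
  have h₇ := ((h.gen _ _ le_rfl le_rfl o₁ ho₁).2 3).trans h.le₁
  rw [runStage_finishReveal]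
  refine Prog.ev_outC_congr _ fun o₃ ho₃ => ?_
  rw [runStage_eager_cut₁ h h₃ hq, cutTo_eq ((h₅.trans h.le₂).trans hq),
    cutTo_eq (((h.reveal _ _ h₆ h₇ o₃ ho₃).2 3).trans hq)]

/-- `uteAdversary` averages over the same games with a fake ciphertext, with its own challenge bit in the
place of `β`. -/
theorem uteAdversary_winProb_eq (h : SizeBounds U N A n S T ((n + c) ^ k))
    (b : Bool) : U.toSplit.winProb (uteAdversary U N A c k) (uteDistinguisher N B) b n =
      (average ((n + c) ^ k) fun i => fakeValue U N A B n i b).re := by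
  rw [uteAdversary_winProb]
  refine congrArg Complex.re ?_
  simp only [fakeValue]
  rw [← ev_average]
  refine Prog.ev_outC_congr _ fun o₁ ho₁ => ?_
  rw [ev_sampler c k n fun s₃ s₄ => ev (N.kg.outC (ones n) [] []) fun g =>
    ev (N.fake.outC (ones n) (g 3) []) fun t => runStage A n
      (fun _ => eagerOracle U N n (g 3) (o₁.final.cl 3) (t 3) id (cutTo s₄) b)
      (fun x => finishReveal N B n (t 4) (o₁.final.cl 3) x.1) (s₃, false)]
  have hq : (n + c) ^ k ≤ (ones ((n + c) ^ k)).length := by simp [ones]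
  simp only [runStage_eager_cut₂ h ((h.gen _ _ le_rfl le_rfl o₁ ho₁).2 3) hq]

theorem crUTE_winProb_false_eq (U : UTSKE) (N : SKNCER) (A : Prog ℕ Unit)
    (n : ℕ) : (crUTE U N).winProb A B false n = (hybridValue U N A B n 0).re := by
  rw [crUTE_winProb]
  exact congrArg Complex.re (congrArg (ev _) (funext fun g =>
    (runStage_hybrid_zero U N A n (g 3) (finish B n (g 4))).symm))

theorem crUTE_winProb_true_eq (B : Prog ℕ Empty) (i : ℕ)
    (hi : ∀ o ∈ A.paths {1, 2} (inputCfg (ones n) [] []).point, o.calls.length ≤ i) :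
    (crUTE U N).winProb A B true n = (hybridValue U N A B n i).re := by
  rw [crUTE_winProb]
  exact congrArg Complex.re (congrArg (ev _) (funext fun g =>
    (runStage_hybrid_of_calls_le U N A n (g 3) (finish B n (g 4)) i hi).symm))

/-- The advantage against the collusion-resistant scheme is that of the reductions, up to the number
of hybrids. -/
theorem crUTE_advantage (h : SizeBounds U N A n S T ((n + c) ^ k)) :
    (crUTE U N).winProb A B false n - (crUTE U N).winProb A B true n =
      samplerRange ((n + c) ^ k) *
        ((N.winProb (nceAdversary U A B c k false) false n -
            N.winProb (nceAdversary U A B c k false) true n) +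
          (U.toSplit.winProb (uteAdversary U N A c k) (uteDistinguisher N B) false n -
            U.toSplit.winProb (uteAdversary U N A c k) (uteDistinguisher N B) true n) -
          (N.winProb (nceAdversary U A B c k true) false n -
            N.winProb (nceAdversary U A B c k true) true n)) := by
  have hD := (samplerRange_spec ((n + c) ^ k)).1
  rw [crUTE_winProb_false_eq, crUTE_winProb_true_eq B (samplerRange ((n + c) ^ k))
      fun o ho => (h.calls o ho).2.1.trans hD.le]
  simp only [nceAdversary_winProb_false_eq h, nceAdversary_winProb_true_eq h,
    uteAdversary_winProb_eq h]
  have hD0 : (samplerRange ((n + c) ^ k) : ℂ) ≠ 0 := by exact_mod_cast (by omega : _ ≠ 0)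
  -- The averages over the hybrids `i` and `i + 1` telescope.
  have key : hybridValue U N A B n 0 - hybridValue U N A B n (samplerRange ((n + c) ^ k)) =
      samplerRange ((n + c) ^ k) *
        ((average ((n + c) ^ k) fun i => hybridValue U N A B n (i + false.toNat)) -
          average ((n + c) ^ k) fun i => hybridValue U N A B n (i + true.toNat)) := by
    simp only [average, ← mul_sub, ← Finset.sum_sub_distrib, Bool.toNat_false, Bool.toNat_true,
      add_zero, Finset.sum_range_sub']
    rw [← mul_assoc, mul_inv_cancel₀ hD0, one_mul]
  rw [← Complex.sub_re, key, ← Complex.ofReal_natCast, Complex.re_ofReal_mul, Complex.sub_re]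
  ring

end

/-! ### Computation paths of straight-line programs -/

section ensures

variable {R S O : Type}

/-- The final configuration, the running time and the list of oracle calls of every computation path
satisfy `Φ`. -/
def Prog.Ensures (ans : Set R) (p : Prog R O) (m : Point R)
    (Φ : Point R → ℕ → List (O × Store R) → Prop) : Prop :=
  ∀ o ∈ p.paths ans m, Φ o.final o.time o.calls

variable {ans : Set R} {m : Point R} {Φ Ψ : Point R → ℕ → List (O × Store R) → Prop}

theorem Prog.Ensures.mono {p : Prog R O} (h : p.Ensures ans m Φ) (hΦ : ∀ m t l, Φ m t l → Ψ m t l) :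
    p.Ensures ans m Ψ := fun o ho => hΦ _ _ _ (h o ho)

theorem Prog.ensures_seq (p q : Prog R O) : (p ;; q).Ensures ans m Φ ↔
    p.Ensures ans m fun m' t l => q.Ensures ans m' fun m'' t' l' => Φ m'' (t + t') (l ++ l') := by
  constructor
  · intro h o₁ h₁ o₂ h₂
    exact h _ ⟨o₁, h₁, o₂, h₂, rfl⟩
  · rintro h _ ⟨o₁, h₁, o₂, h₂, rfl⟩
    exact h o₁ h₁ o₂ h₂

theorem Prog.ensures_instr {i : Instr R} {m' : Point R}
    (h : i.eval ⟨m.cl, m.q, m.q⟩ = Finsupp.single ⟨m'.cl, m'.q, m'.q⟩ 1) :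
    (Prog.instr i : Prog R O).Ensures ans m Φ ↔ Φ m' (i.cost m) [] := by
  classical
  constructor
  · intro hΦ
    refine hΦ ⟨m', i.cost m, []⟩ ⟨?_, rfl, rfl⟩
    rw [h, Finsupp.single_eq_same]; exact one_ne_zero
  · rintro hΦ ⟨⟨a, b⟩, t, l⟩ ⟨h₁, h₂, h₃⟩
    rw [h, Finsupp.single_apply] at h₁
    simp only at h₂ h₃
    split_ifs at h₁ with h'
    · simp only [Cfg.mk.injEq] at h'
      obtain ⟨rfl, rfl, -⟩ := h'
      rw [h₂, h₃]; exact hΦ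
    · exact absurd rfl h₁

theorem Prog.ensures_copy (r s : R) : (Prog.copy r s : Prog R O).Ensures ans m Φ ↔
    Φ ⟨setReg m.cl r (m.cl s), m.q⟩ (1 + (m.cl s).length) [] :=
  Prog.ensures_instr (m' := ⟨setReg m.cl r (m.cl s), m.q⟩) rfl

theorem Prog.ensures_push (b : Bool) (r : R) : (Prog.instr (.push b r) : Prog R O).Ensures ans m Φ ↔
    Φ ⟨setReg m.cl r (b :: m.cl r), m.q⟩ 1 [] :=
  Prog.ensures_instr (m' := ⟨setReg m.cl r (b :: m.cl r), m.q⟩) rfl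

theorem Prog.ensures_pop (r : R) : (Prog.instr (.pop r) : Prog R O).Ensures ans m Φ ↔
    Φ ⟨setReg m.cl r (m.cl r).tail, m.q⟩ 1 [] :=
  Prog.ensures_instr (m' := ⟨setReg m.cl r (m.cl r).tail, m.q⟩) rfl

theorem Prog.ensures_cut (r s : R) : (Prog.instr (.cut r s) : Prog R O).Ensures ans m Φ ↔
    Φ ⟨setReg m.cl r ((m.cl r).take (m.cl s).length), m.q⟩ (1 + (m.cl s).length) [] :=
  Prog.ensures_instr (m' := ⟨setReg m.cl r ((m.cl r).take (m.cl s).length), m.q⟩) rfl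

theorem Prog.ensures_pair (r s t : R) : (Prog.instr (.pair r s t) : Prog R O).Ensures ans m Φ ↔
    Φ ⟨setReg m.cl r (pairCode (m.cl s) (m.cl t)), m.q⟩
      (1 + (m.cl s).length + (m.cl t).length) [] :=
  Prog.ensures_instr (m' := ⟨setReg m.cl r (pairCode (m.cl s) (m.cl t)), m.q⟩) rfl

theorem Prog.ensures_unpair (r s t : R) : (Prog.instr (.unpair r s t) : Prog R O).Ensures ans m Φ ↔
    Φ ⟨setReg (setReg m.cl r (unpairCode (m.cl t)).1) s (unpairCode (m.cl t)).2, m.q⟩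
      (1 + (m.cl t).length) [] :=
  Prog.ensures_instr (m' :=
    ⟨setReg (setReg m.cl r (unpairCode (m.cl t)).1) s (unpairCode (m.cl t)).2, m.q⟩) rfl

theorem Prog.ensures_qswap (r s : R) : (Prog.instr (.qswap r s) : Prog R O).Ensures ans m Φ ↔
    Φ ⟨m.cl, open Classical in m.q ∘ Equiv.swap r s⟩ 1 [] := by
  classical
  refine Prog.ensures_instr (m' := ⟨m.cl, m.q ∘ Equiv.swap r s⟩) ?_
  rw [Instr.eval, Cfg.conjugate_single]

theorem Prog.ensures_reset_singleton (s : R) :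
    (Prog.instr (.reset {s}) : Prog R O).Ensures ans m Φ ↔
      Φ ⟨setReg m.cl s [], setReg m.q s []⟩ 1 [] := by
  classical
  refine Prog.ensures_instr (m' := ⟨setReg m.cl s [], setReg m.q s []⟩) ?_
  rw [Instr.eval_reset_of_forall fun _ _ => rfl]
  have hu : ∀ x : Store R, (fun r => if r ∈ ({s} : Set R) then [] else x r) = setReg x s [] := by
    intro x; funext t
    simp [setReg_apply]
  simp only [hu]

theorem Prog.ensures_reset_range (g : ℕ → R) :
    (Prog.instr (.reset (Set.range g)) : Prog R O).Ensures ans m Φ ↔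
      Φ (m.overlay g ⟨fun _ => [], fun _ => []⟩) 1 [] := by
  classical
  refine Prog.ensures_instr (m' := m.overlay g ⟨fun _ => [], fun _ => []⟩) ?_
  rw [Instr.eval_reset_of_forall fun _ _ => rfl]
  have hu : ∀ x : Store R, (fun r => if r ∈ Set.range g then [] else x r) =
      Function.extend g (fun _ => []) x := by
    intro x; funext s
    by_cases h : ∃ k, g k = s
    · rw [if_pos (show s ∈ Set.range g from h)]; unfold Function.extend; rw [dif_pos h]
    · rw [if_neg (show s ∉ Set.range g from h), Function.extend_apply' _ _ _ h]
  simp only [hu, Point.overlay]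

theorem Prog.ensures_ite (r : R) (p q : Prog R O) : (Prog.ite r p q).Ensures ans m Φ ↔
    if (m.cl r).head? = some true then p.Ensures ans m fun m t l => Φ m (1 + t) l
    else q.Ensures ans m fun m t l => Φ m (1 + t) l := by
  have : (Prog.ite r p q).Ensures ans m Φ ↔ ∀ o ∈ (if (m.cl r).head? = some true
      then p.paths ans m else q.paths ans m), Φ o.final (1 + o.time) o.calls := by
    constructor
    · intro h o ho
      refine h ⟨o.final, 1 + o.time, [] ++ o.calls⟩ ⟨⟨m, 1, []⟩, rfl, o, ?_, rfl⟩
      split_ifs at ho ⊢ <;> exact ho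
    · rintro h _ ⟨_, rfl, o, ho, rfl⟩
      refine h o ?_
      simp only at ho
      split_ifs at ho ⊢ <;> exact ho
  rw [this]
  split_ifs <;> rfl

theorem Prog.ensures_query (o : O) : (Prog.query o).Ensures ans m Φ ↔
    ∀ m' : Point R, (∀ r, r ∉ ans → m'.cl r = m.cl r ∧ m'.q r = m.q r) → Φ m' 1 [(o, m.cl)] := by
  constructor
  · intro h m' hm'
    exact h ⟨m', 1, [(o, m.cl)]⟩ ⟨hm', rfl, rfl⟩
  · rintro h ⟨m', t, l⟩ ⟨h₁, h₂, h₃⟩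
    simp only at h₂ h₃
    rw [h₂, h₃]; exact h m' h₁

theorem Point.overlay_overlay (f : S → R) (m : Point R) (w w' : Point S) :
    (m.overlay f w).overlay f w' = m.overlay f w' := by
  simp [Point.overlay, extend_extend]

theorem Point.restrict_overlay {f : S → R} (hf : f.Injective) (m : Point R) (w : Point S) :
    (m.overlay f w).restrict f = w := by
  cases w; simp [Point.overlay, Point.restrict, extend_comp_left hf]

variable {g : ℕ → R} {s₀ s₁ s₂ : R}

theorem setReg_extend (hg : g.Injective) (w : Store ℕ) (x : Store R) (k : ℕ) (v : List Bool) :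
    setReg (Function.extend g w x) (g k) v = Function.extend g (setReg w k v) x := by
  classical
  funext s
  by_cases h : ∃ k, g k = s
  · obtain ⟨j, rfl⟩ := h
    simp [setReg_apply, hg.extend_apply, hg.eq_iff]
  · rw [Function.extend_apply' _ _ _ h, setReg_of_ne _ _ (fun hs => h ⟨k, hs.symm⟩),
      Function.extend_apply' _ _ _ h]

theorem extend_of_ne (w : Store ℕ) (x : Store R) {s : R} (hs : ∀ k, g k ≠ s) :
    Function.extend g w x s = x s :=
  Function.extend_apply' _ _ _ fun ⟨k, hk⟩ => hs k hk

theorem Prog.ensures_load₁ (hg : g.Injective) (h₀ : ∀ k, g k ≠ s₀) :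
    (Prog.load g [(0, s₀)] : Prog R O).Ensures ans m Φ ↔
      Φ (m.overlay g (inputCfg (m.cl s₀) [] []).point) (2 + (m.cl s₀).length) [] := by
  simp only [Prog.load, List.foldl, Prog.ensures_seq, Prog.ensures_reset_range, Prog.ensures_copy,
    Point.overlay, setReg_extend hg, extend_of_ne _ _ h₀]
  have hs : setReg (fun _ => [] : Store ℕ) 0 (m.cl s₀) = inputStore (m.cl s₀) [] [] := by
    funext r; simp only [setReg_apply, inputStore]; split_ifs <;> rfl
  rw [hs, ← add_assoc]
  rfl

theorem Prog.ensures_load₂ (hg : g.Injective) (h₀ : ∀ k, g k ≠ s₀) (h₁ : ∀ k, g k ≠ s₁) :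
    (Prog.load g [(0, s₀), (1, s₁)] : Prog R O).Ensures ans m Φ ↔
      Φ (m.overlay g (inputCfg (m.cl s₀) (m.cl s₁) []).point)
        (3 + (m.cl s₀).length + (m.cl s₁).length) [] := by
  simp only [Prog.load, List.foldl, Prog.ensures_seq, Prog.ensures_reset_range, Prog.ensures_copy,
    Point.overlay, setReg_extend hg, extend_of_ne _ _ h₀, extend_of_ne _ _ h₁]
  have hs : setReg (setReg (fun _ => [] : Store ℕ) 0 (m.cl s₀)) 1 (m.cl s₁) =
      inputStore (m.cl s₀) (m.cl s₁) [] := by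
    funext r; simp only [setReg_apply, inputStore]; split_ifs <;> simp_all
  have ht : 1 + (1 + (m.cl s₀).length) + (1 + (m.cl s₁).length) =
      3 + (m.cl s₀).length + (m.cl s₁).length := by omega
  rw [hs, ht]
  rfl

theorem Prog.ensures_load₃ (hg : g.Injective) (h₀ : ∀ k, g k ≠ s₀) (h₁ : ∀ k, g k ≠ s₁)
    (h₂ : ∀ k, g k ≠ s₂) :
    (Prog.load g [(0, s₀), (1, s₁), (2, s₂)] : Prog R O).Ensures ans m Φ ↔
      Φ (m.overlay g (inputCfg (m.cl s₀) (m.cl s₁) (m.cl s₂)).point)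
        (4 + (m.cl s₀).length + (m.cl s₁).length + (m.cl s₂).length) [] := by
  simp only [Prog.load, List.foldl, Prog.ensures_seq, Prog.ensures_reset_range, Prog.ensures_copy,
    Point.overlay, setReg_extend hg, extend_of_ne _ _ h₀, extend_of_ne _ _ h₁, extend_of_ne _ _ h₂]
  have hs : setReg (setReg (setReg (fun _ => [] : Store ℕ) 0 (m.cl s₀)) 1 (m.cl s₁)) 2 (m.cl s₂) =
      inputStore (m.cl s₀) (m.cl s₁) (m.cl s₂) := by
    funext r; simp only [setReg_apply, inputStore]; split_ifs <;> simp_all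
  have ht : 1 + (1 + (m.cl s₀).length) + (1 + (m.cl s₁).length) + (1 + (m.cl s₂).length) =
      4 + (m.cl s₀).length + (m.cl s₁).length + (m.cl s₂).length := by omega
  rw [hs, ht]
  rfl

theorem Prog.ensures_place (hg : g.Injective) {p : Prog ℕ Empty}
    (h : ∀ u ∈ p.paths ∅ (m.restrict g), ∀ t ≤ u.time, Φ (m.overlay g u.final) t []) :
    (p.place g : Prog R O).Ensures ans m Φ := by
  intro w hw
  obtain ⟨hc, u, hu, hf, ht⟩ := Prog.mem_paths_place hg ans p m w hw
  rw [hc, hf]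
  exact h u hu _ ht

theorem Prog.ensures_call₁ (hg : g.Injective) (h₀ : ∀ k, g k ≠ s₀) {p : Prog ℕ Empty}
    (h : ∀ u ∈ p.paths ∅ (inputCfg (m.cl s₀) [] []).point, ∀ t ≤ 2 + (m.cl s₀).length + u.time,
      Φ (m.overlay g u.final) t []) :
    (Prog.call g p [(0, s₀)] : Prog R O).Ensures ans m Φ := by
  rw [Prog.call, Prog.ensures_seq, Prog.ensures_load₁ hg h₀]
  refine Prog.ensures_place hg fun u hu t ht => ?_
  rw [Point.restrict_overlay hg] at hu
  rw [Point.overlay_overlay]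
  exact h u hu _ (by omega)

theorem Prog.ensures_call₂ (hg : g.Injective) (h₀ : ∀ k, g k ≠ s₀) (h₁ : ∀ k, g k ≠ s₁)
    {p : Prog ℕ Empty}
    (h : ∀ u ∈ p.paths ∅ (inputCfg (m.cl s₀) (m.cl s₁) []).point,
      ∀ t ≤ 3 + (m.cl s₀).length + (m.cl s₁).length + u.time, Φ (m.overlay g u.final) t []) :
    (Prog.call g p [(0, s₀), (1, s₁)] : Prog R O).Ensures ans m Φ := by
  rw [Prog.call, Prog.ensures_seq, Prog.ensures_load₂ hg h₀ h₁]
  refine Prog.ensures_place hg fun u hu t ht => ?_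
  rw [Point.restrict_overlay hg] at hu
  rw [Point.overlay_overlay]
  exact h u hu _ (by omega)

theorem Prog.ensures_call₃ (hg : g.Injective) (h₀ : ∀ k, g k ≠ s₀) (h₁ : ∀ k, g k ≠ s₁)
    (h₂ : ∀ k, g k ≠ s₂) {p : Prog ℕ Empty}
    (h : ∀ u ∈ p.paths ∅ (inputCfg (m.cl s₀) (m.cl s₁) (m.cl s₂)).point,
      ∀ t ≤ 4 + (m.cl s₀).length + (m.cl s₁).length + (m.cl s₂).length + u.time,
        Φ (m.overlay g u.final) t []) :
    (Prog.call g p [(0, s₀), (1, s₁), (2, s₂)] : Prog R O).Ensures ans m Φ := by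
  rw [Prog.call, Prog.ensures_seq, Prog.ensures_load₃ hg h₀ h₁ h₂]
  refine Prog.ensures_place hg fun u hu t ht => ?_
  rw [Point.restrict_overlay hg] at hu
  rw [Point.overlay_overlay]
  exact h u hu _ (by omega)

end ensures

/-! ### The scheme runs in quantum polynomial time -/

open Polynomial in
theorem eval_mono_nat (f : ℕ[X]) {a b : ℕ} (h : a ≤ b) : f.eval a ≤ f.eval b := by
  rw [Polynomial.eval_eq_sum_range, Polynomial.eval_eq_sum_range]
  gcongr

@[simp] theorem extend_block (i j : ℕ) (w x : Store ℕ) (s : ℕ) :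
    Function.extend (block i) w x (block j s) = if j = i then w s else x (block j s) := by
  split_ifs with h
  · subst h; exact (block_injective j).extend_apply w x s
  · refine Function.extend_apply' _ _ _ fun ⟨r, hr⟩ => h ?_
    exact (block_eq_block.1 hr).1.symm

theorem length_ones (n : ℕ) : (ones n).length = n := List.length_replicate

/-- A polynomial bound for the running time and the lengths of the outputs in terms of a bound `z` for
the security parameter and the lengths of the inputs. -/
theorem Prog.IsQPT.exists_bound {p : Prog ℕ Empty} (hp : p.IsQPT) :
    ∃ f : Polynomial ℕ, ∀ (z n : ℕ) (x y u v : List Bool), n ≤ z → x.length ≤ z → y.length ≤ z →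
      u.length ≤ z → v.length ≤ z → ∀ o ∈ p.paths ∅ (inputPoint n x y u v),
        o.time ≤ f.eval z ∧ ∀ r, (o.final.cl r).length ≤ f.eval z := by
  obtain ⟨f, hf⟩ := hp
  refine ⟨.X + 2 * f.comp (5 * .X), fun z n x y u v hn hx hy hu hv o ho => ?_⟩
  simp only [Polynomial.eval_add, Polynomial.eval_X, Polynomial.eval_mul, Polynomial.eval_ofNat,
    Polynomial.eval_comp]
  have ht : o.time ≤ f.eval (5 * z) := (hf n x y u v o ho).trans (eval_mono_nat f (by omega))
  refine ⟨by omega, fun r => ?_⟩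
  have := (p.length_le_of_mem_paths ∅ z (inputPoint n x y u v) (fun r _ => ?_) o ho).1 r
    (Set.notMem_empty r)
  · omega
  · simp only [inputPoint]
    split_ifs <;> simp [hn, hx, hy]

theorem Prog.IsQPT.exists_boundedBy {p : Prog ℕ Empty} (hp : p.IsQPT) :
    ∃ f : Polynomial ℕ, ∀ z n s : ℕ, n ≤ z → s ≤ z → p.BoundedBy n s (f.eval z) := by
  obtain ⟨f, hf⟩ := hp.exists_bound
  refine ⟨f, fun z n s hn hs x y hx hy o ho => hf z n x y [] [] hn (hx.trans hs) (hy.trans hs)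
    (Nat.zero_le _) (Nat.zero_le _) o ?_⟩
  rw [inputPoint_eq]
  exact ho

theorem Prog.isQPT_of_ensures {p : Prog ℕ Empty} (f : Polynomial ℕ)
    (h : ∀ (z n : ℕ) (x y u v : List Bool), n + x.length + y.length + u.length + v.length = z →
      p.Ensures ∅ (inputPoint n x y u v) fun _ t _ => t ≤ f.eval z) : p.IsQPT :=
  ⟨f, fun n x y u v => h _ n x y u v rfl⟩

theorem crEnc_isQPT {U : UTSKE} {N : SKNCER} (hU : U.IsQPT) (hN : N.IsQPT) :
    (crEnc U N).IsQPT := by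
  obtain ⟨fg, hg⟩ := hU.1.exists_boundedBy
  obtain ⟨fu, hu⟩ := hU.2.1.exists_boundedBy
  obtain ⟨fn, hn⟩ := hN.2.1.exists_boundedBy
  refine Prog.isQPT_of_ensures (12 + 5 * .X + 3 * fg + 2 * fu.comp (.X + fg) + 2 * fn.comp (.X + fg))
    fun z n x y u v hz => ?_
  simp only [Polynomial.eval_add, Polynomial.eval_X, Polynomial.eval_mul, Polynomial.eval_ofNat,
    Polynomial.eval_comp]
  have h₀ : (inputPoint n x y u v).cl 0 = ones n := by simp [inputPoint, ones]
  have h₁ : (inputPoint n x y u v).cl 1 = x := by simp [inputPoint]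
  have h₂ : (inputPoint n x y u v).cl 2 = y := by simp [inputPoint]
  generalize inputPoint n x y u v = m at h₀ h₁ h₂ ⊢
  rw [crEnc, Prog.ensures_seq]
  refine Prog.ensures_call₁ (block_injective 0) (by simp) fun o₁ ho₁ t₁ ht₁ => ?_
  rw [Prog.ensures_seq]
  refine Prog.ensures_call₃ (block_injective 1) (by simp) (by simp) (by simp) fun o₂ ho₂ t₂ ht₂ => ?_
  rw [Prog.ensures_seq]
  refine Prog.ensures_call₃ (block_injective 2) (by simp) (by simp) (by simp) fun o₃ ho₃ t₃ ht₃ => ?_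
  simp [Point.overlay, h₀, h₁, h₂] at ho₁ ho₂ ho₃ ht₁ ht₂ ht₃
  simp [Prog.ensures_seq, Prog.ensures_pair, Prog.ensures_qswap, Point.overlay]
  obtain ⟨a₁, b₁⟩ := hg z n 0 (by omega) (by omega) [] [] le_rfl le_rfl o₁ ho₁
  have e : Function.extend (block 0) o₁.final.cl m.cl (block 0 3) = o₁.final.cl 3 := by simp
  obtain ⟨a₂, b₂⟩ := hu (z + fg.eval z) n _ (by omega) le_rfl _ _ ((b₁ 3).trans (by omega))
    (by omega) o₂ ho₂
  obtain ⟨a₃, b₃⟩ := hn (z + fg.eval z) n _ (by omega) le_rfl _ _ (by omega)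
    ((b₁ 3).trans (by omega)) o₃ ho₃
  have c₁ := b₁ 3
  have c₂ := b₂ 3
  have c₃ := b₃ 3
  omega

theorem crDec_isQPT {U : UTSKE} {N : SKNCER} (hU : U.IsQPT) (hN : N.IsQPT) :
    (crDec U N).IsQPT := by
  obtain ⟨fu, hu⟩ := hU.2.2.exists_bound
  obtain ⟨fn, hn⟩ := hN.2.2.1.exists_boundedBy
  refine Prog.isQPT_of_ensures (12 + 6 * .X + 2 * fn + 2 * fu.comp (.X + fn))
    fun z n x y u v hz => ?_
  simp only [Polynomial.eval_add, Polynomial.eval_X, Polynomial.eval_mul, Polynomial.eval_ofNat,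
    Polynomial.eval_comp]
  have h₀ : (inputPoint n x y u v).cl 0 = ones n := by simp [inputPoint, ones]
  have h₁ : (inputPoint n x y u v).cl 1 = x := by simp [inputPoint]
  have h₂ : (inputPoint n x y u v).cl 2 = y := by simp [inputPoint]
  have h₃ : (inputPoint n x y u v).q 2 = v := by simp [inputPoint]
  generalize inputPoint n x y u v = m at h₀ h₁ h₂ h₃ ⊢
  obtain ⟨e₁, e₂⟩ := length_unpairCode_le y
  rw [crDec, Prog.ensures_seq, Prog.ensures_unpair, Prog.ensures_seq]
  refine Prog.ensures_call₃ (block_injective 0) (by simp) (by simp) (by simp) fun o₁ ho₁ t₁ ht₁ => ?_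
  rw [Prog.ensures_seq, Prog.ensures_load₃ (block_injective 1) (by simp) (by simp) (by simp),
    Prog.ensures_seq, Prog.ensures_qswap, Prog.ensures_seq]
  refine Prog.ensures_place (block_injective 1) fun o₂ ho₂ t₂ ht₂ => ?_
  rw [Prog.ensures_copy]
  simp [Point.overlay, setReg_apply, h₀, h₁, h₂] at ho₁ ho₂ ht₁ ht₂ ⊢
  obtain ⟨a₁, b₁⟩ := hn z n z (by omega) le_rfl _ _ (by omega) (by omega) o₁ ho₁
  have c₁ := b₁ 3
  rw [show Point.restrict (block 1) _ = inputPoint n (o₁.final.cl 3) (unpairCode y).1 [] v from ?_]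
    at ho₂
  · obtain ⟨a₂, b₂⟩ := hu (z + fn.eval z) n _ _ _ _ (by omega) (by omega) (by omega) (Nat.zero_le _)
      (by omega) o₂ ho₂
    have c₂ := b₂ 3
    omega
  · simp only [Point.restrict, inputPoint, Point.mk.injEq, extend_comp_left (block_injective 1)]
    refine ⟨rfl, funext fun r => ?_⟩
    by_cases hr : r = 2
    · subst hr
      simp [h₃]
    · rw [Function.comp, Function.comp,
        @Equiv.swap_apply_of_ne_of_ne _ (_) _ _ _ (by simpa using hr) (by simp),
        (block_injective 1).extend_apply]
      simp [inputCfg, Cfg.point, hr]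

/-! ### The reductions run in quantum polynomial time -/

/-- The rule for running an oracle program `A` whose calls are answered by programs; see
`Prog.mem_paths_subst` for the invariant `I`, the bound `cost` and the relation `Good`. -/
theorem Prog.ensures_subst {R S O P : Type} {f : R → S} (hf : f.Injective) {h : O → Prog S P}
    (ans : Set R) {ans' : Set S} (I : List (P × Store S) → Point S → Prop) (cost : O × Store R → ℕ)
    (Good : O × Store R → P × Store S → Prop)
    (hI : ∀ l m m', (∀ s ∉ Set.range f, m'.cl s = m.cl s ∧ m'.q s = m.q s) → I l m → I l m')
    (hO : ∀ o l m, I l m → (h o).Ensures ans' m fun m' t l' => I (l ++ l') m' ∧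
      (∀ r ∉ ans, m'.cl (f r) = m.cl (f r) ∧ m'.q (f r) = m.q (f r)) ∧
      t ≤ cost (o, m.cl ∘ f) ∧ ∀ d ∈ l', Good (o, m.cl ∘ f) d) (A : Prog R O) {m : Point S}
    (hm : I [] m) {Φ : Point S → ℕ → List (P × Store S) → Prop}
    (hΦ : ∀ u ∈ A.paths ans (m.restrict f), ∀ m' t l, I l m' → m'.restrict f = u.final →
      t ≤ u.time + (u.calls.map cost).sum → (∀ d ∈ l, ∃ e ∈ u.calls, Good e d) → Φ m' t l) :
    (A.subst f h).Ensures ans' m Φ := by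
  intro w hw
  obtain ⟨h₁, u, hu, h₂, h₃, h₄⟩ := Prog.mem_paths_subst hf ans ans' I cost Good hI
    (fun o l m hm w hw => hO o l m hm w hw) A [] m hm w hw
  exact hΦ u hu _ _ _ h₁ h₂.symm h₃ h₄

theorem uteDistinguisher_isQPT {N : SKNCER} {B : Prog ℕ Empty} (hN : N.reveal.IsQPT)
    (hB : B.IsQPT) : (uteDistinguisher N B).IsQPT := by
  obtain ⟨fr, hr⟩ := hN.exists_boundedBy
  obtain ⟨fb, hb⟩ := hB.exists_boundedBy
  refine Prog.isQPT_of_ensures (12 + 6 * .X + 2 * fr + 2 * fb.comp (.X + fr))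
    fun z n x y u v hz => ?_
  simp only [Polynomial.eval_add, Polynomial.eval_X, Polynomial.eval_mul, Polynomial.eval_ofNat,
    Polynomial.eval_comp]
  have h₀ : (inputPoint n x y u v).cl 0 = ones n := by simp [inputPoint, ones]
  have h₁ : (inputPoint n x y u v).cl 1 = x := by simp [inputPoint]
  have h₂ : (inputPoint n x y u v).cl 2 = y := by simp [inputPoint]
  generalize inputPoint n x y u v = m at h₀ h₁ h₂ ⊢
  obtain ⟨e₁, e₂⟩ := length_unpairCode_le x
  rw [uteDistinguisher, Prog.ensures_seq, Prog.ensures_unpair, Prog.ensures_seq]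
  refine Prog.ensures_call₃ (block_injective 1) (by simp) (by simp) (by simp) fun o₁ ho₁ t₁ ht₁ => ?_
  rw [Prog.ensures_seq]
  refine Prog.ensures_call₃ (block_injective 2) (by simp) (by simp) (by simp) fun o₂ ho₂ t₂ ht₂ => ?_
  rw [Prog.ensures_copy]
  simp [Point.overlay, setReg_apply, h₀, h₁, h₂] at ho₁ ho₂ ht₁ ht₂ ⊢
  obtain ⟨a₁, b₁⟩ := hr z n z (by omega) le_rfl _ _ (by omega) (by omega) o₁ ho₁
  have c₁ := b₁ 3
  obtain ⟨a₂, b₂⟩ := hb (z + fr.eval z) n _ (by omega) le_rfl _ _ (by omega) (by omega) o₂ ho₂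
  have c₂ := b₂ 3
  omega

section

variable {U : UTSKE} {n S W : ℕ} {E : ℕ → ℕ} {K : ℕ → Set (List Bool)}

/-- What the oracle of `nceAdversary` preserves; `l` is the list of oracle calls. -/
structure NceInvariant (K : ℕ → Set (List Bool)) (n S W : ℕ) (l : List (NCEQuery × Store ℕ))
    (m : Point ℕ) : Prop where
  param : m.cl 0 = ones n
  bound : (m.cl (block 3 4)).length ≤ W
  key : (m.cl (block 5 0)).length ≤ S
  ct : (m.cl (block 5 1)).length ≤ W
  dk : (m.cl (block 5 2)).length ≤ W
  calls : ∀ d ∈ l, d.1 = .encrypt ∧ d.2 3 ∈ K n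

/-- A bound for the time in which a reduction answers a query. -/
def answerCost (n S W : ℕ) (E : ℕ → ℕ) (e : Unit × Store ℕ) : ℕ :=
  40 + 5 * n + 5 * S + 5 * W + 2 * (e.2 3).length + 2 * (e.2 4).length +
    2 * E (S + (e.2 3).length + (e.2 4).length)

/-- The answers by fresh encryptions; the bound leaves ten steps for the selection in `slotted`. -/
theorem nceFresh_ensures (hg : U.gen.BoundedBy n 0 S)
    (hK : ∀ o ∈ U.gen.paths ∅ (inputCfg (ones n) [] []).point, o.final.cl 3 ∈ K n)
    (hE : ∀ s, U.enc.BoundedBy n s (E s)) {j : ℕ} (hj : j = 3 ∨ j = 4)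
    {l : List (NCEQuery × Store ℕ)} {m : Point ℕ} (hm : NceInvariant K n S W l m) :
    (nceFresh U j).Ensures {1, 2} m fun m' t l' => NceInvariant K n S W (l ++ l') m' ∧
      (∀ r ∉ ({1, 2} : Set ℕ), m'.cl (block 0 r) = m.cl (block 0 r) ∧
        m'.q (block 0 r) = m.q (block 0 r)) ∧
      t + 10 ≤ answerCost n S W E ((), m.cl ∘ block 0) := by
  obtain ⟨h₀, h₁, h₂, h₃, h₄, h₅⟩ := hm
  rw [nceFresh, Prog.ensures_seq]
  refine Prog.ensures_call₁ (block_injective 1) (by simp) fun o₁ ho₁ t₁ ht₁ => ?_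
  simp only [Prog.ensures_seq, Prog.ensures_copy, Prog.ensures_query]
  intro m' hm'
  rw [Prog.ensures_cut]
  refine Prog.ensures_call₃ (block_injective 2) (by simp) (by simp) (by simp) fun o₂ ho₂ t₂ ht₂ => ?_
  simp only [deliver, Prog.ensures_seq, Prog.ensures_reset_singleton, Prog.ensures_pair,
    Prog.ensures_qswap]
  have hcl : ∀ r, r ≠ 1 → r ≠ 2 → m'.cl r = _ := fun r h h' => (hm' r (by simp [h, h'])).1
  have hq : ∀ r, r ≠ 1 → r ≠ 2 → m'.q r = _ := fun r h h' => (hm' r (by simp [h, h'])).2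
  rw [h₀] at ho₁ ht₁
  rw [length_ones] at ht₁
  simp [hcl, Point.overlay, setReg_apply, h₀] at ho₂ ht₂
  obtain ⟨a₁, b₁⟩ := hg [] [] le_rfl le_rfl o₁ ho₁
  have c₁ := b₁ 3
  have hlen : (m.cl (block 0 j)).length ≤ S + (m.cl (block 0 3)).length + (m.cl (block 0 4)).length := by
    rcases hj with rfl | rfl <;> omega
  obtain ⟨a₂, b₂⟩ := hE (S + (m.cl (block 0 3)).length + (m.cl (block 0 4)).length) _ _
    (by omega) hlen o₂ ho₂
  have c₂ := b₂ 3
  refine ⟨⟨?_, ?_, ?_, ?_, ?_, ?_⟩, ?_, ?_⟩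
  · simp [hcl, Point.overlay, setReg_apply, h₀]
  · simpa [hcl, Point.overlay, setReg_apply] using h₁
  · simpa [hcl, Point.overlay, setReg_apply] using h₂
  · simpa [hcl, Point.overlay, setReg_apply] using h₃
  · simpa [hcl, Point.overlay, setReg_apply] using h₄
  · intro d hd
    rw [List.mem_append] at hd
    rcases hd with hd | hd
    · exact h₅ d hd
    · simp at hd
      subst hd
      refine ⟨rfl, ?_⟩
      simpa [Point.overlay] using hK o₁ ho₁
  · intro r hr
    have hr1 : r ≠ 1 := fun h => hr (by simp [h])
    constructor
    · simp [hcl, Point.overlay, setReg_apply, hr1]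
    · simp [hq, Point.overlay, setReg_apply, hr1, Equiv.swap_apply_def]
  · simp [hcl, Point.overlay, setReg_apply, answerCost]
    omega

end

/-- The rule for `slotted`; up to three steps are spent on the choice of the answer. -/
theorem slotted_ensures {O : Type} {ans : Set ℕ} {fresh : ℕ → Prog ℕ O} {chal : Prog ℕ O}
    {m : Point ℕ} {Φ : Point ℕ → ℕ → List (O × Store ℕ) → Prop}
    (h₁ : (fresh 4).Ensures ans ⟨setReg m.cl (block 3 3) (m.cl (block 3 3)).tail, m.q⟩
      fun m' t l => ∀ d ≤ 3, Φ m' (t + d) l)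
    (h₂ : (fresh 3).Ensures ans m fun m' t l => ∀ d ≤ 3, Φ m' (t + d) l)
    (h₃ : (m.cl (block 5 3)).head? ≠ some true →
      chal.Ensures ans ⟨setReg m.cl (block 5 3) (true :: m.cl (block 5 3)), m.q⟩
        fun m' t l => ∀ d ≤ 3, Φ m' (t + d) l) :
    (slotted fresh chal).Ensures ans m Φ := by
  rw [slotted, Prog.ensures_ite]
  split_ifs with h
  · rw [Prog.ensures_seq, Prog.ensures_pop]
    refine h₁.mono fun m' t l hΦ => ?_
    have := hΦ 2 (by omega)
    rwa [show 1 + (1 + t) = t + 2 by omega]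
  · rw [Prog.ensures_ite]
    split_ifs with h'
    · refine h₂.mono fun m' t l hΦ => ?_
      have := hΦ 2 (by omega)
      rwa [show 1 + (1 + t) = t + 2 by omega]
    · rw [Prog.ensures_seq, Prog.ensures_push]
      refine (h₃ h').mono fun m' t l hΦ => ?_
      have := hΦ 3 (by omega)
      rwa [show 1 + (1 + (1 + t)) = t + 3 by omega]

section

variable {U : UTSKE} {A : Prog ℕ Unit} {B : Prog ℕ Empty} {c k n S W R : ℕ}
  {E : ℕ → ℕ} {K : ℕ → Set (List Bool)}

theorem nceChallenge_ensures (hE : ∀ s, U.enc.BoundedBy n s (E s)) (β : Bool)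
    {l : List (NCEQuery × Store ℕ)} {m : Point ℕ} (hm : NceInvariant K n S W l m) :
    (nceChallenge U β).Ensures {1, 2} m fun m' t l' => NceInvariant K n S W (l ++ l') m' ∧
      (∀ r ∉ ({1, 2} : Set ℕ), m'.cl (block 0 r) = m.cl (block 0 r) ∧
        m'.q (block 0 r) = m.q (block 0 r)) ∧
      t + 10 ≤ answerCost n S W E ((), m.cl ∘ block 0) := by
  obtain ⟨h₀, h₁, h₂, h₃, h₄, h₅⟩ := hm
  rw [nceChallenge, Prog.ensures_seq]
  refine Prog.ensures_call₃ (block_injective 2) (by simp) (by simp) (by simp) fun o₂ ho₂ t₂ ht₂ => ?_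
  simp only [deliver, Prog.ensures_seq, Prog.ensures_reset_singleton, Prog.ensures_pair,
    Prog.ensures_qswap]
  rw [h₀] at ho₂ ht₂
  rw [length_ones] at ht₂
  have hlen : (m.cl (block 0 (msgReg β))).length ≤
      (m.cl (block 0 3)).length + (m.cl (block 0 4)).length := by
    cases β <;> simp [msgReg]
  obtain ⟨a₂, b₂⟩ := hE (S + (m.cl (block 0 3)).length + (m.cl (block 0 4)).length) _ _
    (by omega) (by omega) o₂ ho₂
  have c₂ := b₂ 3
  refine ⟨⟨?_, ?_, ?_, ?_, ?_, ?_⟩, ?_, ?_⟩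
  · simp [Point.overlay, setReg_apply, h₀]
  · simpa [Point.overlay, setReg_apply] using h₁
  · simpa [Point.overlay, setReg_apply] using h₂
  · simpa [Point.overlay, setReg_apply] using h₃
  · simpa [Point.overlay, setReg_apply] using h₄
  · simpa using h₅
  · intro r hr
    have hr1 : r ≠ 1 := fun h => hr (by simp [h])
    constructor
    · simp [Point.overlay, setReg_apply, hr1]
    · simp [Point.overlay, setReg_apply, hr1, Equiv.swap_apply_def]
  · simp [Point.overlay, setReg_apply, answerCost]
    omega

theorem nceOracle_ensures (hg : U.gen.BoundedBy n 0 S)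
    (hK : ∀ o ∈ U.gen.paths ∅ (inputCfg (ones n) [] []).point, o.final.cl 3 ∈ K n)
    (hE : ∀ s, U.enc.BoundedBy n s (E s)) (β : Bool)
    {l : List (NCEQuery × Store ℕ)} {m : Point ℕ} (hm : NceInvariant K n S W l m) :
    (slotted (nceFresh U) (nceChallenge U β)).Ensures {1, 2} m fun m' t l' =>
      NceInvariant K n S W (l ++ l') m' ∧
      (∀ r ∉ ({1, 2} : Set ℕ), m'.cl (block 0 r) = m.cl (block 0 r) ∧
        m'.q (block 0 r) = m.q (block 0 r)) ∧
      t ≤ answerCost n S W E ((), m.cl ∘ block 0) ∧ ∀ d ∈ l', True := by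
  have hset : ∀ j v, j = 3 ∨ j = 5 →
      NceInvariant K n S W l ⟨setReg m.cl (block j 3) v, m.q⟩ := by
    rintro j v (rfl | rfl) <;>
      exact ⟨by simpa [setReg_apply] using hm.param, by simpa [setReg_apply] using hm.bound,
        by simpa [setReg_apply] using hm.key, by simpa [setReg_apply] using hm.ct,
        by simpa [setReg_apply] using hm.dk, hm.calls⟩
  have hcomp : ∀ j v, j = 3 ∨ j = 5 → setReg m.cl (block j 3) v ∘ block 0 = m.cl ∘ block 0 := by
    rintro j v (rfl | rfl) <;> funext r <;> simp [setReg_apply]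
  refine slotted_ensures ?_ ?_ fun _ => ?_
  · refine (nceFresh_ensures hg hK hE (.inr rfl) (hset 3 _ (.inl rfl))).mono ?_
    rintro m' t l' ⟨a, b, c⟩ d hd
    simp only [hcomp 3 _ (.inl rfl)] at c
    refine ⟨a, fun r hr => ?_, by omega, fun _ _ => trivial⟩
    simpa [setReg_apply] using b r hr
  · refine (nceFresh_ensures hg hK hE (.inl rfl) hm).mono ?_
    rintro m' t l' ⟨a, b, c⟩ d hd
    exact ⟨a, b, by omega, fun _ _ => trivial⟩
  · refine (nceChallenge_ensures hE β (hset 5 _ (.inr rfl))).mono ?_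
    rintro m' t l' ⟨a, b, c⟩ d hd
    simp only [hcomp 5 _ (.inr rfl)] at c
    refine ⟨a, fun r hr => ?_, by omega, fun _ _ => trivial⟩
    simpa [setReg_apply] using b r hr

theorem sum_answerCost_le {S' X : ℕ} (hE : Monotone E) {l : List (Unit × Store ℕ)}
    (hl : l.length ≤ X) (hS : ∀ e ∈ l, (e.2 3).length ≤ S' ∧ (e.2 4).length ≤ S') :
    (l.map (answerCost n S W E)).sum ≤
      X * (40 + 5 * n + 5 * S + 5 * W + 4 * S' + 2 * E (S + 2 * S')) := by
  refine (List.sum_le_card_nsmul _ (40 + 5 * n + 5 * S + 5 * W + 4 * S' + 2 * E (S + 2 * S'))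
    fun x hx => ?_).trans ?_
  · obtain ⟨e, he, rfl⟩ := List.mem_map.1 hx
    obtain ⟨h₃, h₄⟩ := hS e he
    have := hE (show S + (e.2 3).length + (e.2 4).length ≤ S + 2 * S' by omega)
    simp only [answerCost]
    omega
  · rw [List.length_map, smul_eq_mul]
    exact Nat.mul_le_mul_right _ hl

/-- A bound for the running time of a reduction. `X` bounds the time and the number of queries of the
first-stage adversary, and `R` the time of the second-stage adversary. -/
def reductionTime (n S W X R : ℕ) (E : ℕ → ℕ) : ℕ :=
  100 + 20 * n + 20 * S + 20 * W + 20 * X + 20 * R +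
    X * (40 + 5 * n + 5 * S + 5 * W + 4 * S + 2 * E (S + 2 * S))

/-- `nceAdversary` runs in polynomial time and makes one challenge query, at the outset; all further
queries encrypt one-time keys. -/
theorem nceAdversary_ensures {X : ℕ} (hs : (sampler c k).BoundedBy n 0 W)
    (hg : U.gen.BoundedBy n 0 S)
    (hK : ∀ o ∈ U.gen.paths ∅ (inputCfg (ones n) [] []).point, o.final.cl 3 ∈ K n)
    (hE : ∀ s, U.enc.BoundedBy n s (E s)) (hE' : Monotone E) (β : Bool)
    (hA : ∀ o ∈ A.paths {1, 2} (inputCfg (ones n) [] []).point, o.time ≤ X ∧ o.calls.length ≤ X ∧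
      (o.final.cl 3).length ≤ X ∧ ∀ e ∈ o.calls, (e.2 3).length ≤ S ∧ (e.2 4).length ≤ S)
    (hB : B.BoundedBy n (X + W) R) {m : Point ℕ} (hm₀ : m.cl 0 = ones n)
    (hmb : ∀ j r, m.cl (block j r) = [] ∧ m.q (block j r) = []) :
    (nceAdversary U A B c k β).Ensures {1, 2} m fun _ t l =>
      t ≤ reductionTime n S W X R E ∧ nceQueriesIn K n l := by
  rw [nceAdversary, Prog.ensures_seq]
  refine Prog.ensures_call₁ (block_injective 3) (by simp) fun o₁ ho₁ t₁ ht₁ => ?_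
  rw [Prog.ensures_seq]
  refine Prog.ensures_call₁ (block_injective 1) (by simp) fun o₂ ho₂ t₂ ht₂ => ?_
  simp only [Prog.ensures_seq, Prog.ensures_copy, Prog.ensures_query]
  intro m' hm'
  simp only [Prog.ensures_cut]
  have hcl : ∀ r, r ≠ 1 → r ≠ 2 → m'.cl r = _ := fun r h h' => (hm' r (by simp [h, h'])).1
  have hq : ∀ r, r ≠ 1 → r ≠ 2 → m'.q r = _ := fun r h h' => (hm' r (by simp [h, h'])).2
  simp [Point.overlay, hm₀] at ho₁ ho₂ ht₁ ht₂
  obtain ⟨a₁, b₁⟩ := hs [] [] le_rfl le_rfl o₁ ho₁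
  obtain ⟨a₂, b₂⟩ := hg [] [] le_rfl le_rfl o₂ ho₂
  have c₁ := b₁ 4
  have c₂ := b₂ 3
  refine Prog.ensures_subst (block_injective 0) {1, 2} (NceInvariant K n S W)
    (answerCost n S W E) (fun _ _ => True) ?_ (fun _ l m hm => nceOracle_ensures hg hK hE β hm) A
    ?_ ?_
  · intro l m m' h hm
    have hne : ∀ j s, j ≠ 0 → block j s ∉ Set.range (block 0) := by
      rintro j s hj ⟨r, hr⟩
      exact hj (block_eq_block.1 hr).1.symm
    have h0 : 0 ∉ Set.range (block 0) := by
      rintro ⟨r, hr⟩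
      have := five_le_block 0 r
      omega
    obtain ⟨h₀, h₁, h₂, h₃, h₄, h₅⟩ := hm
    exact ⟨(h _ h0).1.trans h₀, by rwa [(h _ (hne 3 4 (by omega))).1],
      by rwa [(h _ (hne 5 0 (by omega))).1], by rwa [(h _ (hne 5 1 (by omega))).1],
      by rwa [(h _ (hne 5 2 (by omega))).1], h₅⟩
  · refine ⟨?_, ?_, ?_, ?_, ?_, by simp⟩
    · simp [hcl, Point.overlay, setReg_apply, hm₀]
    · simpa [hcl, Point.overlay, setReg_apply] using c₁
    · simpa [hcl, Point.overlay, setReg_apply] using c₂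
    · simp [hcl, Point.overlay, setReg_apply, c₁]
    · simp [hcl, Point.overlay, setReg_apply, c₁]
  · intro u hu m'' t l hI hf ht _
    rw [show Point.restrict (block 0) _ = (inputCfg (ones n) [] []).point from ?_] at hu
    · obtain ⟨x₁, x₂, x₃, x₄⟩ := hA u hu
      have hsum := sum_answerCost_le (n := n) (S := S) (W := W) hE' x₂ x₄
      obtain ⟨h₀, h₁, h₂, h₃, h₄, h₅⟩ := hI
      have hst : (m''.cl (block 0 3)).length ≤ X := by
        rw [← hf] at x₃; exact x₃
      refine Prog.ensures_call₃ (block_injective 4) (by simp) (by simp) (by simp)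
        fun o₃ ho₃ t₃ ht₃ => ?_
      rw [h₀] at ho₃ ht₃
      rw [length_ones] at ht₃
      obtain ⟨a₃, b₃⟩ := hB _ _ (by omega) (by omega) o₃ ho₃
      have c₃ := b₃ 3
      constructor
      · simp [hcl, Point.overlay, setReg_apply, hm₀, reductionTime]
        generalize X * (_ + _) = D at hsum ⊢
        have hcut : ∀ w : List Bool, min (o₁.final.cl 4).length w.length ≤ W :=
          fun w => (min_le_left _ _).trans c₁
        have d₁ := hcut (m'.cl 1)
        have d₂ := hcut (m'.cl 2)
        omega
      · have hl : ∀ d ∈ l, d.1 = .encrypt := fun d hd => (h₅ d hd).1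
        simp [Point.overlay, nceQueriesIn]
        refine ⟨⟨by simpa [setReg_apply] using hK o₂ ho₂, fun a b hab => (h₅ (a, b) hab).2⟩,
          fun a b hab h => ?_, ?_⟩
        · exact absurd (hl _ hab) (by simp [h])
        · exact List.pairwise_of_forall_mem_list fun d hd e _ h => by
            simp [hl d hd] at h
    · simp only [Point.restrict, inputCfg, Cfg.point, Point.mk.injEq]
      constructor <;> funext r
      · simp [hcl, Point.overlay, setReg_apply, hm₀, hmb, inputStore]
      · simp [hq, Point.overlay, hmb]

end

section

variable {U : UTSKE} {N : SKNCER} {A : Prog ℕ Unit} {c k n S T Q W : ℕ}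
  {E : ℕ → ℕ} {M : ℕ → Set (List Bool)}

/-- What the oracle of `uteAdversary` preserves; `l` is the list of oracle calls. -/
structure UteInvariant (n S T W : ℕ) (l : List (Unit × Store ℕ)) (m : Point ℕ) : Prop where
  param : m.cl 0 = ones n
  bound : (m.cl (block 3 4)).length ≤ W
  ek : (m.cl (block 6 3)).length ≤ S
  ct : (m.cl (block 7 3)).length ≤ T
  state : (m.cl (block 7 4)).length ≤ T
  calls : l = [] ∨ l.length ≤ 1 ∧ (m.cl (block 5 3)).head? = some true

/-- The answers by fresh encryptions do not use the oracle. -/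
theorem uteFresh_ensures (hg : U.gen.BoundedBy n 0 S) (hn : N.enc.BoundedBy n S Q)
    (hE : ∀ s, U.enc.BoundedBy n s (E s)) {j : ℕ} (hj : j = 3 ∨ j = 4)
    {l : List (Unit × Store ℕ)} {m : Point ℕ} (hm : UteInvariant n S T W l m) :
    (uteFresh U N j).Ensures {1, 2} m fun m' t l' => (l' = [] ∧ UteInvariant n S T W l m') ∧
      (∀ r ∉ ({1, 2} : Set ℕ), m'.cl (block 0 r) = m.cl (block 0 r) ∧
        m'.q (block 0 r) = m.q (block 0 r)) ∧
      t + 10 ≤ answerCost n S (T + W + Q) E ((), m.cl ∘ block 0) := by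
  obtain ⟨h₀, h₁, h₂, h₃, h₄, h₅⟩ := hm
  rw [uteFresh, Prog.ensures_seq]
  refine Prog.ensures_call₁ (block_injective 1) (by simp) fun o₁ ho₁ t₁ ht₁ => ?_
  rw [Prog.ensures_seq]
  refine Prog.ensures_call₃ (block_injective 8) (by simp) (by simp) (by simp) fun o₃ ho₃ t₃ ht₃ => ?_
  rw [Prog.ensures_seq]
  refine Prog.ensures_call₃ (block_injective 2) (by simp) (by simp) (by simp) fun o₂ ho₂ t₂ ht₂ => ?_
  simp only [deliver, Prog.ensures_seq, Prog.ensures_reset_singleton, Prog.ensures_pair,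
    Prog.ensures_qswap]
  simp [Point.overlay, h₀] at ho₁ ho₂ ho₃ ht₁ ht₂ ht₃
  obtain ⟨a₁, b₁⟩ := hg [] [] le_rfl le_rfl o₁ ho₁
  have c₁ := b₁ 3
  obtain ⟨a₃, b₃⟩ := hn _ _ h₂ c₁ o₃ ho₃
  have c₃ := b₃ 3
  have hlen : (m.cl (block 0 j)).length ≤ S + (m.cl (block 0 3)).length + (m.cl (block 0 4)).length := by
    rcases hj with rfl | rfl <;> omega
  obtain ⟨a₂, b₂⟩ := hE (S + (m.cl (block 0 3)).length + (m.cl (block 0 4)).length) _ _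
    (by omega) hlen o₂ ho₂
  have c₂ := b₂ 3
  refine ⟨⟨by simp, ?_, ?_, ?_, ?_, ?_, ?_⟩, ?_, ?_⟩
  · simp [Point.overlay, setReg_apply, h₀]
  · simpa [Point.overlay, setReg_apply] using h₁
  · simpa [Point.overlay, setReg_apply] using h₂
  · simpa [Point.overlay, setReg_apply] using h₃
  · simpa [Point.overlay, setReg_apply] using h₄
  · simpa [Point.overlay, setReg_apply] using h₅
  · intro r hr
    have hr1 : r ≠ 1 := fun h => hr (by simp [h])
    constructor
    · simp [Point.overlay, setReg_apply, hr1]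
    · simp [Point.overlay, setReg_apply, hr1, Equiv.swap_apply_def]
  · simp [Point.overlay, setReg_apply, answerCost]
    omega

/-- The oracle is asked for an encryption of the two messages that the adversary has supplied. -/
theorem uteChallenge_ensures {m : Point ℕ} (hm : UteInvariant n S T W [] m)
    (hb : (m.cl (block 5 3)).head? = some true) :
    uteChallenge.Ensures {1, 2} m fun m' t l' => UteInvariant n S T W l' m' ∧
      (∀ r ∉ ({1, 2} : Set ℕ), m'.cl (block 0 r) = m.cl (block 0 r) ∧
        m'.q (block 0 r) = m.q (block 0 r)) ∧
      t + 10 ≤ answerCost n S (T + W + Q) E ((), m.cl ∘ block 0) ∧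
      ∀ d ∈ l', d.2 3 = m.cl (block 0 3) ∧ d.2 4 = m.cl (block 0 4) := by
  obtain ⟨h₀, h₁, h₂, h₃, h₄, -⟩ := hm
  simp only [uteChallenge, Prog.ensures_seq, Prog.ensures_copy, Prog.ensures_query]
  intro m' hm'
  simp only [Prog.ensures_cut, Prog.ensures_reset_singleton, Prog.ensures_pair,
    Prog.ensures_qswap]
  have hcl : ∀ r, r ≠ 1 → r ≠ 2 → m'.cl r = _ := fun r h h' => (hm' r (by simp [h, h'])).1
  have hq : ∀ r, r ≠ 1 → r ≠ 2 → m'.q r = _ := fun r h h' => (hm' r (by simp [h, h'])).2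
  refine ⟨⟨?_, ?_, ?_, ?_, ?_, ?_⟩, ?_, ?_, ?_⟩
  · simp [hcl, setReg_apply, h₀]
  · simpa [hcl, setReg_apply] using h₁
  · simpa [hcl, setReg_apply] using h₂
  · simpa [hcl, setReg_apply] using h₃
  · simpa [hcl, setReg_apply] using h₄
  · simp [hcl, setReg_apply, hb]
  · intro r hr
    have hr1 : r ≠ 1 := fun h => hr (by simp [h])
    constructor
    · simp [hcl, setReg_apply, hr1]
    · simp [hq, setReg_apply, hr1, Equiv.swap_apply_def]
  · have hcut := (min_le_left _ (m'.cl 1).length).trans h₁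
    simp [hcl, setReg_apply, answerCost]
    omega
  · simp [setReg_apply]

theorem uteOracle_ensures (hg : U.gen.BoundedBy n 0 S) (hn : N.enc.BoundedBy n S Q)
    (hE : ∀ s, U.enc.BoundedBy n s (E s)) {l : List (Unit × Store ℕ)} {m : Point ℕ}
    (hm : UteInvariant n S T W l m) :
    (slotted (uteFresh U N) uteChallenge).Ensures {1, 2} m fun m' t l' =>
      UteInvariant n S T W (l ++ l') m' ∧
      (∀ r ∉ ({1, 2} : Set ℕ), m'.cl (block 0 r) = m.cl (block 0 r) ∧
        m'.q (block 0 r) = m.q (block 0 r)) ∧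
      t ≤ answerCost n S (T + W + Q) E ((), m.cl ∘ block 0) ∧
      ∀ d ∈ l', d.2 3 = m.cl (block 0 3) ∧ d.2 4 = m.cl (block 0 4) := by
  have hcomp : ∀ j v, j = 3 ∨ j = 5 → setReg m.cl (block j 3) v ∘ block 0 = m.cl ∘ block 0 := by
    rintro j v (rfl | rfl) <;> funext r <;> simp [setReg_apply]
  obtain ⟨h₀, h₁, h₂, h₃, h₄, h₅⟩ := id hm
  refine slotted_ensures ?_ ?_ fun hb => ?_
  · refine (uteFresh_ensures (T := T) (W := W) (l := l) hg hn hE (.inr rfl)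
      (by constructor <;> simpa [setReg_apply])).mono ?_
    rintro m' t l' ⟨⟨rfl, a⟩, b, c⟩ d hd
    simp only [hcomp 3 _ (.inl rfl)] at c
    refine ⟨by simpa using a, fun r hr => ?_, by omega, by simp⟩
    simpa [setReg_apply] using b r hr
  · refine (uteFresh_ensures hg hn hE (.inl rfl) hm).mono ?_
    rintro m' t l' ⟨⟨rfl, a⟩, b, c⟩ d hd
    exact ⟨by simpa using a, b, by omega, by simp⟩
  -- The flag in `block 5 3` is not yet set, hence the oracle has not been called before.
  · obtain rfl : l = [] := h₅.resolve_right fun h => hb h.2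
    refine (uteChallenge_ensures (E := E) (Q := Q) (T := T) (W := W) (S := S) (n := n)
      ⟨by simpa [setReg_apply], by simpa [setReg_apply], by simpa [setReg_apply],
        by simpa [setReg_apply], by simpa [setReg_apply], .inl rfl⟩
      (by simp)).mono ?_
    rintro m' t l' ⟨a, b, c, e⟩ d hd
    simp only [hcomp 5 _ (.inr rfl)] at c
    refine ⟨a, fun r hr => ?_, by omega, ?_⟩
    · simpa [setReg_apply] using b r hr
    · simpa [setReg_apply] using e

/-- `uteAdversary` runs in polynomial time and makes at most one query, which is a query of `A`. -/
theorem uteAdversary_ensures {X : ℕ} (hs : (sampler c k).BoundedBy n 0 W)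
    (hg : U.gen.BoundedBy n 0 S) (hkg : N.kg.BoundedBy n 0 S) (hf : N.fake.BoundedBy n S T)
    (hn : N.enc.BoundedBy n S Q) (hE : ∀ s, U.enc.BoundedBy n s (E s)) (hE' : Monotone E)
    (hA : ∀ o ∈ A.paths {1, 2} (inputCfg (ones n) [] []).point, (o.time ≤ X ∧ o.calls.length ≤ X ∧
      (o.final.cl 3).length ≤ X ∧ ∀ e ∈ o.calls, (e.2 3).length ≤ S ∧ (e.2 4).length ≤ S) ∧
      queriesIn M n o.calls)
    {m : Point ℕ} (hm₀ : m.cl 0 = ones n) (hmb : ∀ j r, m.cl (block j r) = [] ∧ m.q (block j r) = []) :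
    (uteAdversary U N A c k).Ensures {1, 2} m fun _ t l =>
      t ≤ reductionTime n S (T + W + Q) X 0 E ∧ queriesIn M n l ∧ l.length ≤ 1 := by
  rw [uteAdversary, Prog.ensures_seq]
  refine Prog.ensures_call₁ (block_injective 3) (by simp) fun o₁ ho₁ t₁ ht₁ => ?_
  rw [Prog.ensures_seq]
  refine Prog.ensures_call₁ (block_injective 6) (by simp) fun o₂ ho₂ t₂ ht₂ => ?_
  rw [Prog.ensures_seq]
  refine Prog.ensures_call₂ (block_injective 7) (by simp) (by simp) fun o₃ ho₃ t₃ ht₃ => ?_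
  simp only [Prog.ensures_seq, Prog.ensures_copy, Prog.ensures_pair]
  simp [Point.overlay, hm₀] at ho₁ ho₂ ho₃ ht₁ ht₂ ht₃
  obtain ⟨a₁, b₁⟩ := hs [] [] le_rfl le_rfl o₁ ho₁
  obtain ⟨a₂, b₂⟩ := hkg [] [] le_rfl le_rfl o₂ ho₂
  have c₁ := b₁ 4
  have c₂ := b₂ 3
  obtain ⟨a₃, b₃⟩ := hf _ [] c₂ (Nat.zero_le _) o₃ ho₃
  have c₃ := b₃ 3
  have c₄ := b₃ 4
  refine Prog.ensures_subst (block_injective 0) {1, 2} (UteInvariant n S T W)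
    (answerCost n S (T + W + Q) E) (fun e d => d.2 3 = e.2 3 ∧ d.2 4 = e.2 4) ?_
    (fun _ l m hm => uteOracle_ensures hg hn hE hm) A ?_ ?_
  · intro l m m' h hm
    have hne : ∀ j s, j ≠ 0 → block j s ∉ Set.range (block 0) := by
      rintro j s hj ⟨r, hr⟩
      exact hj (block_eq_block.1 hr).1.symm
    have h0 : 0 ∉ Set.range (block 0) := by
      rintro ⟨r, hr⟩
      have := five_le_block 0 r
      omega
    obtain ⟨h₀, h₁, h₂, h₃, h₄, h₅⟩ := hm
    exact ⟨(h _ h0).1.trans h₀, by rwa [(h _ (hne 3 4 (by omega))).1],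
      by rwa [(h _ (hne 6 3 (by omega))).1], by rwa [(h _ (hne 7 3 (by omega))).1],
      by rwa [(h _ (hne 7 4 (by omega))).1], by rwa [(h _ (hne 5 3 (by omega))).1]⟩
  · refine ⟨?_, ?_, ?_, ?_, ?_, .inl rfl⟩
    · simp [Point.overlay, setReg_apply, hm₀]
    · simpa [Point.overlay, setReg_apply] using c₁
    · simpa [Point.overlay, setReg_apply] using c₂
    · simpa [Point.overlay, setReg_apply] using c₃
    · simpa [Point.overlay, setReg_apply] using c₄
  · intro u hu m'' t l hI hf ht hl
    rw [show Point.restrict (block 0) _ = (inputCfg (ones n) [] []).point from ?_] at hu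
    · obtain ⟨⟨x₁, x₂, x₃, x₄⟩, x₅⟩ := hA u hu
      have hsum := sum_answerCost_le (n := n) (S := S) (W := T + W + Q) hE' x₂ x₄
      obtain ⟨h₀, h₁, h₂, h₃, h₄, h₅⟩ := hI
      have hst : (m''.cl (block 0 3)).length ≤ X := by
        rw [← hf] at x₃; exact x₃
      refine ⟨?_, ?_, ?_⟩
      · simp [Point.overlay, hm₀, reductionTime]
        generalize X * (_ + _) = D at hsum ⊢
        omega
      · intro d hd
        obtain ⟨e, he, h⟩ := hl d (by simpa using hd)
        rw [h.1, h.2]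
        exact x₅ e he
      · rcases h₅ with rfl | h₅
        · simp
        · simpa using h₅.1
    · simp only [Point.restrict, inputCfg, Cfg.point, Point.mk.injEq]
      constructor <;> funext r
      · simp [Point.overlay, setReg_apply, hm₀, hmb, inputStore]
      · simp [Point.overlay, hmb]

end

/-! ### Polynomial bounds -/

theorem Prog.BoundedBy.mono {p : Prog ℕ Empty} {n s t s' t' : ℕ} (h : p.BoundedBy n s t)
    (hs : s' ≤ s) (ht : t ≤ t') : p.BoundedBy n s' t' := fun x y hx hy o ho =>
  ⟨(h x y (hx.trans hs) (hy.trans hs) o ho).1.trans ht,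
    fun r => ((h x y (hx.trans hs) (hy.trans hs) o ho).2 r).trans ht⟩

/-- Polynomials are bounded by the functions that the sampler can compute. -/
theorem exists_eval_le_pow (p : Polynomial ℕ) : ∃ c k : ℕ, ∀ n, p.eval n ≤ (n + c) ^ k := by
  induction p using Polynomial.induction_on' with
  | add p q hp hq =>
    obtain ⟨c, k, hp⟩ := hp
    obtain ⟨c', k', hq⟩ := hq
    refine ⟨c + c' + 2, k + k' + 1, fun n => ?_⟩
    have h₁ : (n + c) ^ k ≤ (n + (c + c' + 2)) ^ (k + k') :=
      (Nat.pow_le_pow_left (by omega) k).trans (Nat.pow_le_pow_right (by omega) (by omega))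
    have h₂ : (n + c') ^ k' ≤ (n + (c + c' + 2)) ^ (k + k') :=
      (Nat.pow_le_pow_left (by omega) k').trans (Nat.pow_le_pow_right (by omega) (by omega))
    rw [Polynomial.eval_add, pow_succ]
    have := Nat.mul_le_mul_left ((n + (c + c' + 2)) ^ (k + k'))
      (show 2 ≤ n + (c + c' + 2) by omega)
    have := hp n
    have := hq n
    omega
  | monomial j a =>
    refine ⟨a, j + 1, fun n => ?_⟩
    rw [Polynomial.eval_monomial, pow_succ', ]
    exact Nat.mul_le_mul (by omega) (Nat.pow_le_pow_left (by omega) j)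

theorem length_inputCfg_le (n r : ℕ) :
    ((inputCfg (ones n) [] []).point.cl r).length ≤ n := by
  simp only [inputCfg, Cfg.point, inputStore]
  split_ifs <;> simp

/-- All lengths that occur in the games are polynomially bounded. -/
theorem exists_sizeBounds {U : UTSKE} {N : SKNCER} {A : Prog ℕ Unit} (hU : U.IsQPT) (hN : N.IsQPT)
    (hA : A.IsOracleQPT) : ∃ (pS pT : Polynomial ℕ) (c k : ℕ),
      ∀ n, SizeBounds U N A n (pS.eval n) (pT.eval n) ((n + c) ^ k) := by
  obtain ⟨fa, ha⟩ := hA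
  obtain ⟨fg, hg⟩ := hU.1.exists_boundedBy
  obtain ⟨fu, hu⟩ := hU.2.1.exists_boundedBy
  obtain ⟨fk, hk⟩ := hN.1.exists_boundedBy
  obtain ⟨fn, hn⟩ := hN.2.1.exists_boundedBy
  obtain ⟨ff, hf⟩ := hN.2.2.2.1.exists_boundedBy
  obtain ⟨fr, hr⟩ := hN.2.2.2.2.exists_boundedBy
  set pS : Polynomial ℕ := fg + fk + (.X + 2 * fa) with hS
  set pT : Polynomial ℕ := pS + ff.comp (.X + pS) with hT
  -- The sampler outputs the bound `(n + c) ^ k` in unary, hence a bound of this form.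
  obtain ⟨c, k, hck⟩ := exists_eval_le_pow (pT + fu.comp (.X + pS) + fn.comp (.X + pS) +
    fr.comp (.X + pT))
  refine ⟨pS, pT, c, k, fun n => ?_⟩
  have hQ := hck n
  have eS : pS.eval n = fg.eval n + fk.eval n + (n + 2 * fa.eval n) := by simp [hS]
  have eT : pT.eval n = pS.eval n + ff.eval (n + pS.eval n) := by simp [hT]
  simp only [Polynomial.eval_add, Polynomial.eval_X, Polynomial.eval_comp] at hQ
  generalize pS.eval n = S at *
  generalize pT.eval n = T at *
  refine ⟨(hg n n 0 le_rfl (Nat.zero_le _)).mono le_rfl (by omega),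
    (hk n n 0 le_rfl (Nat.zero_le _)).mono le_rfl (by omega),
    (hf (n + S) n S (by omega) (by omega)).mono le_rfl (by omega),
    (hu (n + S) n S (by omega) (by omega)).mono le_rfl (by omega),
    (hn (n + S) n S (by omega) (by omega)).mono le_rfl (by omega),
    (hr (n + T) n T (by omega) (by omega)).mono le_rfl (by omega), by omega, by omega,
    fun o ho => ?_⟩
  have ht := ha n o (by rw [inputPoint_eq]; exact ho)
  obtain ⟨h₁, h₂, h₃⟩ := A.length_le_of_mem_paths {1, 2} n _ (fun r _ => length_inputCfg_le n r) o ho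
  refine ⟨by omega, by omega, (h₁ 3 (by simp)).trans (by omega), fun e he => ?_⟩
  exact ⟨(h₂ e he 3 (by simp)).trans (by omega), (h₂ e he 4 (by simp)).trans (by omega)⟩

theorem sampler_boundedBy (c k : ℕ) : ∃ f : Polynomial ℕ, ∀ n, (sampler c k).BoundedBy n 0 (f.eval n) := by
  refine ⟨.X + 2 * (.X + c + (.X + c + 1) ^ k + (.X + c) ^ k + 4 +
    ((.X + c) ^ k * (5 * (.X + c) ^ k + 6) + 1)), fun n x y hx hy o ho => ?_⟩
  obtain rfl : x = [] := List.eq_nil_of_length_eq_zero (by omega)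
  obtain rfl : y = [] := List.eq_nil_of_length_eq_zero (by omega)
  have ht := sampler_time c k n o ho
  simp only [Polynomial.eval_add, Polynomial.eval_mul, Polynomial.eval_pow, Polynomial.eval_X,
    Polynomial.eval_natCast, Polynomial.eval_ofNat, Polynomial.eval_one, Nat.cast_id]
  refine ⟨by omega, fun r => ?_⟩
  have := ((sampler c k).length_le_of_mem_paths ∅ n _ (fun r _ => length_inputCfg_le n r) o ho).1 r
    (Set.notMem_empty r)
  omega

theorem exists_eval_eq_reductionTime (pS pW pX pR fu : Polynomial ℕ) : ∃ f : Polynomial ℕ, ∀ n,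
    f.eval n = reductionTime n (pS.eval n) (pW.eval n) (pX.eval n) (pR.eval n)
      (fun s => fu.eval (n + s)) :=
  ⟨100 + 20 * .X + 20 * pS + 20 * pW + 20 * pX + 20 * pR +
    pX * (40 + 5 * .X + 5 * pS + 5 * pW + 4 * pS + 2 * fu.comp (.X + (pS + 2 * pS))),
    fun n => by simp [reductionTime]⟩

/-! ### Collusion-resistant security -/

section

variable {U : UTSKE} {N : SKNCER} {A : Prog ℕ Unit} {B : Prog ℕ Empty} {pS pT : Polynomial ℕ}
  {c k : ℕ} {M K : ℕ → Set (List Bool)}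

theorem inputCfg_block (n j r : ℕ) : (inputCfg (ones n) [] []).point.cl (block j r) = [] ∧
    (inputCfg (ones n) [] []).point.q (block j r) = [] := by
  have := five_le_block j r
  refine ⟨?_, rfl⟩
  simp only [inputCfg, Cfg.point, inputStore]
  rw [if_neg (by omega), if_neg (by omega), if_neg (by omega)]

theorem nceAdversary_admissible
    (h : ∀ n, SizeBounds U N A n (pS.eval n) (pT.eval n) ((n + c) ^ k)) (hU : U.enc.IsQPT)
    (hB : B.IsQPT) (hK : U.KeysIn K) (β : Bool) :
    (nceAdversary U A B c k β).IsOracleQPT ∧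
      (nceAdversary U A B c k β).CallsSatisfy (nceQueriesIn K) := by
  obtain ⟨fu, hu⟩ := hU.exists_boundedBy
  obtain ⟨fb, hb⟩ := hB.exists_boundedBy
  obtain ⟨pW, hW⟩ := sampler_boundedBy c k
  obtain ⟨f, hf⟩ := exists_eval_eq_reductionTime pS pW ((.X + c) ^ k)
    (fb.comp (.X + ((.X + c) ^ k + pW))) fu
  have key : ∀ n, (nceAdversary U A B c k β).Ensures {1, 2} (inputPoint n [] [] [] []) fun _ t l =>
      t ≤ f.eval n ∧ nceQueriesIn K n l := by
    intro n
    rw [inputPoint_eq, hf]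
    simp only [Polynomial.eval_add, Polynomial.eval_comp, Polynomial.eval_pow, Polynomial.eval_X,
      Polynomial.eval_natCast, Nat.cast_id]
    refine nceAdversary_ensures (hW n) (h n).gen (fun o ho => hK n o ?_)
      (fun s => hu (n + s) n s (by omega) (by omega)) (fun a b hab => eval_mono_nat fu (by omega)) β
      (h n).calls (hb _ n _ (by omega) (by omega)) rfl (inputCfg_block n)
    rw [inputPoint_eq]
    exact ho
  exact ⟨⟨f, fun n o ho => (key n o ho).1⟩, fun n o ho => (key n o ho).2⟩

theorem uteAdversary_admissible
    (h : ∀ n, SizeBounds U N A n (pS.eval n) (pT.eval n) ((n + c) ^ k)) (hU : U.enc.IsQPT)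
    (hA : A.CallsSatisfy (queriesIn M)) :
    (uteAdversary U N A c k).IsOracleQPT ∧
      (uteAdversary U N A c k).CallsSatisfy fun n l => queriesIn M n l ∧ l.length ≤ 1 := by
  obtain ⟨fu, hu⟩ := hU.exists_boundedBy
  obtain ⟨pW, hW⟩ := sampler_boundedBy c k
  obtain ⟨f, hf⟩ := exists_eval_eq_reductionTime pS (pT + pW + (.X + c) ^ k) ((.X + c) ^ k) 0 fu
  have key : ∀ n, (uteAdversary U N A c k).Ensures {1, 2} (inputPoint n [] [] [] []) fun _ t l =>
      t ≤ f.eval n ∧ queriesIn M n l ∧ l.length ≤ 1 := by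
    intro n
    rw [inputPoint_eq, hf]
    simp only [Polynomial.eval_add, Polynomial.eval_pow, Polynomial.eval_X, Polynomial.eval_zero,
      Polynomial.eval_natCast, Nat.cast_id]
    refine uteAdversary_ensures (hW n) (h n).gen (h n).kg (h n).fake (h n).nenc
      (fun s => hu (n + s) n s (by omega) (by omega)) (fun a b hab => eval_mono_nat fu (by omega))
      (fun o ho => ⟨(h n).calls o ho, hA n o ?_⟩) rfl (inputCfg_block n)
    rw [inputPoint_eq]
    exact ho
  exact ⟨⟨f, fun n o ho => (key n o ho).1⟩, fun n o ho => (key n o ho).2⟩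

end

theorem mainTheorem4 (M K : ℕ → Set (List Bool)) (U : UTSKE) (N : SKNCER)
    (hU : U.IsQPT) (hN : N.IsQPT) (hK : U.KeysIn K)
    (hUsec : U.IndSecure M) (hNsec : N.NonCommitting K) :
    (crUTE U N).IsQPT ∧ (crUTE U N).CollusionResistant M := by
  refine ⟨⟨hN.1, crEnc_isQPT hU hN, crDec_isQPT hU hN⟩, fun A B hA hB hAM => ?_⟩
  obtain ⟨pS, pT, c, k, h⟩ := exists_sizeBounds (U := U) (N := N) hU hN hA
  have h₀ := nceAdversary_admissible h hU.2.1 hB hK false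
  have h₁ := nceAdversary_admissible h hU.2.1 hB hK true
  have h₂ := uteAdversary_admissible h hU.2.1 hAM
  have hsum := ((hNsec _ h₀.1 h₀.2).add
    (hUsec _ _ h₂.1 (uteDistinguisher_isQPT hN.2.2.2.2 hB) h₂.2)).add (hNsec _ h₁.1 h₁.2)
  refine (hsum.polynomial_mul (2 * (.X + .C (c : ℝ)) ^ k + 1)).trans_abs_le fun n => ?_
  rw [crUTE_advantage (h n), abs_abs, abs_mul, abs_mul]
  have hD : ((samplerRange ((n + c) ^ k) : ℕ) : ℝ) ≤ 2 * ((n : ℝ) + c) ^ k + 1 := by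
    exact_mod_cast (samplerRange_spec ((n + c) ^ k)).2
  have hev : (2 * (.X + .C (c : ℝ)) ^ k + 1 : Polynomial ℝ).eval (n : ℝ) =
      2 * ((n : ℝ) + c) ^ k + 1 := by simp
  rw [hev]
  refine mul_le_mul ?_ ?_ (abs_nonneg _) (abs_nonneg _)
  · rw [Nat.abs_cast]
    exact hD.trans (le_abs_self _)
  · refine le_trans ?_ (le_abs_self _)
    exact (abs_sub _ _).trans (add_le_add_left (abs_add_le _ _) _)

end
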